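/- Let $d\ge 2$, $Q=[0,1]^d\subset\mathbb R^d$ (Euclidean norm, Lebesgue measure). For a Lipschitz function $f\colon Q\to\mathbb R$ let $\operatorname{Lip}(f)$ be its least Lipschitz constant and $\|f\|_L=\max\{\|f\|_\infty,\operatorname{Lip}(f)\}$. A *formal Lipschitz sum* $\sum_i(f_i,\pi_i)$ is a sequence of Lipschitz functions $f_i\colon Q\to\mathbb R$ and Lipschitz maps $\pi_i=(\pi_i^1,\dots,\pi_i^d)\colon Q\to\mathbb R^d$, $i\in\mathbb N$, with $$s\Big(\sum_i(f_i,\pi_i)\Big):=\sum_i\|f_i\|_L\prod_{j=1}^d\operatorname{Lip}(\pi_i^j)<\infty .$$ It *solves the equation with right-hand side* $\rho\in L^\infty(Q)$ if $\sum_i f_i\det\mathrm D\pi_i=\rho$ a.e. on $Q$, with absolute convergence in $L^\infty(Q)$. The weak$^*$ topology on $L^\infty(Q)$ is that of the duality $L^\infty(Q)=L^1(Q)^*$. **Theorem.** For every $\sigma\in L^\infty(Q)$ with $\|\sigma\|_\infty\le 2$, every weak$^*$ open neighbourhood $V\subset L^\infty(Q)$ of $\sigma$ and every real $S\ge 0$,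 there exist a smooth $\rho_0\in V$ (the restriction to $Q$ of a $C^\infty$ function on $\mathbb R^d$) with $\|\rho_0\|_\infty\le 2$ and a weak$^*$ open set $U\subset L^\infty(Q)$ containing $\rho_0$ such that, for every $\rho\in U$, every formal Lipschitz sum $\sum_i(f_i,\pi_i)$ that solves the equation with right-hand side $\rho$ satisfies $$s\Big(\sum_i(f_i,\pi_i)\Big)>S .$$ -/

import Mathlib

open MeasureTheory
open scoped NNReal ENNReal Topology

noncomputable section

namespace PrescribedJacobian

/-- The Euclidean space `ℝ^d`. -/
abbrev E (d : ℕ) : Type := EuclideanSpace ℝ (Fin d)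

/-- The closed unit cube `Q = [0,1]^d`. -/
def cube (d : ℕ) : Set (E d) := {x | ∀ j, x j ∈ Set.Icc (0 : ℝ) 1}

/-- Lebesgue measure on the cube. -/
def cubeMeasure (d : ℕ) : Measure (E d) := volume.restrict (cube d)

/-- The Banach space `L^∞(Q)`. -/
abbrev Linfty (d : ℕ) : Type := Lp ℝ ∞ (cubeMeasure d)

/-- The Banach space `L^1(Q)`, the predual of `L^∞(Q)`. -/
abbrev Lone (d : ℕ) : Type := Lp ℝ 1 (cubeMeasure d)

/-- The weak-star topology on `L^∞(Q) = L^1(Q)^*`: the coarsest topology for which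
`ρ ↦ ∫_Q u ρ` is continuous for every `u ∈ L^1(Q)`. -/
abbrev weakStar (d : ℕ) : TopologicalSpace (Linfty d) :=
  TopologicalSpace.induced
    (fun (ρ : Linfty d) (u : Lone d) => ∫ x, u x * ρ x ∂(cubeMeasure d))
    Pi.topologicalSpace

/-- An element of `L^∞(Q)` is smooth if it is represented by the restriction to `Q` of a
`C^∞` function on `ℝ^d`. -/
def IsSmooth {d : ℕ} (ρ : Linfty d) : Prop :=
  ∃ r : E d → ℝ, ContDiff ℝ (⊤ : ℕ∞) r ∧ ρ =ᵐ[cubeMeasure d] r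

/-- `f` is Lipschitz on the cube. Functions on `Q` are represented by functions on `ℝ^d`
of which only the values on `Q` are used. -/
def IsLip {d : ℕ} (f : E d → ℝ) : Prop := ∃ K : ℝ≥0, LipschitzOnWith K f (cube d)

/-- The least Lipschitz constant `Lip(f)` of a function that is Lipschitz on the cube. -/
def lipConst {d : ℕ} (f : E d → ℝ) : ℝ≥0 := sInf {K : ℝ≥0 | LipschitzOnWith K f (cube d)}

/-- The supremum norm of `f` over the cube. -/
def supNorm {d : ℕ} (f : E d → ℝ) : ℝ := ⨆ x : cube d, |f x|

/-- The norm `‖f‖_L = max (‖f‖_∞, Lip(f))`. -/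
def lipNorm {d : ℕ} (f : E d → ℝ) : ℝ := max (supNorm f) (lipConst f)

/-- The Jacobian determinant `det Dπ` on the cube. The cube has unique derivatives, so the
derivative within the cube depends only on the values of `π` there. -/
def jacobian {d : ℕ} (π : Fin d → E d → ℝ) (x : E d) : ℝ :=
  (Matrix.of fun j k : Fin d =>
    fderivWithin ℝ (π j) (cube d) x (EuclideanSpace.single k (1 : ℝ))).det

/-- Formal Lipschitz sums `∑ᵢ (fᵢ, πᵢ)`; `π i j` is the `j`-th component of `πᵢ`.
(Boundedness of the `fᵢ` is automatic, the cube being compact.) -/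
structure FormalLipschitzSum (d : ℕ) where
  f : ℕ → E d → ℝ
  π : ℕ → Fin d → E d → ℝ
  isLip_f : ∀ i, IsLip (f i)
  isLip_π : ∀ i j, IsLip (π i j)
  summable : Summable fun i => lipNorm (f i) * ∏ j, (lipConst (π i j) : ℝ)

namespace FormalLipschitzSum

/-- The quantity `s = ∑ᵢ ‖fᵢ‖_L ∏ⱼ Lip(πᵢʲ)`. -/
def size {d : ℕ} (F : FormalLipschitzSum d) : ℝ :=
  ∑' i, lipNorm (F.f i) * ∏ j, (lipConst (F.π i j) : ℝ)

/-- The formal Lipschitz sum solves `∑ᵢ fᵢ det Dπᵢ = ρ` a.e. on `Q`, with absolute convergence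
in `L^∞(Q)`. -/
def Solves {d : ℕ} (F : FormalLipschitzSum d) (ρ : Linfty d) : Prop :=
  ∃ g : ℕ → Linfty d,
    (∀ i, g i =ᵐ[cubeMeasure d] fun x => F.f i x * jacobian (F.π i) x) ∧
    Summable (fun i => ‖g i‖) ∧ HasSum g ρ

end FormalLipschitzSum

end PrescribedJacobian

end

/-! By duality it is enough to find a density `u` in `L^1(Q)`, supported in a set of arbitrarily
small measure, that almost annihilates all normalized Jacobians: `|∫ u f det Dπ| ≤ ε ∫ |u|` whenever
`f` and the components of `π` are 1-Lipschitz and `|f| ≤ 1` (`exists_almost_annihilating`). Summing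
over the terms of a formal Lipschitz sum that solves the equation gives `∫ u ρ ≤ ε ‖u‖₁ s`. Replace
a representative of `σ` by `2 sign u` on the small support of `u`. This is a weak-star small change
that respects the bound 2, and it makes the pairing with `u` equal to `2 ‖u‖₁`. A strict lower bound
on the pairing with `u` is a weak-star open condition forcing `s > S`, and it survives
mollification.

To build `u`, consider a wave of values `±1` alternating on layers of width `1/n` in one direction
`x_o`, multiplied by a weight `w` that does not depend on `x_o`. Testing it against `f det Dh`
compares Jacobian integrals over adjacent layers. Jacobians are null Lagrangians, so their integrals
against a Lipschitz function hardly change under uniformly small changes of the map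
(`abs_integral_mul_jac_sub_jac_le`). Consequently two adjacent layers carry nearly the same
integral, unless the difference quotients of `h` across these layers deviate from those at a coarser
scale `1/q` (`abs_setIntegral_jac_sub_le`). The mean square of this deviation is exactly the
increase of the `energy`, the mean square of the difference quotients, from scale `1/q` to scale
`1/n`. Young's inequality with a parameter `t` turns the deviation into `t` times the energy
increase plus `1/t` times the mass of `w` (`abs_setIntegral_wave_mul_weight_le`).

The energy of a 1-Lipschitz function is at most 1, so a map deviates much at few scales only. Hence
waves are superposed at `N` rapidly refining scales: the energy increases telescope to a bound
independent of `N`, and the other errors are `N` times something small. Waves with a common weight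
could cancel down to an `L^1` norm of order `√N`, which is too little. Each new wave is therefore
concentrated on a much smaller set by a fast periodic factor in a second coordinate `x_p`, which is
where `d ≥ 2` enters (`IsWeight.exists_concentrated`). The `L^1` norm then grows linearly in `N`.
The periodic factor averages to one, so it barely changes integrals against the old energies, which
are equi-Lipschitz in all admissible `h`, and the telescoping persists. Choosing first `t` and then
`N` large gives the claim. -/

noncomputable section

namespace PrescribedJacobian

/-! ### Cofactors and the Piola identity -/

/-- The vector of partial derivatives of a real function. -/
def grad {d : ℕ} (f : E d → ℝ) (x : E d) : Fin d → ℝ :=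
  fun k => fderiv ℝ f x (EuclideanSpace.single k (1 : ℝ))

/-- The Jacobian determinant of a map given by its components. -/
def jac {d : ℕ} (h : Fin d → E d → ℝ) (x : E d) : ℝ :=
  (Matrix.of fun j => grad (h j) x).det

/-- The determinant as a continuous multilinear function of the rows. -/
def detRows (d : ℕ) : ContinuousMultilinearMap ℝ (fun _ : Fin d => Fin d → ℝ) ℝ :=
  { (Matrix.detRowAlternating (n := Fin d) (R := ℝ)).toMultilinearMap with
    cont := by
      change Continuous fun M : Fin d → Fin d → ℝ => Matrix.det M
      exact Continuous.matrix_det continuous_id }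

theorem detRows_apply {d : ℕ} (M : Fin d → Fin d → ℝ) : detRows d M = (Matrix.of M).det := rfl

theorem sum_symm_mul_alternating {ι : Type*} [Fintype ι] (s a : ι → ι → ℝ)
    (hs : ∀ k l, s k l = s l k) (ha : ∀ k l, a k l = -a l k) : ∑ k, ∑ l, s k l * a k l = 0 := by
  have h : ∑ k, ∑ l, s k l * a k l = -∑ k, ∑ l, s k l * a k l := by
    conv_lhs => rw [Finset.sum_comm]
    rw [← Finset.sum_neg_distrib]
    refine Finset.sum_congr rfl fun k _ => ?_
    rw [← Finset.sum_neg_distrib]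
    refine Finset.sum_congr rfl fun l _ => ?_
    rw [hs l k, ha l k]; ring
  linarith

theorem contDiff_partial {d : ℕ} {f : E d → ℝ} (hf : ContDiff ℝ 2 f) (k : Fin d) :
    ContDiff ℝ 1 fun x => grad f x k :=
  (hf.fderiv_right (m := 1) (by norm_num)).clm_apply contDiff_const

theorem contDiff_grad {d : ℕ} {f : E d → ℝ} (hf : ContDiff ℝ 2 f) : ContDiff ℝ 1 (grad f) :=
  contDiff_pi.2 fun k => contDiff_partial hf k

theorem partial_comm {d : ℕ} {f : E d → ℝ} (hf : ContDiff ℝ 2 f) (x : E d) (k l : Fin d) :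
    grad (fun y => grad f y l) x k = grad (fun y => grad f y k) x l := by
  have hd : Differentiable ℝ (fderiv ℝ f) :=
    (hf.fderiv_right (m := 1) (by norm_num)).differentiable (by norm_num)
  have key : ∀ a b : Fin d, grad (fun y => grad f y b) x a =
      fderiv ℝ (fderiv ℝ f) x (EuclideanSpace.single a 1) (EuclideanSpace.single b 1) := by
    intro a b
    unfold grad
    rw [fderiv_clm_apply (hd x) (differentiableAt_const _)]
    simp
  rw [key, key]
  have hs : IsSymmSndFDerivAt ℝ f x := hf.contDiffAt.isSymmSndFDerivAt (by simp)
  exact hs _ _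

/-- The cofactor: the determinant of the Jacobian matrix with row `i` replaced by the `k`-th unit
vector. -/
def cof {d : ℕ} (h : Fin d → E d → ℝ) (i k : Fin d) (x : E d) : ℝ :=
  detRows d (Function.update (fun j => grad (h j) x) i (Pi.single k 1))

theorem jac_eq_sum_cof {d : ℕ} (h : Fin d → E d → ℝ) (i : Fin d) (x : E d) :
    jac h x = ∑ k, grad (h i) x k * cof h i k x := by
  unfold jac
  rw [Matrix.det_eq_sum_mul_adjugate_row _ i]
  refine Finset.sum_congr rfl fun k _ => ?_
  rw [Matrix.adjugate_apply]
  rfl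

theorem hasFDerivAt_cof {d : ℕ} {h : Fin d → E d → ℝ} (hh : ∀ j, ContDiff ℝ 2 (h j))
    (i k : Fin d) (x : E d) :
    HasFDerivAt (cof h i k)
      (((detRows d).linearDeriv (Function.update (fun j => grad (h j) x) i (Pi.single k 1))).comp
        (ContinuousLinearMap.pi fun j =>
          if j = i then 0 else fderiv ℝ (grad (h j)) x)) x := by
  refine ((detRows d).hasFDerivAt _).comp x ?_
  rw [hasFDerivAt_pi]
  intro j
  by_cases hj : j = i
  · subst hj
    simp only [Function.update_self, if_true]
    exact hasFDerivAt_const _ _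
  · simp only [ne_eq, hj, not_false_eq_true, Function.update_of_ne, if_false]
    exact ((contDiff_grad (hh j)).differentiable (by norm_num) x).hasFDerivAt

/-- Differentiating the determinant row by row, row `i` is constant and drops out; the derivative of
each other row is expanded in unit vectors. This exhibits the second derivatives, symmetric in `k`
and `l`, as coefficients of determinants alternating in `k` and `l`. -/
theorem grad_cof {d : ℕ} {h : Fin d → E d → ℝ} (hh : ∀ j, ContDiff ℝ 2 (h j))
    (i k : Fin d) (x : E d) :
    grad (cof h i k) x k = ∑ j ∈ Finset.univ.erase i, ∑ l, grad (fun y => grad (h j) y l) x k *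
      detRows d (Function.update (Function.update (fun j => grad (h j) x) i (Pi.single k 1)) j
        (Pi.single l 1)) := by
  conv_lhs => unfold grad
  rw [(hasFDerivAt_cof hh i k x).fderiv]
  simp only [ContinuousLinearMap.comp_apply, ContinuousMultilinearMap.linearDeriv_apply]
  rw [← Finset.add_sum_erase _ _ (Finset.mem_univ i)]
  have h0 : (detRows d) (Function.update (Function.update (fun j => grad (h j) x) i (Pi.single k 1)) i
      ((ContinuousLinearMap.pi fun j => if j = i then 0 else fderiv ℝ (grad (h j)) x)
        (EuclideanSpace.single k 1) i)) = 0 := by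
    simp only [ContinuousLinearMap.coe_pi', if_true, _root_.zero_apply]
    exact (detRows d).map_update_zero _ _
  rw [h0, zero_add]
  refine Finset.sum_congr rfl fun j hj => ?_
  have hji : j ≠ i := (Finset.mem_erase.1 hj).1
  have hv : (ContinuousLinearMap.pi fun j => if j = i then 0 else fderiv ℝ (grad (h j)) x)
        (EuclideanSpace.single k 1) j
      = ∑ l, grad (fun y => grad (h j) y l) x k • (Pi.single l (1 : ℝ) : Fin d → ℝ) := by
    simp only [ContinuousLinearMap.coe_pi', hji, if_false]
    ext m
    have hd : Differentiable ℝ (grad (h j)) := (contDiff_grad (hh j)).differentiable (by norm_num)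
    have : fderiv ℝ (grad (h j)) x (EuclideanSpace.single k 1) m =
        grad (fun y => grad (h j) y m) x k := by
      unfold grad at hd ⊢
      rw [(hasFDerivAt_pi'.1 (hd x).hasFDerivAt m).fderiv]
      rfl
    rw [this]
    simp [Finset.sum_apply, Pi.single_apply]
  rw [hv]
  have := (detRows d).toMultilinearMap.map_update_sum (t := Finset.univ) (i := j)
    (g := fun l => grad (fun y => grad (h j) y l) x k • (Pi.single l (1 : ℝ) : Fin d → ℝ))
    (m := Function.update (fun j => grad (h j) x) i (Pi.single k 1))
  refine this.trans (Finset.sum_congr rfl fun l _ => ?_)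
  exact (detRows d).map_update_smul _ _ _ _

/-- Piola's identity: the cofactor rows are divergence free. -/
theorem sum_grad_cof {d : ℕ} {h : Fin d → E d → ℝ} (hh : ∀ j, ContDiff ℝ 2 (h j))
    (i : Fin d) (x : E d) : ∑ k, grad (cof h i k) x k = 0 := by
  simp_rw [grad_cof hh]
  rw [Finset.sum_comm]
  refine Finset.sum_eq_zero fun j hj => ?_
  have hji : j ≠ i := (Finset.mem_erase.1 hj).1
  refine sum_symm_mul_alternating _ _ (fun k l => partial_comm (hh j) x k l) fun k l => ?_
  set M := fun j => grad (h j) x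
  -- Exchanging `k` and `l` amounts to swapping the rows `i` and `j`.
  have := (Matrix.detRowAlternating (n := Fin d) (R := ℝ)).map_swap
    (Function.update (Function.update M i (Pi.single l 1)) j (Pi.single k 1)) hji
  change _ = -Matrix.detRowAlternating _
  rw [← this]
  change Matrix.detRowAlternating _ = _
  congr 1
  ext a b
  by_cases ha : a = i
  · subst ha
    simp [Function.update_of_ne hji.symm]
  · by_cases hb : a = j
    · subst hb
      simp [Function.update_of_ne hji.symm]
    · simp [ha, hb, Equiv.swap_apply_of_ne_of_ne]

theorem continuous_cof {d : ℕ} {h : Fin d → E d → ℝ} (hh : ∀ j, ContDiff ℝ 2 (h j))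
    (i k : Fin d) : Continuous (cof h i k) :=
  continuous_iff_continuousAt.2 fun x => (hasFDerivAt_cof hh i k x).continuousAt

theorem contDiff_cof {d : ℕ} {h : Fin d → E d → ℝ} (hh : ∀ j, ContDiff ℝ 2 (h j))
    (i k : Fin d) : ContDiff ℝ 1 (cof h i k) := by
  refine (detRows d).contDiff.comp (contDiff_pi.2 fun j => ?_)
  by_cases hj : j = i
  · subst hj
    simp only [Function.update_self]
    exact contDiff_const
  · simp only [ne_eq, hj, not_false_eq_true, Function.update_of_ne]
    exact contDiff_grad (hh j)

/-- The Jacobian is the divergence of `h i` times the cofactor row `i`, by Piola's identity;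
integrating by parts leaves no boundary term. -/
theorem integral_jac_eq_zero_of_contDiff {d : ℕ} {h : Fin d → E d → ℝ}
    (hh : ∀ j, ContDiff ℝ 2 (h j)) (i : Fin d) (hi : HasCompactSupport (h i)) :
    ∫ x, jac h x = 0 := by
  have hgc : ∀ k, Continuous fun x => grad (h i) x k := fun k => (contDiff_partial (hh i) k).continuous
  have hgs : ∀ k, HasCompactSupport fun x => grad (h i) x k := fun k =>
    hi.fderiv_apply (𝕜 := ℝ) _
  have hcc : ∀ k, Continuous fun x => grad (cof h i k) x k := fun k =>
    ((contDiff_cof hh i k).continuous_fderiv (by norm_num)).clm_apply continuous_const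
  have hint1 : ∀ k, Integrable fun x => grad (h i) x k * cof h i k x := fun k =>
    ((hgc k).mul (continuous_cof hh i k)).integrable_of_hasCompactSupport (hgs k).mul_right
  have hint2 : ∀ k, Integrable fun x => h i x * grad (cof h i k) x k := fun k =>
    ((hh i).continuous.mul (hcc k)).integrable_of_hasCompactSupport hi.mul_right
  have hint3 : ∀ k, Integrable fun x => h i x * cof h i k x := fun k =>
    ((hh i).continuous.mul (continuous_cof hh i k)).integrable_of_hasCompactSupport hi.mul_right
  have hparts : ∀ k, ∫ x, grad (h i) x k * cof h i k x = -∫ x, h i x * grad (cof h i k) x k := by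
    intro k
    have := integral_mul_fderiv_eq_neg_fderiv_mul_of_integrable (μ := volume) (𝕜 := ℝ)
      (v := EuclideanSpace.single k (1 : ℝ)) (hint1 k) (hint2 k) (hint3 k)
      (fun x _ => (hh i).differentiable (by norm_num) x)
      (fun x _ => (contDiff_cof hh i k).differentiable (by norm_num) x)
    unfold grad
    rw [this, neg_neg]
  simp_rw [jac_eq_sum_cof h i]
  rw [integral_finsetSum _ fun k _ => hint1 k]
  simp_rw [hparts]
  rw [Finset.sum_neg_distrib, ← integral_finsetSum _ fun k _ => hint2 k]
  simp_rw [← Finset.mul_sum, sum_grad_cof hh]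
  simp

/-! ### Mollification and the null Lagrangian property for Lipschitz maps -/

section

open ContinuousLinearMap in
-- By Rademacher's theorem the derivative may fall on the Lipschitz factor, the difference quotients
-- being dominated. In this form the gradients of mollifications inherit the Lipschitz bound and
-- converge almost everywhere.
theorem hasFDerivAt_convolution_lipschitz {d : ℕ} {f : E d → ℝ} {K : ℝ≥0} (hf : LipschitzWith K f)
    (φ : ContDiffBump (0 : E d)) (x : E d) :
    HasFDerivAt (convolution (φ.normed volume) f (lsmul ℝ ℝ) volume)
      (convolution (φ.normed volume) (fderiv ℝ f) (lsmul ℝ ℝ) volume x) x := by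
  have hφc : Continuous (φ.normed (volume : Measure (E d))) := φ.continuous_normed
  have hφs : HasCompactSupport (φ.normed (volume : Measure (E d))) := φ.hasCompactSupport_normed
  have hφi : Integrable (φ.normed (volume : Measure (E d))) := hφc.integrable_of_hasCompactSupport hφs
  unfold convolution
  refine (hasFDerivAt_integral_of_dominated_loc_of_lip (s := Set.univ)
    (bound := fun t => φ.normed volume t * K) Filter.univ_mem ?_ ?_ ?_ ?_ ?_ ?_).2
  · refine Filter.Eventually.of_forall fun y => Continuous.aestronglyMeasurable ?_
    exact hφc.smul (hf.continuous.comp (continuous_const.sub continuous_id))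
  · refine Continuous.integrable_of_hasCompactSupport ?_ hφs.smul_right
    exact hφc.smul (hf.continuous.comp (continuous_const.sub continuous_id))
  · refine hφc.aestronglyMeasurable.smul ?_
    exact ((measurable_fderiv ℝ f).comp (measurable_const.sub measurable_id)).aestronglyMeasurable
  · refine Filter.Eventually.of_forall fun t => ?_
    rw [lipschitzOnWith_univ]
    refine LipschitzWith.of_dist_le_mul fun y z => ?_
    have h1 := hf.dist_le_mul (y - t) (z - t)
    simp only [lsmul_apply, dist_sub_right] at h1 ⊢
    rw [dist_smul₀, Real.coe_nnabs, abs_mul, NNReal.abs_eq, mul_assoc, Real.norm_eq_abs]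
    exact mul_le_mul_of_nonneg_left h1 (abs_nonneg _)
  · exact hφi.mul_const _
  · have hd : ∀ᵐ t : E d, DifferentiableAt ℝ f (x - t) :=
      (quasiMeasurePreserving_sub_left volume x).ae hf.ae_differentiableAt
    filter_upwards [hd] with t ht
    have h1 : HasFDerivAt (fun y => f (y - t)) (fderiv ℝ f (x - t)) x := by
      have := ht.hasFDerivAt.comp x ((hasFDerivAt_id x).sub_const t)
      simpa using! this
    exact h1.const_smul _

open ContinuousLinearMap in
theorem norm_convolution_fderiv_le {d : ℕ} {f : E d → ℝ} {K : ℝ≥0} (hf : LipschitzWith K f)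
    (φ : ContDiffBump (0 : E d)) (x : E d) :
    ‖convolution (φ.normed volume) (fderiv ℝ f) (lsmul ℝ ℝ) volume x‖ ≤ K := by
  have hφi : Integrable (φ.normed (volume : Measure (E d))) :=
    φ.continuous_normed.integrable_of_hasCompactSupport φ.hasCompactSupport_normed
  unfold convolution
  refine (norm_integral_le_of_norm_le (hφi.mul_const (K : ℝ)) (Filter.Eventually.of_forall fun t => ?_)).trans ?_
  · simp only [lsmul_apply, norm_smul, Real.norm_eq_abs, abs_of_nonneg (φ.nonneg_normed t)]
    exact mul_le_mul_of_nonneg_left (norm_fderiv_le_of_lipschitz ℝ hf) (φ.nonneg_normed t)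
  · rw [integral_mul_const, φ.integral_normed, one_mul]

theorem abs_grad_le {d : ℕ} {f : E d → ℝ} {K : ℝ≥0} (hf : LipschitzWith K f) (x : E d) (k : Fin d) :
    |grad f x k| ≤ K := by
  have := (fderiv ℝ f x).le_opNorm (EuclideanSpace.single k (1 : ℝ))
  simp only [PiLp.norm_single, norm_one, mul_one] at this
  exact this.trans (norm_fderiv_le_of_lipschitz ℝ hf)

theorem measurable_grad {d : ℕ} (f : E d → ℝ) : Measurable (grad f) :=
  measurable_pi_iff.2 fun _ => measurable_fderiv_apply_const ℝ f _

theorem measurable_detRows_comp {d : ℕ} {M : E d → Fin d → Fin d → ℝ}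
    (hM : ∀ j, Measurable fun x => M x j) : Measurable fun x => detRows d (M x) :=
  (detRows d).cont.measurable.comp (measurable_pi_iff.2 hM)

theorem measurable_jac {d : ℕ} (h : Fin d → E d → ℝ) : Measurable (jac h) :=
  measurable_detRows_comp fun j => measurable_grad (h j)

theorem abs_detRows_le {d : ℕ} {M : Fin d → Fin d → ℝ} {L : ℝ} (hM : ∀ i j, |M i j| ≤ L) :
    |detRows d M| ≤ d.factorial * L ^ d := by
  have := Matrix.det_le (A := Matrix.of M) (abv := AbsoluteValue.abs) (x := L) (by simpa using hM)
  simpa [detRows_apply] using this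

theorem grad_eq_zero_of_notMem {d : ℕ} {f : E d → ℝ} {s : Set (E d)} (hs : IsClosed s)
    (hf : ∀ x ∉ s, f x = 0) {x : E d} (hx : x ∉ s) : grad f x = 0 := by
  have : f =ᶠ[𝓝 x] fun _ => 0 := by
    filter_upwards [hs.isOpen_compl.mem_nhds hx] with y hy using hf y hy
  unfold grad
  rw [this.fderiv_eq]
  ext k
  simp

theorem detRows_eq_zero_of_row {d : ℕ} {M : Fin d → Fin d → ℝ} (i : Fin d) (h : M i = 0) :
    detRows d M = 0 := (detRows d).map_coord_zero i h

/-- The Jacobian of a Lipschitz map with a compactly supported component has integral zero. -/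
theorem integral_jac_eq_zero {d : ℕ} {h : Fin d → E d → ℝ} {K : ℝ≥0}
    (hh : ∀ j, LipschitzWith K (h j)) (i : Fin d) (hi : HasCompactSupport (h i)) :
    ∫ x, jac h x = 0 := by
  obtain ⟨R, hR⟩ := hi.isCompact.isBounded.subset_closedBall (0 : E d)
  have hsup : ∀ x ∉ Metric.closedBall (0 : E d) R, h i x = 0 := fun x hx =>
    image_eq_zero_of_notMem_tsupport fun h' => hx (hR h')
  -- The ratio of the radii stays 2, as the Lebesgue differentiation theorem for bump convolutions
  -- requires it bounded.
  let φ : ℕ → ContDiffBump (0 : E d) := fun n =>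
    { rIn := 1 / (2 * ((n : ℝ) + 1)), rOut := 1 / ((n : ℝ) + 1), rIn_pos := by positivity,
      rIn_lt_rOut := by
        refine one_div_lt_one_div_of_lt (by positivity) ?_
        have : (0 : ℝ) < n + 1 := by positivity
        linarith }
  have hφ0 : Filter.Tendsto (fun n => (φ n).rOut) Filter.atTop (𝓝 0) :=
    tendsto_one_div_add_atTop_nhds_zero_nat
  have hφ2 : ∀ᶠ n in Filter.atTop, (φ n).rOut ≤ 2 * (φ n).rIn := by
    refine Filter.Eventually.of_forall fun n => le_of_eq ?_
    change 1 / ((n : ℝ) + 1) = 2 * (1 / (2 * ((n : ℝ) + 1)))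
    field_simp
  let g : ℕ → Fin d → E d → ℝ := fun n j =>
    convolution ((φ n).normed volume) (h j) (ContinuousLinearMap.lsmul ℝ ℝ) volume
  have hgd : ∀ n j, ContDiff ℝ 2 (g n j) := fun n j =>
    (φ n).hasCompactSupport_normed.contDiff_convolution_left (n := 2) _ (φ n).contDiff_normed
      (hh j).continuous.locallyIntegrable
  have hgf : ∀ n j x, fderiv ℝ (g n j) x = convolution ((φ n).normed volume) (fderiv ℝ (h j))
      (ContinuousLinearMap.lsmul ℝ ℝ) volume x := fun n j x =>
    (hasFDerivAt_convolution_lipschitz (hh j) (φ n) x).fderiv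
  have hgs : ∀ n, ∀ x ∉ Metric.closedBall (0 : E d) (R + 1), g n i x = 0 := by
    intro n x hx
    by_contra hne
    have hmem := support_convolution_subset (ContinuousLinearMap.lsmul ℝ ℝ)
      (Function.mem_support.2 hne)
    obtain ⟨a, ha, b, hb, rfl⟩ := Set.mem_add.1 hmem
    rw [(φ n).support_normed_eq, mem_ball_zero_iff] at ha
    have hb' : ‖b‖ ≤ R := by
      by_contra hb'
      exact hb (hsup b (by simpa using hb'))
    have h1 : (φ n).rOut ≤ 1 := by
      change 1 / ((n : ℝ) + 1) ≤ 1
      rw [div_le_one (by positivity)]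
      have : (0 : ℝ) ≤ n := n.cast_nonneg
      linarith
    apply hx
    rw [mem_closedBall_zero_iff]
    linarith [norm_add_le a b]
  have hgsc : ∀ n, HasCompactSupport (g n i) := fun n =>
    HasCompactSupport.intro (isCompact_closedBall _ _) (hgs n)
  have hzero : ∀ n, ∫ x, jac (g n) x = 0 := fun n =>
    integral_jac_eq_zero_of_contDiff (hgd n) i (hgsc n)
  have hbound : ∀ n j x k, |grad (g n j) x k| ≤ K := by
    intro n j x k
    have := (fderiv ℝ (g n j) x).le_opNorm (EuclideanSpace.single k (1 : ℝ))
    simp only [PiLp.norm_single, norm_one, mul_one, hgf n j x] at this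
    unfold grad
    rw [hgf]
    exact this.trans (norm_convolution_fderiv_le (hh j) _ _)
  have hlim : Filter.Tendsto (fun n => ∫ x, jac (g n) x) Filter.atTop (𝓝 (∫ x, jac h x)) := by
    refine tendsto_integral_of_dominated_convergence
      ((Metric.closedBall (0 : E d) (R + 1)).indicator fun _ => (d.factorial : ℝ) * (K : ℝ) ^ d)
      (fun n => (measurable_jac _).aestronglyMeasurable) ?_ (fun n => ?_) ?_
    · exact (integrable_indicator_iff Metric.isClosed_closedBall.measurableSet).2
        (integrableOn_const (isCompact_closedBall _ _).measure_lt_top.ne)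
    · refine Filter.Eventually.of_forall fun x => ?_
      by_cases hx : x ∈ Metric.closedBall (0 : E d) (R + 1)
      · rw [Set.indicator_of_mem hx]
        exact abs_detRows_le fun j k => hbound n j x k
      · rw [Set.indicator_of_notMem hx, norm_le_zero_iff]
        exact detRows_eq_zero_of_row i (grad_eq_zero_of_notMem Metric.isClosed_closedBall (hgs n) hx)
    · have hae : ∀ᵐ x : E d, ∀ j, Filter.Tendsto (fun n => convolution ((φ n).normed volume)
          (fderiv ℝ (h j)) (ContinuousLinearMap.lsmul ℝ ℝ) volume x) Filter.atTop
          (𝓝 (fderiv ℝ (h j) x)) := by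
        rw [ae_all_iff]
        intro j
        refine ContDiffBump.ae_convolution_tendsto_right_of_locallyIntegrable hφ0 hφ2 ?_
        refine (locallyIntegrable_const (K : ℝ)).mono
          (measurable_fderiv ℝ (h j)).aestronglyMeasurable (Filter.Eventually.of_forall fun x => ?_)
        simpa using norm_fderiv_le_of_lipschitz ℝ (hh j)
      filter_upwards [hae] with x hx
      refine ((detRows d).cont.tendsto _).comp (tendsto_pi_nhds.2 fun j => tendsto_pi_nhds.2 fun k => ?_)
      have h2 := ((ContinuousLinearMap.apply ℝ ℝ (EuclideanSpace.single k (1 : ℝ))).continuous.tendsto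
        (fderiv ℝ (h j) x)).comp (hx j)
      refine h2.congr fun n => ?_
      rw [Function.comp_apply, ← hgf]
      rfl
  exact tendsto_nhds_unique (hlim.congr hzero) tendsto_const_nhds |>.symm ▸ rfl

end

/-! ### Continuity of weighted Jacobian integrals under uniform perturbations -/

theorem integrable_of_bounded_of_eq_zero {d : ℕ} {f : E d → ℝ} {T : Set (E d)} {C : ℝ}
    (hf : AEStronglyMeasurable f volume) (hT : MeasurableSet T) (hTv : volume T ≠ ⊤)
    (hC : ∀ x, |f x| ≤ C) (h0 : ∀ x ∉ T, f x = 0) : Integrable f := by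
  refine Integrable.mono' (g := T.indicator fun _ => C)
    ((integrable_indicator_iff hT).2 (integrableOn_const hTv)) hf
    (Filter.Eventually.of_forall fun x => ?_)
  by_cases hx : x ∈ T
  · rw [Set.indicator_of_mem hx]; exact hC x
  · rw [Set.indicator_of_notMem hx, h0 x hx]; simp

theorem abs_integral_le_mul_volume {d : ℕ} {f : E d → ℝ} {T : Set (E d)} {C : ℝ}
    (hTv : volume T ≠ ⊤)
    (hC : ∀ x, |f x| ≤ C) (h0 : ∀ x ∉ T, f x = 0) : |∫ x, f x| ≤ C * volume.real T := by
  rw [← setIntegral_eq_integral_of_forall_compl_eq_zero h0]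
  exact norm_setIntegral_le_of_norm_le_const (f := f) hTv.lt_top fun x _ => hC x

theorem lipschitzWith_mul {X : Type*} [PseudoMetricSpace X] {f g : X → ℝ} {A B a b : ℝ≥0}
    (hf : LipschitzWith A f) (hg : LipschitzWith B g) (ha : ∀ x, |f x| ≤ a) (hb : ∀ x, |g x| ≤ b) :
    LipschitzWith (a * B + b * A) fun x => f x * g x := by
  refine LipschitzWith.of_dist_le_mul fun x y => ?_
  have h1 := hf.dist_le_mul x y
  have h2 := hg.dist_le_mul x y
  rw [Real.dist_eq] at *
  have h3 : f x * g x - f y * g y = f x * (g x - g y) + g y * (f x - f y) := by ring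
  rw [h3]
  refine (abs_add_le _ _).trans ?_
  rw [abs_mul, abs_mul]
  push_cast
  have h4 := mul_le_mul (ha x) h2 (abs_nonneg _) a.2
  have h5 := mul_le_mul (hb y) h1 (abs_nonneg _) b.2
  linarith

/-- Homogeneity in row `i`: dividing that row by `K` reduces to the bound for entries at most `L`.
The point is that the estimate is linear in `K`. -/
theorem abs_detRows_update_le {d : ℕ} {M : Fin d → Fin d → ℝ} {L K : ℝ} (hL : 1 ≤ L) (hK : 0 ≤ K)
    (i : Fin d) (hM : ∀ j k, |M j k| ≤ L) {v : Fin d → ℝ} (hv : ∀ k, |v k| ≤ K) :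
    |detRows d (Function.update M i v)| ≤ d.factorial * L ^ d * K := by
  rcases hK.eq_or_lt with h0 | hpos
  · have : v = 0 := funext fun k => by simpa using (hv k).trans_eq h0.symm
    rw [this, detRows_eq_zero_of_row i (Function.update_self ..), ← h0]; simp
  · have : v = K • fun k => v k / K := by
      ext k; simp [mul_div_cancel₀ _ hpos.ne']
    rw [this, (detRows d).map_update_smul, smul_eq_mul, abs_mul, abs_of_pos hpos, mul_comm]
    refine mul_le_mul_of_nonneg_right (abs_detRows_le fun j k => ?_) hK
    by_cases hj : j = i
    · subst hj
      simp only [Function.update_self, abs_div, abs_of_pos hpos]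
      exact ((div_le_one hpos).2 (hv k)).trans hL
    · simp only [ne_eq, hj, not_false_eq_true, Function.update_of_ne, hM]

theorem jac_update {d : ℕ} (h : Fin d → E d → ℝ) (i : Fin d) (f : E d → ℝ) (x : E d) :
    jac (Function.update h i f) x =
      detRows d (Function.update (fun j => grad (h j) x) i (grad f x)) := by
  unfold jac
  rw [← detRows_apply]
  congr 1
  ext j k
  by_cases hj : j = i
  · subst hj; simp
  · simp [hj]

theorem grad_sub {d : ℕ} {f g : E d → ℝ} {x : E d} (hf : DifferentiableAt ℝ f x)
    (hg : DifferentiableAt ℝ g x) : grad (fun y => f y - g y) x = grad f x - grad g x := by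
  ext k
  unfold grad
  rw [fderiv_fun_sub hf hg]
  simp

theorem grad_add {d : ℕ} {f g : E d → ℝ} {x : E d} (hf : DifferentiableAt ℝ f x)
    (hg : DifferentiableAt ℝ g x) : grad (fun y => f y + g y) x = grad f x + grad g x := by
  ext k
  unfold grad
  rw [fderiv_fun_add hf hg]
  simp

theorem grad_mul {d : ℕ} {f g : E d → ℝ} {x : E d} (hf : DifferentiableAt ℝ f x)
    (hg : DifferentiableAt ℝ g x) :
    grad (fun y => f y * g y) x = f x • grad g x + g x • grad f x := by
  ext k
  unfold grad
  rw [fderiv_fun_mul hf hg]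
  simp

/-- Replacing one component of a Lipschitz map changes a weighted Jacobian integral little, if the
change of the component is uniformly small. -/
theorem integral_mul_jac_update_sub {d : ℕ} {h : Fin d → E d → ℝ} {a b χ : E d → ℝ}
    {L K B : ℝ≥0} {ε : ℝ≥0} {T : Set (E d)} (hL : 1 ≤ L) (i : Fin d)
    (hh : ∀ j, LipschitzWith L (h j)) (ha : LipschitzWith L a) (hb : LipschitzWith L b)
    (hχ : LipschitzWith K χ) (hχB : ∀ x, |χ x| ≤ B) (hε : ∀ x, |a x - b x| ≤ ε)
    (hT : IsCompact T) (h0 : ∀ x ∉ T, χ x = 0 ∨ a x = b x) :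
    Integrable (fun x => χ x * (jac (Function.update h i a) x - jac (Function.update h i b) x)) ∧
    |∫ x, χ x * (jac (Function.update h i a) x - jac (Function.update h i b) x)| ≤
      d.factorial * L ^ d * K * ε * volume.real T := by
  set φ : E d → ℝ := fun x => a x - b x with hφ
  have hφL : LipschitzWith (L + L) φ := ha.sub hb
  have hψL : LipschitzWith (B * (L + L) + ε * K) fun x => χ x * φ x :=
    lipschitzWith_mul hχ hφL hχB hε
  set ψ : E d → ℝ := fun x => χ x * φ x with hψ
  have hψ0 : ∀ x ∉ T, ψ x = 0 := fun x hx => by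
    rcases h0 x hx with h | h
    · simp [hψ, h]
    · simp [hψ, hφ, h]
  -- Off `T`, where `φ ≠ 0` this persists nearby, so `χ` vanishes in a neighbourhood.
  have hφχ0 : ∀ x ∉ T, φ x = 0 ∨ grad χ x = 0 := by
    intro x hx
    by_cases hφx : φ x = 0
    · exact Or.inl hφx
    · right
      have h1 : ∀ᶠ y in 𝓝 x, φ y ≠ 0 := hφL.continuous.continuousAt.eventually_ne hφx
      have h2 : χ =ᶠ[𝓝 x] fun _ => 0 := by
        filter_upwards [h1, hT.isClosed.isOpen_compl.mem_nhds hx] with y hy hyT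
        rcases h0 y hyT with h | h
        · exact h
        · exact absurd (by simp [hφ, h]) hy
      unfold grad
      rw [h2.fderiv_eq]
      ext k; simp
  set R : E d → Fin d → Fin d → ℝ := fun x j => grad (h j) x
  -- The product rule for `ψ = χ φ` in row `i`. The Jacobian with component `ψ` has integral zero,
  -- so only the term with `φ grad χ` remains, and it is small because `φ` is uniformly small.
  have hae : (fun x => χ x * (jac (Function.update h i a) x - jac (Function.update h i b) x)) =ᵐ[volume]
      fun x => jac (Function.update h i ψ) x -
        φ x * detRows d (Function.update (R x) i (grad χ x)) := by
    filter_upwards [ha.ae_differentiableAt, hb.ae_differentiableAt, hχ.ae_differentiableAt]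
      with x h1 h2 h3
    have h4 : grad ψ x = χ x • (grad a x - grad b x) + φ x • grad χ x := by
      rw [hψ, grad_mul h3 (h1.fun_sub h2), hφ, grad_sub h1 h2]
    rw [jac_update, jac_update, jac_update, h4, (detRows d).map_update_add,
      (detRows d).map_update_smul, (detRows d).map_update_smul, (detRows d).map_update_sub]
    simp only [smul_eq_mul]
    ring
  have hψT : HasCompactSupport ψ := HasCompactSupport.intro hT hψ0
  set L' : ℝ≥0 := L + (B * (L + L) + ε * K) with hL'
  have hupd : ∀ j, LipschitzWith L' (Function.update h i ψ j) := by
    intro j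
    by_cases hj : j = i
    · subst hj; simpa using hψL.weaken le_add_self
    · simpa [hj] using (hh j).weaken le_self_add
  have hint1 : Integrable (jac (Function.update h i ψ)) := by
    refine integrable_of_bounded_of_eq_zero (measurable_jac _).aestronglyMeasurable
      hT.isClosed.measurableSet hT.measure_lt_top.ne
      (fun x => abs_detRows_le (L := L') fun j k => abs_grad_le (hupd j) x k) fun x hx => ?_
    refine detRows_eq_zero_of_row i ?_
    change grad (Function.update h i ψ i) x = 0
    rw [Function.update_self]
    exact grad_eq_zero_of_notMem hT.isClosed hψ0 hx
  have hb2 : ∀ x, |φ x * detRows d (Function.update (R x) i (grad χ x))| ≤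
      d.factorial * L ^ d * K * ε := by
    intro x
    rw [abs_mul, mul_comm]
    refine mul_le_mul (abs_detRows_update_le (L := L) (by exact_mod_cast hL) K.2 i
      (fun j k => abs_grad_le (hh j) x k) fun k => abs_grad_le hχ x k) (hε x) (abs_nonneg _) (by positivity)
  have hz2 : ∀ x ∉ T, φ x * detRows d (Function.update (R x) i (grad χ x)) = 0 := by
    intro x hx
    rcases hφχ0 x hx with h | h
    · rw [h, zero_mul]
    · rw [h, detRows_eq_zero_of_row i (Function.update_self ..), mul_zero]
  have hint2 : Integrable fun x => φ x * detRows d (Function.update (R x) i (grad χ x)) := by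
    refine integrable_of_bounded_of_eq_zero ?_ hT.isClosed.measurableSet hT.measure_lt_top.ne hb2 hz2
    refine (hφL.continuous.measurable.mul (measurable_detRows_comp fun j => ?_)).aestronglyMeasurable
    by_cases hj : j = i
    · subst hj; simpa using measurable_grad χ
    · simpa [hj] using measurable_grad (h j)
  refine ⟨(hint1.sub hint2).congr hae.symm, ?_⟩
  rw [integral_congr_ae hae, integral_sub hint1 hint2, integral_jac_eq_zero hupd i
    (by simpa using hψT), zero_sub, abs_neg]
  exact abs_integral_le_mul_volume hT.measure_lt_top.ne hb2 hz2

/-- Uniformly close Lipschitz maps have close weighted Jacobian integrals. -/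
theorem abs_integral_mul_jac_sub_jac_le {d : ℕ} {α β : Fin d → E d → ℝ} {χ : E d → ℝ}
    {L K B : ℝ≥0} {ε : ℝ≥0} {T : Set (E d)} (hL : 1 ≤ L)
    (hα : ∀ j, LipschitzWith L (α j)) (hβ : ∀ j, LipschitzWith L (β j))
    (hχ : LipschitzWith K χ) (hχB : ∀ x, |χ x| ≤ B) (hε : ∀ j x, |α j x - β j x| ≤ ε)
    (hT : IsCompact T) (h0 : ∀ x ∉ T, χ x = 0 ∨ ∀ j, α j x = β j x) :
    Integrable (fun x => χ x * (jac α x - jac β x)) ∧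
    |∫ x, χ x * (jac α x - jac β x)| ≤ d * (d.factorial * L ^ d * K * ε * volume.real T) := by
  -- Hybrid maps: the first `m` components come from `α`, the others from `β`. Consecutive hybrids
  -- differ in a single component.
  let h : ℕ → Fin d → E d → ℝ := fun m j => if (j : ℕ) < m then α j else β j
  have hhL : ∀ m j, LipschitzWith L (h m j) := by
    intro m j
    simp only [h]
    split_ifs
    exacts [hα j, hβ j]
  have h_zero : h 0 = β := by ext j; simp [h]
  have h_d : h d = α := by ext j; simp [h]
  have key : ∀ m ≤ d, Integrable (fun x => χ x * (jac (h m) x - jac β x)) ∧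
      |∫ x, χ x * (jac (h m) x - jac β x)| ≤
        m * (d.factorial * L ^ d * K * ε * volume.real T) := by
    intro m
    induction m with
    | zero => intro _; simp [h_zero]
    | succ m ih =>
      intro hm
      obtain ⟨hi1, hb1⟩ := ih (by omega)
      let i : Fin d := ⟨m, hm⟩
      obtain ⟨hi2, hb2⟩ := integral_mul_jac_update_sub (h := h m) hL i (hhL m) (hα i) (hβ i) hχ hχB
        (hε i) hT (fun x hx => (h0 x hx).imp id fun H => H i)
      have e1 : Function.update (h m) i (α i) = h (m + 1) := by
        ext j x
        by_cases hj : j = i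
        · subst hj; simp [h, i]
        · have : (j : ℕ) ≠ m := fun H => hj (Fin.ext H)
          have h3 : (j : ℕ) < m + 1 ↔ (j : ℕ) < m := by omega
          simp [hj, h, h3]
      have e2 : Function.update (h m) i (β i) = h m := by
        refine Function.update_eq_self_iff.2 ?_
        simp [h, i]
      rw [e1, e2] at hi2 hb2
      have e3 : (fun x => χ x * (jac (h (m + 1)) x - jac β x)) = fun x =>
          χ x * (jac (h m) x - jac β x) + χ x * (jac (h (m + 1)) x - jac (h m) x) := by
        ext x; ring
      rw [e3]
      refine ⟨hi1.add hi2, ?_⟩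
      rw [integral_add hi1 hi2]
      refine (abs_add_le _ _).trans ?_
      push_cast
      linarith
  have := key d le_rfl
  rwa [h_d] at this

/-! ### Freezing one coordinate, boxes and slabs -/

/-- The point `x` with its `o`-th coordinate replaced by `t`. -/
def repl {d : ℕ} (o : Fin d) (t : ℝ) (x : E d) : E d :=
  WithLp.toLp 2 (Function.update (WithLp.ofLp x) o t)

theorem repl_apply {d : ℕ} (o : Fin d) (t : ℝ) (x : E d) (j : Fin d) :
    repl o t x j = if j = o then t else x j := by
  simp [repl, Function.update_apply]

theorem repl_repl {d : ℕ} (o : Fin d) (s t : ℝ) (x : E d) : repl o s (repl o t x) = repl o s x := by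
  ext j
  simp only [repl_apply]
  split_ifs <;> rfl

theorem repl_self {d : ℕ} (o : Fin d) (x : E d) : repl o (x o) x = x := by
  ext j
  rw [repl_apply]
  split_ifs with h
  · rw [h]
  · rfl

theorem norm_le_of_abs_le {d : ℕ} {u v : E d} (h : ∀ j, |u j| ≤ |v j|) : ‖u‖ ≤ ‖v‖ := by
  rw [EuclideanSpace.norm_eq, EuclideanSpace.norm_eq]
  refine Real.sqrt_le_sqrt (Finset.sum_le_sum fun j _ => ?_)
  simp only [Real.norm_eq_abs]
  exact pow_le_pow_left₀ (abs_nonneg _) (h j) 2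

theorem abs_apply_le_norm {d : ℕ} (x : E d) (j : Fin d) : |x j| ≤ ‖x‖ := PiLp.norm_apply_le x j

theorem dist_repl_le {d : ℕ} (o : Fin d) {s t : ℝ} {x y : E d} (h : |s - t| ≤ |x o - y o|) :
    dist (repl o s x) (repl o t y) ≤ dist x y := by
  rw [dist_eq_norm, dist_eq_norm]
  refine norm_le_of_abs_le fun j => ?_
  simp only [PiLp.sub_apply, repl_apply]
  split_ifs with hj
  · rw [hj]; exact h
  · exact le_rfl

theorem dist_repl_same {d : ℕ} (o : Fin d) (s t : ℝ) (x : E d) :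
    dist (repl o s x) (repl o t x) ≤ |s - t| := by
  have : dist (repl o s x) (repl o t x) = ‖(EuclideanSpace.single o (s - t) : E d)‖ := by
    rw [dist_eq_norm]
    congr 1
    ext j
    simp only [PiLp.sub_apply, repl_apply, PiLp.single_apply]
    split_ifs <;> simp
  rw [this, PiLp.norm_single, Real.norm_eq_abs]

theorem lipschitzWith_real {X : Type*} [PseudoMetricSpace X] {f : X → ℝ} {C : ℝ≥0}
    (h : ∀ x y, |f x - f y| ≤ C * dist x y) : LipschitzWith C f :=
  LipschitzWith.of_dist_le_mul fun x y => by rw [Real.dist_eq]; exact h x y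

theorem abs_sub_le_of_lipschitz {X : Type*} [PseudoMetricSpace X] {f : X → ℝ} {C : ℝ≥0}
    (h : LipschitzWith C f) (x y : X) : |f x - f y| ≤ C * dist x y := by
  rw [← Real.dist_eq]; exact h.dist_le_mul x y

theorem lipschitzWith_coord {d : ℕ} (o : Fin d) : LipschitzWith 1 fun x : E d => x o :=
  lipschitzWith_real fun x y => by
    rw [NNReal.coe_one, one_mul, dist_eq_norm]
    exact abs_apply_le_norm (x - y) o

theorem lipschitzWith_comp_repl {d : ℕ} (o : Fin d) (t : ℝ) {f : E d → ℝ} {C : ℝ≥0}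
    (hf : LipschitzWith C f) : LipschitzWith C fun x => f (repl o t x) :=
  lipschitzWith_real fun x y => (abs_sub_le_of_lipschitz hf _ _).trans
    (mul_le_mul_of_nonneg_left (dist_repl_le o (by simp)) C.2)

theorem abs_repl_sub_repl_le {d : ℕ} (o : Fin d) (s t : ℝ) {f : E d → ℝ} (hf : LipschitzWith 1 f)
    (x : E d) : |f (repl o s x) - f (repl o t x)| ≤ |s - t| := by
  refine (abs_sub_le_of_lipschitz hf _ _).trans ?_
  rw [NNReal.coe_one, one_mul]
  exact dist_repl_same o s t x

/-- A function that does not depend on a coordinate has a vanishing partial derivative. -/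
theorem grad_eq_zero_of_indep {d : ℕ} {o : Fin d} {f : E d → ℝ}
    (hf : ∀ t x, f (repl o t x) = f x) (x : E d) : grad f x o = 0 := by
  unfold grad
  by_cases hd : DifferentiableAt ℝ f x
  · rw [← hd.lineDeriv_eq_fderiv]
    unfold lineDeriv
    have : (fun t : ℝ => f (x + t • EuclideanSpace.single o (1 : ℝ))) = fun _ => f x := by
      ext t
      have h1 : x + t • EuclideanSpace.single o (1 : ℝ) = repl o (x o + t) x := by
        ext j
        simp only [PiLp.add_apply, PiLp.smul_apply, repl_apply, PiLp.single_apply, smul_eq_mul]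
        split_ifs with hj
        · rw [hj, mul_one]
        · rw [mul_zero, add_zero]
      rw [h1, hf]
    rw [this, deriv_const]
  · rw [fderiv_zero_of_not_differentiableAt hd]; rfl

theorem grad_coord_add {d : ℕ} (o : Fin d) (s c : ℝ) (x : E d) :
    grad (fun y : E d => s * y o + c) x = Pi.single o s := by
  have : HasFDerivAt (fun y : E d => s * y o + c) (s • (EuclideanSpace.proj o : E d →L[ℝ] ℝ)) x :=
    ((EuclideanSpace.proj o : E d →L[ℝ] ℝ).hasFDerivAt.const_mul s).add_const c
  ext k
  unfold grad
  rw [this.fderiv]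
  simp only [FunLike.coe_smul, Pi.smul_apply, PiLp.proj_apply, PiLp.single_apply, Pi.single_apply,
    smul_eq_mul, eq_comm (a := k)]
  split_ifs <;> simp

theorem differentiableAt_coord_add {d : ℕ} (o : Fin d) (s c : ℝ) (x : E d) :
    DifferentiableAt ℝ (fun y : E d => s * y o + c) x :=
  (((EuclideanSpace.proj o : E d →L[ℝ] ℝ).hasFDerivAt.const_mul s).add_const c).differentiableAt

theorem grad_congr {d : ℕ} {f g : E d → ℝ} {x : E d} (h : f =ᶠ[𝓝 x] g) : grad f x = grad g x := by
  unfold grad; rw [h.fderiv_eq]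

/-- The box `{a ≤ x_o ≤ b, 0 ≤ x_j ≤ 1 (j ≠ o)}`. -/
def box {d : ℕ} (o : Fin d) (a b : ℝ) : Set (E d) :=
  {x | x o ∈ Set.Icc a b ∧ ∀ j, j ≠ o → x j ∈ Set.Icc (0 : ℝ) 1}

theorem box_eq {d : ℕ} (o : Fin d) (a b : ℝ) : box o a b = (WithLp.ofLp : E d → Fin d → ℝ) ⁻¹'
    Set.Icc (Function.update 0 o a) (Function.update 1 o b) := by
  ext x
  simp only [box, Set.mem_ofPred_eq, Set.mem_preimage, Set.mem_Icc, Pi.le_def, ← forall_and]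
  constructor
  · rintro ⟨h1, h2⟩ j
    by_cases hj : j = o
    · subst hj; simpa using h1
    · simpa [hj] using h2 j hj
  · intro h
    refine ⟨by simpa using h o, fun j hj => by simpa [hj] using h j⟩

theorem measurePreserving_ofLp (d : ℕ) :
    MeasurePreserving (WithLp.ofLp : E d → Fin d → ℝ) volume volume :=
  PiLp.volume_preserving_ofLp (Fin d)

theorem isCompact_box {d : ℕ} (o : Fin d) (a b : ℝ) : IsCompact (box o a b) := by
  rw [box_eq]
  exact (PiLp.homeomorph 2 (fun _ : Fin d => ℝ)).isCompact_preimage.2 isCompact_Icc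

theorem volume_real_box {d : ℕ} (o : Fin d) {a b : ℝ} (hab : a ≤ b) :
    volume.real (box o a b) = b - a := by
  rw [box_eq, measureReal_def, (measurePreserving_ofLp d).measure_preimage
    measurableSet_Icc.nullMeasurableSet, Real.volume_Icc_pi, ← Finset.mul_prod_erase _ _ (Finset.mem_univ o)]
  rw [Finset.prod_eq_one]
  · simp [hab]
  · intro j hj
    have := (Finset.mem_erase.1 hj).1
    simp [this]

theorem ae_coord_ne {d : ℕ} (o : Fin d) (c : ℝ) : ∀ᵐ x : E d, x o ≠ c := by
  have h : volume {y : Fin d → ℝ | y o = c} = 0 := by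
    rw [volume_pi]; exact Measure.pi_hyperplane (fun _ : Fin d => (volume : Measure ℝ)) o c
  have h2 := (measurePreserving_ofLp d).quasiMeasurePreserving.preimage_null h
  rw [ae_iff]
  simpa using! h2

/-- The half-open slab `{a ≤ x_o < b}`. -/
def slab {d : ℕ} (o : Fin d) (a b : ℝ) : Set (E d) := {x | x o ∈ Set.Ico a b}

theorem measurableSet_slab {d : ℕ} (o : Fin d) (a b : ℝ) : MeasurableSet (slab o a b) :=
  (lipschitzWith_coord o).continuous.measurable measurableSet_Ico

/-! ### Replacing one column of the Jacobian matrix -/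

/-- The Jacobian determinant with the `o`-th partial derivative replaced by `P`. -/
def colDet {d : ℕ} (o : Fin d) (h P : Fin d → E d → ℝ) (x : E d) : ℝ :=
  ((Matrix.of fun j => grad (h j) x).updateCol o fun j => P j x).det

theorem measurable_colDet {d : ℕ} (o : Fin d) (h : Fin d → E d → ℝ) {P : Fin d → E d → ℝ}
    (hP : ∀ j, Measurable (P j)) : Measurable (colDet o h P) := by
  refine measurable_detRows_comp (M := fun x => (Matrix.of fun j => grad (h j) x).updateCol o fun j => P j x)
    fun j => measurable_pi_iff.2 fun k => ?_
  simp only [Matrix.updateCol_apply]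
  split_ifs
  · exact hP j
  · exact (measurable_pi_iff.1 (measurable_grad (h j))) k

theorem abs_det_updateCol_le {d : ℕ} {M : Matrix (Fin d) (Fin d) ℝ} {L K : ℝ} (hL : 1 ≤ L)
    (hK : 0 ≤ K) (o : Fin d) (hM : ∀ j k, |M j k| ≤ L) {v : Fin d → ℝ} (hv : ∀ k, |v k| ≤ K) :
    |(M.updateCol o v).det| ≤ d.factorial * L ^ d * K := by
  rw [← Matrix.det_transpose, ← Matrix.updateRow_transpose]
  exact abs_detRows_update_le hL hK o (M := M.transpose) (fun j k => hM k j) hv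

theorem abs_detRows_sub_le {d : ℕ} {M N : Fin d → Fin d → ℝ} {L ε : ℝ} (hL : 0 ≤ L) (hε : 0 ≤ ε)
    (hM : ∀ j k, |M j k| ≤ L) (hN : ∀ j k, |N j k| ≤ L) (h : ∀ j k, |M j k - N j k| ≤ ε) :
    |detRows d M - detRows d N| ≤ ‖detRows d‖ * d * L ^ (d - 1) * ε := by
  have h1 := (detRows d).norm_image_sub_le M N
  rw [Fintype.card_fin] at h1
  refine h1.trans ?_
  have hM' : ‖M‖ ≤ L := (pi_norm_le_iff_of_nonneg hL).2 fun j => (pi_norm_le_iff_of_nonneg hL).2 (hM j)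
  have hN' : ‖N‖ ≤ L := (pi_norm_le_iff_of_nonneg hL).2 fun j => (pi_norm_le_iff_of_nonneg hL).2 (hN j)
  have hd : ‖M - N‖ ≤ ε := (pi_norm_le_iff_of_nonneg hε).2 fun j => (pi_norm_le_iff_of_nonneg hε).2 (h j)
  gcongr
  exact max_le hM' hN'

/-- Perturbing the partial derivative in direction `o` by `s • P`, and the whole Jacobian matrix by a
small error. -/
theorem abs_jac_sub_le {d : ℕ} (o : Fin d) {h P α : Fin d → E d → ℝ} {x : E d} {s ε L : ℝ}
    (hL : 1 ≤ L) (hε : 0 ≤ ε) (hα : ∀ j k, |grad (α j) x k| ≤ L) (hh : ∀ j k, |grad (h j) x k| ≤ L)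
    (hs : |s| ≤ 1) (hP : ∀ j, |P j x| ≤ 1)
    (he : ∀ j k, |grad (α j) x k - (grad (h j) x + Pi.single o (s * P j x) : Fin d → ℝ) k| ≤ ε) :
    |jac α x - (jac h x + s * colDet o h P x)| ≤ ‖detRows d‖ * d * (L + 1) ^ (d - 1) * ε := by
  have h1 : jac h x + s * colDet o h P x =
      detRows d fun j => grad (h j) x + Pi.single o (s * P j x) := by
    set M := Matrix.of fun j => grad (h j) x with hM
    have e1 : jac h x = (M.updateCol o fun j => M j o).det := by
      rw [Matrix.updateCol_eq_self]; rfl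
    have e2 : colDet o h P x = (M.updateCol o fun j => P j x).det := rfl
    rw [e1, e2, ← Matrix.det_updateCol_smul, ← Matrix.det_updateCol_add,
      detRows_apply]
    congr 1
    ext j k
    by_cases hk : k = o
    · subst hk; simp [hM]
    · simp [hM, hk]
  rw [h1]
  refine abs_detRows_sub_le (by linarith) hε (fun j k => (hα j k).trans (by linarith)) (fun j k => ?_) he
  refine (abs_add_le _ _).trans (add_le_add (hh j k) ?_)
  by_cases hk : k = o
  · subst hk
    simp only [Pi.single_eq_same, abs_mul]
    exact mul_le_one₀ hs (abs_nonneg _) (hP j)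
  · simp [hk]

/-! ### Jacobian integrals over one thin layer -/

section

theorem abs_sub_le_add (a b : ℝ) : |a - b| ≤ |a| + |b| := by
  simpa [sub_eq_add_neg] using abs_add_le a (-b)

/-- `χ` vanishes outside the strip `{0 ≤ x_j ≤ 1 for j ≠ o}`. -/
def VanishesOffStrip {d : ℕ} (o : Fin d) (χ : E d → ℝ) : Prop :=
  ∀ x j, j ≠ o → x j ∉ Set.Icc (0 : ℝ) 1 → χ x = 0

theorem VanishesOffStrip.eq_zero_of_notMem_box {d : ℕ} {o : Fin d} {χ : E d → ℝ}
    (h : VanishesOffStrip o χ) {a b : ℝ} {x : E d} (hx : x ∉ box o a b) (hxo : x o ∈ Set.Icc a b) :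
    χ x = 0 := by
  by_contra hne
  exact hx ⟨hxo, fun j hj => by_contra fun hc => hne (h x j hj hc)⟩

theorem indicator_slab_eq_zero {d : ℕ} {o : Fin d} {F : E d → ℝ}
    (h : VanishesOffStrip o F) {a b : ℝ} {x : E d} (hx : x ∉ box o a b) :
    (slab o a b).indicator F x = 0 := by
  by_cases hs : x ∈ slab o a b
  · rw [Set.indicator_of_mem hs]
    exact h.eq_zero_of_notMem_box hx ⟨hs.1, hs.2.le⟩
  · exact Set.indicator_of_notMem hs _

theorem abs_indicator_le {X : Type*} {F : X → ℝ} {C : ℝ} (hF : ∀ x, |F x| ≤ C) (s : Set X) (x : X) :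
    |s.indicator F x| ≤ C := by
  have hC : 0 ≤ C := (abs_nonneg _).trans (hF x)
  by_cases hs : x ∈ s
  · rw [Set.indicator_of_mem hs]; exact hF x
  · rw [Set.indicator_of_notMem hs, abs_zero]; exact hC

theorem integrableOn_slab {d : ℕ} {o : Fin d} {F : E d → ℝ} (hF : Measurable F) {C : ℝ}
    (hC : ∀ x, |F x| ≤ C) (h : VanishesOffStrip o F) (a b : ℝ) : IntegrableOn F (slab o a b) := by
  rw [← integrable_indicator_iff (measurableSet_slab o a b)]
  exact integrable_of_bounded_of_eq_zero (hF.indicator (measurableSet_slab o a b)).aestronglyMeasurable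
    (isCompact_box o a b).isClosed.measurableSet (isCompact_box o a b).measure_lt_top.ne
    (abs_indicator_le hC _) fun x hx => indicator_slab_eq_zero h hx

theorem abs_setIntegral_slab_le {d : ℕ} {o : Fin d} {F : E d → ℝ} {C : ℝ}
    (hC : ∀ x, |F x| ≤ C) (h : VanishesOffStrip o F) {a b : ℝ} (hab : a ≤ b) :
    |∫ x in slab o a b, F x| ≤ C * (b - a) := by
  rw [← integral_indicator (measurableSet_slab o a b), ← volume_real_box o hab]
  exact abs_integral_le_mul_volume
    (isCompact_box o a b).measure_lt_top.ne
    (abs_indicator_le hC _) fun x hx => indicator_slab_eq_zero h hx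

/-- The difference quotient in direction `o` between the hyperplanes `x_o = a` and `x_o = b`. -/
def diffQuot {d : ℕ} (o : Fin d) (a b : ℝ) (f : E d → ℝ) (x : E d) : ℝ :=
  (f (repl o b x) - f (repl o a x)) / (b - a)

theorem diffQuot_repl {d : ℕ} (o : Fin d) (a b : ℝ) (f : E d → ℝ) (t : ℝ) (x : E d) :
    diffQuot o a b f (repl o t x) = diffQuot o a b f x := by
  simp only [diffQuot, repl_repl]

theorem abs_diffQuot_le {d : ℕ} (o : Fin d) (a b : ℝ) {f : E d → ℝ} (hf : LipschitzWith 1 f)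
    (x : E d) : |diffQuot o a b f x| ≤ 1 := by
  rw [diffQuot, abs_div]
  exact div_le_one_of_le₀ (abs_repl_sub_repl_le o b a hf x) (abs_nonneg _)

/-- The hypothesis encodes `q = 1 / (b - a)` as a nonnegative real. The bound degenerates with the
scale, which is why the comparison functions below live at a coarse scale. -/
theorem lipschitzWith_diffQuot {d : ℕ} (o : Fin d) {a b : ℝ} {q : ℝ≥0} (hq : (b - a) * q = 1)
    {f : E d → ℝ} (hf : LipschitzWith 1 f) : LipschitzWith (2 * q) (diffQuot o a b f) := by
  refine lipschitzWith_real fun x y => ?_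
  have hne : b - a ≠ 0 := fun h => by simp [h] at hq
  have hq' : (q : ℝ) = 1 / (b - a) := by field_simp; linarith
  have e : ∀ z, diffQuot o a b f z = (f (repl o b z) - f (repl o a z)) * q := fun z => by
    rw [diffQuot, hq']; ring
  have h1 := abs_sub_le_of_lipschitz (lipschitzWith_comp_repl o b hf) x y
  have h2 := abs_sub_le_of_lipschitz (lipschitzWith_comp_repl o a hf) x y
  rw [e, e, ← sub_mul, abs_mul, NNReal.abs_eq]
  push_cast at h1 h2 ⊢
  have h3 : |f (repl o b x) - f (repl o a x) - (f (repl o b y) - f (repl o a y))| ≤ 2 * dist x y := by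
    rw [abs_le] at *
    constructor <;> linarith [h1.1, h1.2, h2.1, h2.2]
  nlinarith [q.2]

section Estimates

variable {d : ℕ} {o : Fin d} {h P : Fin d → E d → ℝ} {χ : E d → ℝ} {K B q ℓ : ℝ≥0} {a b c : ℝ}

/-- On a thin slab the Jacobian integral is, up to the deviation of the difference quotients from
`P`, the integral of the determinant with the normal derivative replaced by `P`. -/
theorem abs_setIntegral_slab_jac_sub_colDet_le (hab : b = a + ℓ) (hℓ : 0 < ℓ) (hℓq : ℓ * q ≤ 1)
    (hh : ∀ j, LipschitzWith 1 (h j)) (hP : ∀ j, LipschitzWith (2 * q) (P j))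
    (hP1 : ∀ j x, |P j x| ≤ 1) (hPi : ∀ j t x, P j (repl o t x) = P j x)
    (hχ : LipschitzWith K χ) (hχB : ∀ x, |χ x| ≤ B) (hχ0 : VanishesOffStrip o χ) :
    |∫ x in slab o a b, χ x * (jac h x - colDet o h P x)| ≤
      d.factorial * 7 ^ d * (∫ x in slab o a b, |χ x| * ∑ j, |diffQuot o a b (h j) x - P j x|) +
      (2 * d * d.factorial * 7 ^ d * K + 2 * ‖detRows d‖ * d * 8 ^ (d - 1) * B * q) * ℓ ^ 2 := by
  have hℓ' : (0 : ℝ) < ℓ := hℓ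
  have hℓqR : (ℓ : ℝ) * q ≤ 1 := by exact_mod_cast hℓq
  have hba : b - a = ℓ := by rw [hab]; ring
  set δ : Fin d → E d → ℝ := fun j x => diffQuot o a b (h j) x - P j x with hδ
  set κ : E d → ℝ := fun x => max a (min b (x o)) - a with hκ
  have hκ0 : ∀ x, 0 ≤ κ x := fun x => sub_nonneg.2 (le_max_left a _)
  have hκℓ : ∀ x, κ x ≤ ℓ := fun x => by
    have h1 : max a (min b (x o)) ≤ b := max_le (by rw [hab]; linarith) (min_le_left _ _)
    have h2 : κ x = max a (min b (x o)) - a := rfl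
    linarith
  have hκabs : ∀ x, |κ x| ≤ ℓ := fun x => by rw [abs_of_nonneg (hκ0 x)]; exact hκℓ x
  have hκd : ∀ x y, |κ x - κ y| ≤ |x o - y o| := fun x y => by
    simp only [hκ, sub_sub_sub_cancel_right]
    refine (abs_max_sub_max_le_max a (min b (x o)) a (min b (y o))).trans ?_
    have := abs_min_sub_min_le_max b (x o) b (y o)
    simpa using this
  have hκL : LipschitzWith 1 κ := lipschitzWith_real fun x y =>
    (hκd x y).trans (abs_sub_le_of_lipschitz (lipschitzWith_coord o) x y)
  have hQL : ∀ j, LipschitzWith (2 * ℓ⁻¹) (diffQuot o a b (h j)) := fun j =>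
    lipschitzWith_diffQuot o (by rw [hba, NNReal.coe_inv, mul_inv_cancel₀ hℓ'.ne']) (hh j)
  have hδL : ∀ j, LipschitzWith (2 * ℓ⁻¹ + 2 * q) (δ j) := fun j => (hQL j).sub (hP j)
  have hδ2 : ∀ j x, |δ j x| ≤ (2 : ℝ≥0) := fun j x => by
    refine (abs_sub_le_add _ _).trans ?_
    have := abs_diffQuot_le o a b (hh j) x
    have := hP1 j x
    push_cast
    linarith
  -- Inside the slab, `α = h - κ P` has Jacobian close to `jac h - colDet o h P`. The map `β`
  -- interpolates `h` linearly between the two faces and subtracts the same `κ P`. Its normal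
  -- derivative is `δ`, so its Jacobian is controlled by `δ`. The maps are within `2ℓ` of each other
  -- and agree outside the slab, so their weighted Jacobian integrals are close.
  set α : Fin d → E d → ℝ := fun j x => h j (repl o (a + κ x) x) - κ x * P j x with hα
  set β : Fin d → E d → ℝ := fun j x => h j (repl o a x) + κ x * δ j x with hβ
  have hαL : ∀ j, LipschitzWith 7 (α j) := by
    intro j
    have h1 : LipschitzWith 1 fun x => h j (repl o (a + κ x) x) := lipschitzWith_real fun x y => by
      refine (abs_sub_le_of_lipschitz (hh j) _ _).trans (mul_le_mul_of_nonneg_left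
        (dist_repl_le o ?_) zero_le_one)
      rw [add_sub_add_left_eq_sub]
      exact hκd x y
    have h2 := lipschitzWith_mul hκL (hP j) hκabs (b := 1) (by simpa using hP1 j)
    refine (h1.sub h2).weaken ?_
    rw [← NNReal.coe_le_coe]
    push_cast
    nlinarith
  -- The constant 7 bounds `1 + ℓ (2/ℓ + 2q) + 2`, with `ℓ q ≤ 1`.
  have hβL : ∀ j, LipschitzWith 7 (β j) := by
    intro j
    have h2 := lipschitzWith_mul hκL (hδL j) hκabs (hδ2 j)
    refine ((lipschitzWith_comp_repl o a (hh j)).add h2).weaken ?_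
    rw [← NNReal.coe_le_coe]
    push_cast
    have : (ℓ : ℝ) * (2 * (ℓ : ℝ)⁻¹ + 2 * q) = 2 + 2 * (ℓ * q) := by field_simp
    rw [this]
    linarith
  have hdiff : ∀ j x, α j x - β j x = h j (repl o (a + κ x) x) - h j (repl o a x) -
      κ x / ℓ * (h j (repl o b x) - h j (repl o a x)) := by
    intro j x
    simp only [hα, hβ, hδ, diffQuot, hba]
    ring
  have hsmall : ∀ j x, |α j x - β j x| ≤ (2 * ℓ : ℝ≥0) := by
    intro j x
    rw [hdiff]
    refine (abs_sub_le_add _ _).trans ?_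
    have h1 := abs_repl_sub_repl_le o (a + κ x) a (hh j) x
    have h2 := abs_repl_sub_repl_le o b a (hh j) x
    rw [add_sub_cancel_left] at h1
    rw [hba, NNReal.abs_eq] at h2
    rw [abs_mul, abs_div, NNReal.abs_eq]
    have h3 : |κ x| / ℓ ≤ 1 := (div_le_one hℓ').2 (hκabs x)
    have h4 := mul_le_mul h3 h2 (abs_nonneg _) zero_le_one
    have := hκabs x
    push_cast
    linarith
  have hαβ : ∀ x, x o ≤ a ∨ b ≤ x o → ∀ j, α j x = β j x := by
    intro x hx j
    rw [← sub_eq_zero, hdiff]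
    rcases hx with hx | hx
    · have : κ x = 0 := by
        simp only [hκ]
        rw [max_eq_left ((min_le_right _ _).trans hx), sub_self]
      simp [this]
    · have : κ x = ℓ := by
        simp only [hκ]
        rw [min_eq_left hx, max_eq_right (by linarith), hba]
      rw [this, ← hab, div_self hℓ'.ne']
      ring
  obtain ⟨hNi, hN⟩ := abs_integral_mul_jac_sub_jac_le (L := 7) (by norm_num) hαL hβL hχ hχB hsmall
    (isCompact_box o a b) (fun x hx => by
      by_cases hxo : x o ∈ Set.Icc a b
      · exact Or.inl (hχ0.eq_zero_of_notMem_box hx hxo)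
      · right
        refine hαβ x ?_
        by_contra hc
        push Not at hc
        exact hxo ⟨hc.1.le, hc.2.le⟩)
  rw [volume_real_box o (by linarith), hba] at hN
  set F : E d → ℝ := fun x => χ x * (jac h x - colDet o h P x) with hF
  set S : Set (E d) := slab o a b
  set G : E d → ℝ := fun x => |χ x| * (d.factorial * 7 ^ d * ∑ j, |δ j x| +
    ‖detRows d‖ * d * (7 + 1) ^ (d - 1) * (ℓ * (2 * q))) with hG
  have hgrad1 : ∀ j x k, |grad (h j) x k| ≤ 1 := fun j x k => by
    simpa using abs_grad_le (hh j) x k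
  have hae : ∀ᵐ x : E d, |S.indicator F x - χ x * (jac α x - jac β x)| ≤ S.indicator G x := by
    filter_upwards [ae_coord_ne o a, ae_coord_ne o b, ae_all_iff.2 fun j => (hh j).ae_differentiableAt,
      ae_all_iff.2 fun j => (hP j).ae_differentiableAt,
      ae_all_iff.2 fun j => (lipschitzWith_comp_repl o a (hh j)).ae_differentiableAt,
      ae_all_iff.2 fun j => (hδL j).ae_differentiableAt] with x hxa hxb hdh hdP hda hdδ
    by_cases hx : x ∈ S
    · rw [Set.indicator_of_mem hx, Set.indicator_of_mem hx]
      have hxa' : a < x o := lt_of_le_of_ne hx.1 (Ne.symm hxa)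
      have hκe : κ =ᶠ[𝓝 x] fun y => 1 * y o + -a := by
        have hc := (lipschitzWith_coord o).continuous.continuousAt (x := x)
        filter_upwards [hc.eventually_const_lt hxa', hc.eventually_lt_const hx.2] with y hy1 hy2
        simp only [hκ]
        rw [min_eq_right hy2.le, max_eq_right hy1.le]
        ring
      have hgκ : grad κ x = Pi.single o 1 := by
        rw [grad_congr hκe, grad_coord_add]
      have hdκ : DifferentiableAt ℝ κ x :=
        (differentiableAt_coord_add o 1 (-a) x).congr_of_eventuallyEq hκe
      have hgα : ∀ j, grad (α j) x = grad (h j) x - (κ x • grad (P j) x + P j x • Pi.single o 1) := by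
        intro j
        have he : α j =ᶠ[𝓝 x] fun y => h j y - κ y * P j y := by
          filter_upwards [hκe] with y hy
          have : a + κ y = y o := by rw [hy]; ring
          simp only [hα]
          rw [this, repl_self]
        rw [grad_congr he, grad_sub (hdh j) (hdκ.fun_mul (hdP j)), grad_mul hdκ (hdP j), hgκ]
      -- In the product rule only `κ` depends on `x_o`; `δ` and the boundary values of `h` do not.
      have hgβ : ∀ j, grad (β j) x o = δ j x := by
        intro j
        simp only [hβ]
        rw [grad_add (hda j) (hdκ.fun_mul (hdδ j)), grad_mul hdκ (hdδ j), hgκ]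
        simp only [Pi.add_apply, Pi.smul_apply, Pi.single_eq_same, smul_eq_mul, mul_one]
        rw [grad_eq_zero_of_indep (fun t y => by simp only [repl_repl]),
          grad_eq_zero_of_indep (fun t y => by simp only [hδ, diffQuot_repl, hPi])]
        ring
      have hjα : |jac α x - (jac h x + (-1) * colDet o h P x)| ≤
          ‖detRows d‖ * d * (7 + 1) ^ (d - 1) * (ℓ * (2 * q)) := by
        refine abs_jac_sub_le o (by norm_num) (by positivity) (fun j k => abs_grad_le (hαL j) x k)
          (fun j k => (hgrad1 j x k).trans (by norm_num)) (by norm_num) (fun j => hP1 j x)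
          fun j k => ?_
        rw [hgα]
        have : (grad (h j) x - (κ x • grad (P j) x + P j x • Pi.single o 1) : Fin d → ℝ) k -
            (grad (h j) x + Pi.single o (-1 * P j x) : Fin d → ℝ) k = -(κ x * grad (P j) x k) := by
          by_cases hk : k = o
          · subst hk
            simp only [Pi.sub_apply, Pi.add_apply, Pi.smul_apply, Pi.single_eq_same, smul_eq_mul]
            ring
          · simp [hk]
        rw [this, abs_neg, abs_mul]
        exact mul_le_mul (hκabs x) (by simpa using abs_grad_le (hP j) x k) (abs_nonneg _) hℓ'.le
      have hjβ : |jac β x| ≤ d.factorial * 7 ^ d * ∑ j, |δ j x| := by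
        have : jac β x = ((Matrix.of fun j => grad (β j) x).updateCol o fun j => δ j x).det := by
          have e : (fun j => δ j x) = fun j => (Matrix.of fun j => grad (β j) x) j o :=
            funext fun j => (hgβ j).symm
          rw [e, Matrix.updateCol_eq_self]; rfl
        rw [this]
        exact abs_det_updateCol_le (by norm_num) (Finset.sum_nonneg fun j _ => abs_nonneg _) o
          (fun j k => abs_grad_le (hβL j) x k) fun j =>
            Finset.single_le_sum (f := fun j => |δ j x|) (fun j _ => abs_nonneg _) (Finset.mem_univ j)
      have e : F x - χ x * (jac α x - jac β x) =
          χ x * (jac β x - (jac α x - (jac h x + (-1) * colDet o h P x))) := by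
        simp only [hF]; ring
      rw [e, abs_mul]
      refine mul_le_mul_of_nonneg_left ((abs_sub_le_add _ _).trans (add_le_add hjβ hjα)) (abs_nonneg _)
    · rw [Set.indicator_of_notMem hx, Set.indicator_of_notMem hx]
      have hc := (lipschitzWith_coord o).continuous.continuousAt (x := x)
      have hev : ∀ j, α j =ᶠ[𝓝 x] β j := by
        intro j
        rcases lt_or_gt_of_ne hxa with h1 | h1
        · filter_upwards [hc.eventually_lt_const h1] with y hy using hαβ y (Or.inl hy.le) j
        · have h2 : b < x o := by
            rcases lt_or_gt_of_ne hxb with h2 | h2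
            · exact absurd ⟨h1.le, h2⟩ hx
            · exact h2
          filter_upwards [hc.eventually_const_lt h2] with y hy using hαβ y (Or.inr hy.le) j
      have : jac α x = jac β x := by
        unfold jac
        simp only [fun j => grad_congr (hev j)]
      rw [this]
      simp
  have hmF : Measurable F := hχ.continuous.measurable.mul
    ((measurable_jac h).sub (measurable_colDet o h fun j => (hP j).continuous.measurable))
  have hFi : IntegrableOn F S := by
    refine integrableOn_slab hmF (C := B * (d.factorial * 1 ^ d + d.factorial * 1 ^ d * 1)) ?_
      (fun x j hj hx => by simp only [hF, hχ0 x j hj hx, zero_mul]) a b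
    intro x
    simp only [hF]
    rw [abs_mul]
    refine mul_le_mul (hχB x) ((abs_sub_le_add _ _).trans (add_le_add (abs_detRows_le fun j k => hgrad1 j x k)
      (abs_det_updateCol_le le_rfl zero_le_one o (fun j k => hgrad1 j x k) fun j => hP1 j x)))
      (abs_nonneg _) B.2
  have hsumb : ∀ x, ∑ j, |δ j x| ≤ d * 2 := fun x => by
    refine (Finset.sum_le_card_nsmul _ _ 2 fun j _ => by simpa using hδ2 j x).trans ?_
    simp
  have hsum0 : ∀ x, 0 ≤ ∑ j, |δ j x| := fun x => Finset.sum_nonneg fun j _ => abs_nonneg _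
  have hmδ : Measurable fun x => ∑ j, |δ j x| :=
    Finset.measurable_fun_sum _ fun j _ => (hδL j).continuous.abs.measurable
  have hmχ : Measurable fun x => |χ x| := hχ.continuous.abs.measurable
  have hG1 : IntegrableOn (fun x => |χ x| * ∑ j, |δ j x|) S := by
    refine integrableOn_slab (hmχ.mul hmδ) (C := B * (d * 2)) (fun x => ?_)
      (fun x j hj hx => by simp [hχ0 x j hj hx]) a b
    rw [Pi.mul_apply, abs_mul, abs_abs, abs_of_nonneg (hsum0 x)]
    exact mul_le_mul (hχB x) (hsumb x) (hsum0 x) B.2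
  have hG2 : IntegrableOn (fun x => |χ x|) S :=
    integrableOn_slab hmχ (C := B) (fun x => by rw [abs_abs]; exact hχB x)
      (fun x j hj hx => by simp only [hχ0 x j hj hx, abs_zero]) a b
  have hG2b : ∫ x in S, |χ x| ≤ B * ℓ := by
    have := abs_setIntegral_slab_le (F := fun x => |χ x|) (C := B) (o := o)
      (fun x => by rw [abs_abs]; exact hχB x)
      (fun x j hj hx => by simp only [hχ0 x j hj hx, abs_zero]) (a := a) (b := b) (by linarith)
    rw [hba] at this
    exact (le_abs_self _).trans this
  have hGe : G = fun x => d.factorial * 7 ^ d * (|χ x| * ∑ j, |δ j x|) +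
      ‖detRows d‖ * d * (7 + 1) ^ (d - 1) * (ℓ * (2 * q)) * |χ x| := by
    ext x; simp only [hG]; ring
  have hGi : IntegrableOn G S := by
    rw [hGe]; exact (hG1.const_mul _).add (hG2.const_mul _)
  have hmS := measurableSet_slab o a b
  have hGint : ∫ x in S, G x ≤ d.factorial * 7 ^ d * (∫ x in S, |χ x| * ∑ j, |δ j x|) +
      ‖detRows d‖ * d * (7 + 1) ^ (d - 1) * (ℓ * (2 * q)) * (B * ℓ) := by
    rw [hGe, integral_add (hG1.const_mul _) (hG2.const_mul _), integral_const_mul, integral_const_mul]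
    have := mul_le_mul_of_nonneg_left hG2b
      (show 0 ≤ ‖detRows d‖ * d * (7 + 1) ^ (d - 1) * (ℓ * (2 * q)) by positivity)
    linarith
  have hfin : |∫ x, (S.indicator F x - χ x * (jac α x - jac β x))| ≤ ∫ x in S, G x := by
    rw [← integral_indicator hmS]
    exact norm_integral_le_of_norm_le (f := fun x => S.indicator F x - χ x * (jac α x - jac β x))
      ((integrable_indicator_iff hmS).2 hGi) hae
  rw [integral_sub ((integrable_indicator_iff hmS).2 hFi) hNi, integral_indicator hmS] at hfin
  have h1 := abs_sub_abs_le_abs_sub (∫ x in S, F x) (∫ x, χ x * (jac α x - jac β x))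
  push_cast at hN
  have e8 : (7 : ℝ) + 1 = 8 := by norm_num
  rw [e8] at hGint
  have h2 : |∫ x in S, F x| ≤ _ := (sub_le_iff_le_add.1 (h1.trans (hfin.trans hGint))).trans
    (add_le_add_right hN _)
  refine h2.trans (le_of_eq ?_)
  ring

end Estimates

end

/-! ### Comparison of two adjacent layers -/

section

section Pair

variable {d : ℕ} {o : Fin d} {h P : Fin d → E d → ℝ} {χ : E d → ℝ} {K B q ℓ : ℝ≥0} {a b c : ℝ}

theorem slab_subset_slab {a b a' b' : ℝ} (ha : a' ≤ a) (hb : b ≤ b') :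
    slab o a b ⊆ slab o a' b' := fun _ hx => ⟨ha.trans hx.1, hx.2.trans_le hb⟩

theorem integrableOn_mul_colDet (hh : ∀ j, LipschitzWith 1 (h j)) (hP : ∀ j, LipschitzWith q (P j))
    (hP1 : ∀ j x, |P j x| ≤ 1) (hχ : LipschitzWith K χ) (hχB : ∀ x, |χ x| ≤ B)
    (hχ0 : VanishesOffStrip o χ) (a b : ℝ) :
    IntegrableOn (fun x => χ x * colDet o h P x) (slab o a b) := by
  refine integrableOn_slab (hχ.continuous.measurable.mul
    (measurable_colDet o h fun j => (hP j).continuous.measurable))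
    (C := B * (d.factorial * 1 ^ d * 1)) (fun x => ?_)
    (fun x j hj hx => by simp [hχ0 x j hj hx]) a b
  rw [Pi.mul_apply, abs_mul]
  refine mul_le_mul (hχB x) (abs_det_updateCol_le le_rfl zero_le_one o
    (fun j k => by simpa using abs_grad_le (hh j) x k) fun j => hP1 j x) (abs_nonneg _) B.2

theorem integrableOn_mul_jac (hh : ∀ j, LipschitzWith 1 (h j)) (hχ : Measurable χ)
    (hχB : ∀ x, |χ x| ≤ B) (hχ0 : VanishesOffStrip o χ) (a b : ℝ) :
    IntegrableOn (fun x => χ x * jac h x) (slab o a b) := by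
  refine integrableOn_slab (hχ.mul (measurable_jac h))
    (C := B * (d.factorial * 1 ^ d)) (fun x => ?_) (fun x j hj hx => by simp [hχ0 x j hj hx]) a b
  rw [Pi.mul_apply, abs_mul]
  exact mul_le_mul (hχB x) (abs_detRows_le fun j k => by simpa using abs_grad_le (hh j) x k)
    (abs_nonneg _) B.2

/-- The determinant with normal derivative `P` has nearly equal integrals over adjacent slabs. -/
theorem abs_setIntegral_colDet_sub_le (hab : b = a + ℓ) (hbc : c = b + ℓ) (hℓ : 0 < ℓ)
    (hℓq : ℓ * q ≤ 1)
    (hh : ∀ j, LipschitzWith 1 (h j)) (hP : ∀ j, LipschitzWith (2 * q) (P j))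
    (hP1 : ∀ j x, |P j x| ≤ 1)
    (hχ : LipschitzWith K χ) (hχB : ∀ x, |χ x| ≤ B) (hχ0 : VanishesOffStrip o χ) :
    |(∫ x in slab o a b, χ x * colDet o h P x) - ∫ x in slab o b c, χ x * colDet o h P x| ≤
      (2 * d * d.factorial * 7 ^ d * K + 4 * ‖detRows d‖ * d * 8 ^ (d - 1) * B * q) * ℓ ^ 2 := by
  have hℓ' : (0 : ℝ) < ℓ := hℓ
  have hℓqR : (ℓ : ℝ) * q ≤ 1 := by exact_mod_cast hℓq
  have hca : c - a = 2 * ℓ := by rw [hbc, hab]; ring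
  -- A tent over the two slabs, with slope `1` on the first and `-1` on the second. Adding `τ P` to
  -- `h` is a perturbation of size `ℓ`, so it hardly changes the weighted Jacobian integral. To
  -- first order the change is the integral of `colDet o h P` over the first slab minus that over
  -- the second.
  set τ : E d → ℝ := fun x => max 0 (ℓ - |x o - b|) with hτ
  have hτ0 : ∀ x, 0 ≤ τ x := fun x => le_max_left _ _
  have hτabs : ∀ x, |τ x| ≤ ℓ := fun x => by
    rw [abs_of_nonneg (hτ0 x)]
    exact max_le ℓ.2 (by linarith [abs_nonneg (x o - b)])
  have hτL : LipschitzWith 1 τ := lipschitzWith_real fun x y => by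
    refine (abs_max_sub_max_le_max 0 _ 0 _).trans ?_
    have h1 := abs_abs_sub_abs_le_abs_sub (y o - b) (x o - b)
    have h2 := abs_sub_le_of_lipschitz (lipschitzWith_coord o) y x
    rw [dist_comm] at h2
    have h3 : (ℓ : ℝ) - |x o - b| - (ℓ - |y o - b|) = |y o - b| - |x o - b| := by ring
    rw [h3, sub_self, abs_zero, max_eq_right (abs_nonneg _)]
    rw [sub_sub_sub_cancel_right] at h1
    exact h1.trans h2
  set α : Fin d → E d → ℝ := fun j x => h j x + τ x * P j x with hα
  have hαL : ∀ j, LipschitzWith 7 (α j) := by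
    intro j
    have h2 := lipschitzWith_mul hτL (hP j) hτabs (b := 1) (by simpa using hP1 j)
    refine ((hh j).add h2).weaken ?_
    rw [← NNReal.coe_le_coe]
    push_cast
    linarith
  have hsmall : ∀ j x, |α j x - h j x| ≤ ℓ := fun j x => by
    simp only [hα, add_sub_cancel_left, abs_mul]
    exact (mul_le_mul (hτabs x) (hP1 j x) (abs_nonneg _) ℓ.2).trans_eq (mul_one _)
  have hαh : ∀ x, x o ≤ a ∨ c ≤ x o → ∀ j, α j x = h j x := by
    intro x hx j
    have h1 : (ℓ : ℝ) ≤ |x o - b| := by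
      rcases hx with hx | hx
      · exact le_trans (by linarith) (neg_abs_le (x o - b) |> fun H => (neg_le.1 H))
      · exact le_trans (by linarith) (le_abs_self (x o - b))
    have h2 : τ x = 0 := max_eq_left (by linarith)
    simp [hα, h2]
  obtain ⟨hNi, hN⟩ := abs_integral_mul_jac_sub_jac_le (L := 7) (β := h) (by norm_num) hαL
    (fun j => (hh j).weaken (by norm_num)) hχ hχB hsmall
    (isCompact_box o a c) (fun x hx => by
      by_cases hxo : x o ∈ Set.Icc a c
      · exact Or.inl (hχ0.eq_zero_of_notMem_box hx hxo)
      · right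
        refine hαh x ?_
        by_contra hc
        push Not at hc
        exact hxo ⟨hc.1.le, hc.2.le⟩)
  rw [volume_real_box o (by linarith), hca] at hN
  set F : E d → ℝ := fun x => χ x * colDet o h P x with hF
  set D : ℝ := ‖detRows d‖ * d * (7 + 1) ^ (d - 1) * (ℓ * (2 * q)) with hD
  have hD0 : 0 ≤ D := by positivity
  have hgrad1 : ∀ j x k, |grad (h j) x k| ≤ 1 := fun j x k => by
    simpa using abs_grad_le (hh j) x k
  -- The error `D` comes from the remaining product rule term `τ grad P`, of size at most `ℓ · 2q`.
  have hgα : ∀ s t : ℝ, |s| ≤ 1 → ∀ x : E d, (∀ j, DifferentiableAt ℝ (h j) x) →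
      (∀ j, DifferentiableAt ℝ (P j) x) → (τ =ᶠ[𝓝 x] fun y => s * y o + t) →
      |jac α x - (jac h x + s * colDet o h P x)| ≤ D := by
    intro s t hs x hdh hdP hτe
    have hgτ : grad τ x = Pi.single o s := by rw [grad_congr hτe, grad_coord_add]
    have hdτ : DifferentiableAt ℝ τ x :=
      (differentiableAt_coord_add o s t x).congr_of_eventuallyEq hτe
    refine abs_jac_sub_le o (by norm_num) (by positivity) (fun j k => abs_grad_le (hαL j) x k)
      (fun j k => (hgrad1 j x k).trans (by norm_num)) hs (fun j => hP1 j x) fun j k => ?_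
    have e1 : grad (α j) x = grad (h j) x + (τ x • grad (P j) x + P j x • Pi.single o s) := by
      simp only [hα]
      rw [grad_add (hdh j) (hdτ.fun_mul (hdP j)), grad_mul hdτ (hdP j), hgτ]
    rw [e1]
    have : (grad (h j) x + (τ x • grad (P j) x + P j x • Pi.single o s) : Fin d → ℝ) k -
        (grad (h j) x + Pi.single o (s * P j x) : Fin d → ℝ) k = τ x * grad (P j) x k := by
      by_cases hk : k = o
      · subst hk
        simp only [Pi.add_apply, Pi.smul_apply, Pi.single_eq_same, smul_eq_mul]
        ring
      · simp [hk]
    rw [this, abs_mul]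
    exact mul_le_mul (hτabs x) (by simpa using abs_grad_le (hP j) x k) (abs_nonneg _) hℓ'.le
  have hbound : ∀ x s, |jac α x - (jac h x + s * colDet o h P x)| ≤ D →
      |χ x * (jac α x - jac h x) - s * F x| ≤ |χ x| * D := by
    intro x s hx
    have : χ x * (jac α x - jac h x) - s * F x =
        χ x * (jac α x - (jac h x + s * colDet o h P x)) := by
      simp only [hF]; ring
    rw [this, abs_mul]
    exact mul_le_mul_of_nonneg_left hx (abs_nonneg _)
  have hae : ∀ᵐ x : E d, |χ x * (jac α x - jac h x) -
      ((slab o a b).indicator F x - (slab o b c).indicator F x)| ≤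
      (slab o a c).indicator (fun x => |χ x| * D) x := by
    filter_upwards [ae_coord_ne o a, ae_coord_ne o b, ae_coord_ne o c,
      ae_all_iff.2 fun j => (hh j).ae_differentiableAt,
      ae_all_iff.2 fun j => (hP j).ae_differentiableAt] with x hxa hxb hxc hdh hdP
    have hc := (lipschitzWith_coord o).continuous.continuousAt (x := x)
    by_cases hx1 : x ∈ slab o a b
    · have hx2 : x ∉ slab o b c := fun H => not_lt_of_ge H.1 hx1.2
      rw [Set.indicator_of_mem hx1, Set.indicator_of_notMem hx2,
        Set.indicator_of_mem (slab_subset_slab le_rfl (by linarith) hx1)]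
      have hxa' : a < x o := lt_of_le_of_ne hx1.1 (Ne.symm hxa)
      have := hbound x 1 (hgα 1 (ℓ - b) (by norm_num) x hdh hdP (by
        filter_upwards [hc.eventually_const_lt hxa', hc.eventually_lt_const hx1.2] with y hy1 hy2
        simp only [hτ]
        rw [abs_of_neg (by linarith), max_eq_right (by linarith)]
        ring))
      simpa using this
    · by_cases hx2 : x ∈ slab o b c
      · rw [Set.indicator_of_notMem hx1, Set.indicator_of_mem hx2,
          Set.indicator_of_mem (slab_subset_slab (by linarith) le_rfl hx2)]
        have hxb' : b < x o := lt_of_le_of_ne hx2.1 (Ne.symm hxb)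
        have := hbound x (-1) (hgα (-1) (ℓ + b) (by norm_num) x hdh hdP (by
          filter_upwards [hc.eventually_const_lt hxb', hc.eventually_lt_const hx2.2] with y hy1 hy2
          simp only [hτ]
          rw [abs_of_pos (by linarith), max_eq_right (by linarith)]
          ring))
        simpa using this
      · have hx3 : x ∉ slab o a c := fun H => by
          by_cases hb : x o < b
          · exact hx1 ⟨H.1, hb⟩
          · exact hx2 ⟨not_lt.1 hb, H.2⟩
        rw [Set.indicator_of_notMem hx1, Set.indicator_of_notMem hx2, Set.indicator_of_notMem hx3]
        have hev : ∀ j, α j =ᶠ[𝓝 x] h j := by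
          intro j
          rcases lt_or_gt_of_ne hxa with h1 | h1
          · filter_upwards [hc.eventually_lt_const h1] with y hy using hαh y (Or.inl hy.le) j
          · have h2 : c < x o := by
              rcases lt_or_gt_of_ne hxc with h2 | h2
              · exact absurd ⟨h1.le, h2⟩ hx3
              · exact h2
            filter_upwards [hc.eventually_const_lt h2] with y hy using hαh y (Or.inr hy.le) j
        have : jac α x = jac h x := by
          unfold jac
          simp only [fun j => grad_congr (hev j)]
        rw [this]
        simp
  have hFi := integrableOn_mul_colDet hh hP hP1 hχ hχB hχ0
  have hG2 : IntegrableOn (fun x => |χ x| * D) (slab o a c) :=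
    (integrableOn_slab (F := fun x => |χ x|) hχ.continuous.abs.measurable (C := B)
      (fun x => by rw [abs_abs]; exact hχB x)
      (fun x j hj hx => by simp only [hχ0 x j hj hx, abs_zero]) a c).mul_const _
  have hG2b : ∫ x in slab o a c, |χ x| ≤ B * (2 * ℓ) := by
    have := abs_setIntegral_slab_le (F := fun x => |χ x|) (C := B) (o := o)
      (fun x => by rw [abs_abs]; exact hχB x)
      (fun x j hj hx => by simp only [hχ0 x j hj hx, abs_zero]) (a := a) (b := c) (by linarith)
    rw [hca] at this
    exact (le_abs_self _).trans this
  have hfin := norm_integral_le_of_norm_le (f := fun x => χ x * (jac α x - jac h x) -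
      ((slab o a b).indicator F x - (slab o b c).indicator F x))
      ((integrable_indicator_iff (measurableSet_slab o a c)).2 hG2) hae
  have hi1 : Integrable ((slab o a b).indicator F) :=
    (integrable_indicator_iff (measurableSet_slab o a b)).2 (hFi a b)
  have hi2 : Integrable ((slab o b c).indicator F) :=
    (integrable_indicator_iff (measurableSet_slab o b c)).2 (hFi b c)
  have hi3 : Integrable fun x => (slab o a b).indicator F x - (slab o b c).indicator F x :=
    hi1.sub hi2
  rw [integral_indicator (measurableSet_slab o a c), integral_mul_const,
    integral_sub hNi hi3, integral_sub hi1 hi2,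
    integral_indicator (measurableSet_slab o a b), integral_indicator (measurableSet_slab o b c),
    Real.norm_eq_abs] at hfin
  have h1 := abs_sub_abs_le_abs_sub
    ((∫ x in slab o a b, F x) - ∫ x in slab o b c, F x) (∫ x, χ x * (jac α x - jac h x))
  rw [abs_sub_comm _ (∫ x, χ x * (jac α x - jac h x))] at h1
  have h3 := mul_le_mul_of_nonneg_right hG2b hD0
  push_cast at hN
  have h2 := (sub_le_iff_le_add.1 (h1.trans (hfin.trans h3))).trans (add_le_add_right hN _)
  refine h2.trans (le_of_eq ?_)
  rw [hD, show (7 : ℝ) + 1 = 8 by norm_num]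
  ring

/-- The constant in the error terms of the layer estimates. -/
def layerConst (d : ℕ) : ℝ := 6 * d * d.factorial * 7 ^ d + 8 * ‖detRows d‖ * d * 8 ^ (d - 1)

theorem layerConst_nonneg (d : ℕ) : 0 ≤ layerConst d := by unfold layerConst; positivity

/-- On each layer the Jacobian is traded for `colDet o h P`, whose integrals over the two layers
nearly coincide. The three error terms add up to the coefficients `6` and `8` in `layerConst`. -/
theorem abs_setIntegral_jac_sub_le (hab : b = a + ℓ) (hbc : c = b + ℓ) (hℓ : 0 < ℓ)
    (hℓq : ℓ * q ≤ 1)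
    (hh : ∀ j, LipschitzWith 1 (h j)) (hP : ∀ j, LipschitzWith (2 * q) (P j))
    (hP1 : ∀ j x, |P j x| ≤ 1) (hPi : ∀ j t x, P j (repl o t x) = P j x)
    (hχ : LipschitzWith K χ) (hχB : ∀ x, |χ x| ≤ B) (hχ0 : VanishesOffStrip o χ) :
    |(∫ x in slab o a b, χ x * jac h x) - ∫ x in slab o b c, χ x * jac h x| ≤
      d.factorial * 7 ^ d * ((∫ x in slab o a b, |χ x| * ∑ j, |diffQuot o a b (h j) x - P j x|) +
        ∫ x in slab o b c, |χ x| * ∑ j, |diffQuot o b c (h j) x - P j x|) +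
      layerConst d * (K + B * q) * ℓ ^ 2 := by
  have h1 := abs_setIntegral_slab_jac_sub_colDet_le hab hℓ hℓq hh hP hP1 hPi hχ hχB hχ0
  have h2 := abs_setIntegral_slab_jac_sub_colDet_le hbc hℓ hℓq hh hP hP1 hPi hχ hχB hχ0
  have h3 := abs_setIntegral_colDet_sub_le hab hbc hℓ hℓq hh hP hP1 hχ hχB hχ0
  have hci := integrableOn_mul_colDet hh hP hP1 hχ hχB hχ0
  have hji := integrableOn_mul_jac hh hχ.continuous.measurable hχB hχ0
  simp only [mul_sub] at h1 h2
  rw [integral_sub (hji a b) (hci a b)] at h1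
  rw [integral_sub (hji b c) (hci b c)] at h2
  have e : (∫ x in slab o a b, χ x * jac h x) - ∫ x in slab o b c, χ x * jac h x =
      ((∫ x in slab o a b, χ x * jac h x) - ∫ x in slab o a b, χ x * colDet o h P x) -
      ((∫ x in slab o b c, χ x * jac h x) - ∫ x in slab o b c, χ x * colDet o h P x) +
      ((∫ x in slab o a b, χ x * colDet o h P x) - ∫ x in slab o b c, χ x * colDet o h P x) := by
    ring
  rw [e]
  refine (abs_add_le _ _).trans ((add_le_add ((abs_sub_le_add _ _).trans (add_le_add h1 h2)) h3).trans ?_)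
  have hA : 0 ≤ (6 * d * d.factorial * 7 ^ d : ℝ) := by positivity
  have hB : 0 ≤ 8 * ‖detRows d‖ * d * 8 ^ (d - 1) := by positivity
  have h4 : 0 ≤ (6 * d * d.factorial * 7 ^ d : ℝ) * (B * q) * ℓ ^ 2 := by positivity
  have h5 : 0 ≤ (8 * ‖detRows d‖ * d * 8 ^ (d - 1)) * K * ℓ ^ 2 := by positivity
  unfold layerConst
  nlinarith [h4, h5]

end Pair

end

/-! ### Difference quotients across scales, energies and waves -/

section

theorem sum_range_mul_eq (f : ℕ → ℝ) (q m : ℕ) :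
    ∑ l ∈ Finset.range (q * m), f l = ∑ j ∈ Finset.range q, ∑ i ∈ Finset.range m, f (j * m + i) := by
  induction q with
  | zero => simp
  | succ q ih => rw [Nat.succ_mul, Finset.sum_range_add, ih, Finset.sum_range_succ]

/-- Pythagoras: the block means `C` are the orthogonal projection of `c` onto sequences constant on
blocks of length `m`. -/
theorem sum_sq_sub_block_mean (c C : ℕ → ℝ) (q m : ℕ) (hm : 0 < m)
    (hC : ∀ j, m * C j = ∑ i ∈ Finset.range m, c (j * m + i)) :
    ∑ l ∈ Finset.range (q * m), (c l - C (l / m)) ^ 2 =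
      ∑ l ∈ Finset.range (q * m), c l ^ 2 - m * ∑ j ∈ Finset.range q, C j ^ 2 := by
  rw [sum_range_mul_eq, sum_range_mul_eq, Finset.mul_sum, ← Finset.sum_sub_distrib]
  refine Finset.sum_congr rfl fun j _ => ?_
  have h1 : ∀ i ∈ Finset.range m, (c (j * m + i) - C ((j * m + i) / m)) ^ 2 =
      c (j * m + i) ^ 2 - 2 * C j * c (j * m + i) + C j ^ 2 := by
    intro i hi
    have : (j * m + i) / m = j := by
      rw [mul_comm, Nat.mul_add_div hm, Nat.div_eq_of_lt (Finset.mem_range.1 hi), add_zero]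
    rw [this]; ring
  rw [Finset.sum_congr rfl h1, Finset.sum_add_distrib, Finset.sum_sub_distrib, ← Finset.mul_sum, ← hC]
  simp
  ring

variable {d : ℕ} {o : Fin d}

/-- The difference quotient over the `l`-th of the intervals of length `1/n`. -/
def cellQuot (o : Fin d) (n l : ℕ) (f : E d → ℝ) (x : E d) : ℝ :=
  diffQuot o (l / n) ((l + 1) / n) f x

/-- The mean square of the difference quotients at scale `1/n`. -/
def energy (o : Fin d) (n : ℕ) (f : E d → ℝ) (x : E d) : ℝ :=
  (1 / n) * ∑ l ∈ Finset.range n, cellQuot o n l f x ^ 2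

theorem cellQuot_eq {n : ℕ} (hn : 0 < n) (l : ℕ) (f : E d → ℝ) (x : E d) :
    cellQuot o n l f x = n * (f (repl o ((l + 1 : ℕ) / n) x) - f (repl o (l / n) x)) := by
  have : (0 : ℝ) < n := by exact_mod_cast hn
  have e : ((l : ℝ) + 1) / n - l / n = 1 / n := by field_simp; ring
  rw [cellQuot, diffQuot, e]
  push_cast
  field_simp

/-- Telescoping of increments: a coarse difference quotient is the mean of the fine ones inside its
cell. -/
theorem mul_cellQuot_eq_sum {q m : ℕ} (hq : 0 < q) (hm : 0 < m) (j : ℕ) (f : E d → ℝ) (x : E d) :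
    m * cellQuot o q j f x = ∑ i ∈ Finset.range m, cellQuot o (q * m) (j * m + i) f x := by
  have hq' : (0 : ℝ) < q := by exact_mod_cast hq
  have hm' : (0 : ℝ) < m := by exact_mod_cast hm
  simp_rw [cellQuot_eq (Nat.mul_pos hq hm), cellQuot_eq hq, ← Finset.mul_sum]
  have := Finset.sum_range_sub (fun i => f (repl o ((j * m + i : ℕ) / (q * m : ℕ)) x)) m
  simp only [← add_assoc] at this
  simp only [add_assoc] at this ⊢
  rw [this]
  have e1 : ((j * m + m : ℕ) : ℝ) / (q * m : ℕ) = ((j + 1 : ℕ) : ℝ) / q := by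
    push_cast; field_simp
  have e2 : ((j * m + 0 : ℕ) : ℝ) / (q * m : ℕ) = (j : ℝ) / q := by
    push_cast; field_simp; simp
  rw [e1, e2]
  push_cast
  ring

/-- Since coarse quotients are block means of fine ones, the energy can only grow under refinement,
and its growth is precisely the mean square deviation between the scales. -/
theorem mean_sq_cellQuot_sub {q m : ℕ} (hq : 0 < q) (hm : 0 < m) (f : E d → ℝ) (x : E d) :
    (1 / (q * m : ℕ) : ℝ) * ∑ l ∈ Finset.range (q * m),
      (cellQuot o (q * m) l f x - cellQuot o q (l / m) f x) ^ 2 =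
      energy o (q * m) f x - energy o q f x := by
  have hq' : (0 : ℝ) < q := by exact_mod_cast hq
  have hm' : (0 : ℝ) < m := by exact_mod_cast hm
  rw [sum_sq_sub_block_mean (fun l => cellQuot o (q * m) l f x) (fun j => cellQuot o q j f x) q m hm
    fun j => mul_cellQuot_eq_sum hq hm j f x]
  unfold energy
  push_cast
  field_simp

theorem setIntegral_slab_add {F : E d → ℝ} (hF : ∀ a b, IntegrableOn F (slab o a b)) {a b c : ℝ}
    (hab : a ≤ b) (hbc : b ≤ c) :
    (∫ x in slab o a b, F x) + ∫ x in slab o b c, F x = ∫ x in slab o a c, F x := by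
  have : slab o a c = slab o a b ∪ slab o b c := by
    ext x
    simp only [slab, Set.mem_union, ← Set.Ico_union_Ico_eq_Ico hab hbc]
    rfl
  rw [this, setIntegral_union _ (measurableSet_slab o b c) (hF a b) (hF b c)]
  rw [Set.disjoint_left]
  exact fun x h1 h2 => not_lt_of_ge h2.1 h1.2

theorem sum_setIntegral_cells {F : E d → ℝ} (hF : ∀ a b, IntegrableOn F (slab o a b)) {n : ℕ}
    (hn : 0 < n) :
    ∑ l ∈ Finset.range n, ∫ x in slab o (l / n) ((l + 1) / n), F x = ∫ x in slab o 0 1, F x := by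
  have hn' : (0 : ℝ) < n := by exact_mod_cast hn
  have key : ∀ k : ℕ, ∑ l ∈ Finset.range k, ∫ x in slab o ((l : ℝ) / n) ((l + 1) / n), F x =
      ∫ x in slab o 0 ((k : ℝ) / n), F x := by
    intro k
    induction k with
    | zero => simp [slab]
    | succ k ih =>
      rw [Finset.sum_range_succ, ih, setIntegral_slab_add hF (by positivity)]
      · push_cast; rfl
      · gcongr; linarith
  rw [key, div_self hn'.ne']

theorem repl_add_single (s : ℝ) (x : E d) :
    x + EuclideanSpace.single o s = repl o (x o + s) x := by
  ext j
  simp only [PiLp.add_apply, repl_apply, PiLp.single_apply]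
  split_ifs with hj
  · rw [hj]
  · rw [add_zero]

theorem setIntegral_slab_translate {G : E d → ℝ} (hG : ∀ t x, G (repl o t x) = G x) (a b s : ℝ) :
    ∫ x in slab o (a + s) (b + s), G x = ∫ x in slab o a b, G x := by
  have h1 := (measurePreserving_add_right (volume : Measure (E d))
    (EuclideanSpace.single o s)).setIntegral_preimage_emb
    (measurableEmbedding_addRight _) G (slab o (a + s) (b + s))
  rw [← h1]
  have h2 : (fun x : E d => x + EuclideanSpace.single o s) ⁻¹' slab o (a + s) (b + s) = slab o a b := by
    ext x
    simp [slab]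
  rw [h2]
  simp only [repl_add_single, hG]

/-- All cells are translates of one another in a direction on which `G` does not depend, so they
carry equal shares. -/
theorem setIntegral_cell {G : E d → ℝ} (hG : ∀ t x, G (repl o t x) = G x)
    (hGi : ∀ a b, IntegrableOn G (slab o a b)) {n : ℕ} (hn : 0 < n) (l : ℕ) :
    ∫ x in slab o (l / n) ((l + 1) / n), G x = (1 / n) * ∫ x in slab o 0 1, G x := by
  have hn' : (0 : ℝ) < n := by exact_mod_cast hn
  have key : ∀ k : ℕ, ∫ x in slab o ((k : ℝ) / n) ((k + 1) / n), G x =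
      ∫ x in slab o 0 (1 / n), G x := by
    intro k
    have := setIntegral_slab_translate hG 0 (1 / n) (k / n)
    rw [zero_add] at this
    rw [← this]
    congr 3
    ring
  have h2 := sum_setIntegral_cells hGi hn
  simp only [key, Finset.sum_const, Finset.card_range, nsmul_eq_mul] at h2
  rw [key, ← h2]
  field_simp

/-- A function of the coordinate `x_o` alternating between the values `1` and `-1` on consecutive
intervals of length `1/n`. -/
def wave (o : Fin d) (n : ℕ) (x : E d) : ℝ := (-1) ^ ⌊(n : ℝ) * x o⌋₊

theorem abs_wave (n : ℕ) (x : E d) : |wave o n x| = 1 := by simp [wave]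

theorem measurable_wave (n : ℕ) : Measurable (wave o n) :=
  (measurable_from_top (f := fun k : ℕ => (-1 : ℝ) ^ k)).comp
    (Nat.measurable_floor.comp ((lipschitzWith_coord o).continuous.measurable.const_mul _))

theorem wave_of_mem {n : ℕ} (hn : 0 < n) {l : ℕ} {x : E d}
    (hx : x ∈ slab o ((l : ℝ) / n) ((l + 1) / n)) : wave o n x = (-1) ^ l := by
  have hn' : (0 : ℝ) < n := by exact_mod_cast hn
  have h1 := hx.1
  have h2 := hx.2
  rw [div_le_iff₀ hn'] at h1
  rw [lt_div_iff₀ hn'] at h2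
  have : ⌊(n : ℝ) * x o⌋₊ = l := by
    rw [Nat.floor_eq_iff (by nlinarith [l.cast_nonneg (α := ℝ)])]
    constructor <;> linarith
  rw [wave, this]

theorem sum_range_two_mul (f : ℕ → ℝ) (k : ℕ) :
    ∑ l ∈ Finset.range (2 * k), f l = ∑ i ∈ Finset.range k, (f (2 * i) + f (2 * i + 1)) := by
  rw [mul_comm, sum_range_mul_eq]
  refine Finset.sum_congr rfl fun i _ => ?_
  rw [Finset.sum_range_succ, Finset.sum_range_one, mul_comm]
  rfl

/-- The alternating sum over layers is grouped into consecutive pairs, each handled by the two-layer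
estimate, with `P` the difference quotient over the coarse cell of length `1/q` containing the pair.
There are `n/2` pairs with error of order `1/n²`, where `n = q (2k)`. -/
theorem abs_setIntegral_wave_mul_jac_le {h : Fin d → E d → ℝ} {χ : E d → ℝ} {K B : ℝ≥0}
    {q k : ℕ} (hq : 0 < q) (hk : 0 < k) (hh : ∀ j, LipschitzWith 1 (h j))
    (hχ : LipschitzWith K χ) (hχB : ∀ x, |χ x| ≤ B) (hχ0 : VanishesOffStrip o χ) :
    |∫ x in slab o 0 1, wave o (q * (2 * k)) x * (χ x * jac h x)| ≤
      d.factorial * 7 ^ d * (∑ l ∈ Finset.range (q * (2 * k)),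
        ∫ x in slab o (l / (q * (2 * k) : ℕ)) ((l + 1) / (q * (2 * k) : ℕ)),
          |χ x| * ∑ j, |cellQuot o (q * (2 * k)) l (h j) x - cellQuot o q (l / (2 * k)) (h j) x|) +
      layerConst d * (K + B * q) / (q * (2 * k) : ℕ) := by
  have hq' : (0 : ℝ) < q := by exact_mod_cast hq
  have hk' : (0 : ℝ) < k := by exact_mod_cast hk
  have hn : 0 < q * (2 * k) := by positivity
  set n := q * (2 * k) with hn_def
  have hn' : (0 : ℝ) < n := by exact_mod_cast hn
  have hji := integrableOn_mul_jac (o := o) hh hχ.continuous.measurable hχB hχ0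
  have hwi : ∀ a b, IntegrableOn (fun x => wave o n x * (χ x * jac h x)) (slab o a b) := fun a b =>
    (hji a b).bdd_mul (measurable_wave n).aestronglyMeasurable
      (Filter.Eventually.of_forall fun x => (abs_wave n x).le)
  have hcell : ∀ l : ℕ, ∫ x in slab o ((l : ℝ) / n) ((l + 1) / n), wave o n x * (χ x * jac h x) =
      (-1) ^ l * ∫ x in slab o ((l : ℝ) / n) ((l + 1) / n), χ x * jac h x := by
    intro l
    rw [← integral_const_mul]
    exact setIntegral_congr_fun (measurableSet_slab _ _ _) fun x hx => by
      simp only [wave_of_mem hn hx]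
  rw [← sum_setIntegral_cells hwi hn]
  simp only [hcell]
  have hnk : n = 2 * (q * k) := by rw [hn_def]; ring
  set J : ℕ → ℝ := fun l => ∫ x in slab o ((l : ℝ) / n) ((l + 1) / n), χ x * jac h x with hJ
  set A : ℕ → ℝ := fun l => ∫ x in slab o ((l : ℝ) / n) ((l + 1) / n),
          |χ x| * ∑ j, |cellQuot o n l (h j) x - cellQuot o q (l / (2 * k)) (h j) x| with hA
  have hpair : ∀ i ∈ Finset.range (q * k), |J (2 * i) - J (2 * i + 1)| ≤
      d.factorial * 7 ^ d * (A (2 * i) + A (2 * i + 1)) +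
        layerConst d * (K + B * q) * (1 / n) ^ 2 := by
    intro i _
    -- A coarse cell contains the even number `2k` of layers, so the pair `2i`, `2i + 1` never
    -- straddles two coarse cells.
    set j₀ := i / k with hj₀
    have hd1 : 2 * i / (2 * k) = j₀ := Nat.mul_div_mul_left i k two_pos
    have hd2 : (2 * i + 1) / (2 * k) = j₀ := by
      rw [← Nat.div_div_eq_div_mul, hj₀]
      congr 1
      omega
    have hqq : (((j₀ : ℝ) + 1) / q - j₀ / q) * ((q : ℝ≥0) : ℝ) = 1 := by
      rw [NNReal.coe_natCast]; field_simp; ring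
    have hcast : ((1 / n : ℝ≥0) : ℝ) = 1 / n := by push_cast; rfl
    have := abs_setIntegral_jac_sub_le (o := o) (h := h)
      (P := fun j x => cellQuot o q j₀ (h j) x) (ℓ := 1 / n) (q := q)
      (a := ((2 * i : ℕ) : ℝ) / n) (b := (((2 * i : ℕ) : ℝ) + 1) / n)
      (c := (((2 * i + 1 : ℕ) : ℝ) + 1) / n)
      (by rw [hcast]; ring) (by rw [hcast]; push_cast; ring)
      (by simpa using hn) (by
        rw [← NNReal.coe_le_coe]
        push_cast
        rw [one_div, inv_mul_le_iff₀ hn', mul_one]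
        have : q ≤ n := Nat.le_mul_of_pos_right q (by positivity)
        exact_mod_cast this) hh
      (fun j => lipschitzWith_diffQuot o hqq (hh j)) (fun j x => abs_diffQuot_le o _ _ (hh j) x)
      (fun j t x => diffQuot_repl o _ _ _ t x) hχ hχB hχ0
    rw [hcast] at this
    have e : (((2 * i : ℕ) : ℝ) + 1) / n = ((2 * i + 1 : ℕ) : ℝ) / n := by push_cast; rfl
    simp only [hJ, hA, hd1, hd2]
    rw [← e]
    simpa only [cellQuot, e] using! this
  have hsum : ∑ l ∈ Finset.range n, (-1) ^ l * J l = ∑ i ∈ Finset.range (q * k),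
      (J (2 * i) - J (2 * i + 1)) := by
    rw [hnk, sum_range_two_mul]
    refine Finset.sum_congr rfl fun i _ => ?_
    rw [pow_succ, pow_mul]
    norm_num
    ring
  have hsumA : ∑ l ∈ Finset.range n, A l = ∑ i ∈ Finset.range (q * k), (A (2 * i) + A (2 * i + 1)) := by
    rw [hnk, sum_range_two_mul]
  rw [hsum, hsumA]
  refine (Finset.abs_sum_le_sum_abs _ _).trans ((Finset.sum_le_sum hpair).trans ?_)
  rw [Finset.sum_add_distrib, ← Finset.mul_sum, Finset.sum_const, Finset.card_range, nsmul_eq_mul]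
  refine add_le_add_right ?_ _
  have h0 : 0 ≤ layerConst d * (K + B * q) := mul_nonneg (layerConst_nonneg d) (by positivity)
  have hqk : ((q * k : ℕ) : ℝ) = n / 2 := by
    rw [hnk]; push_cast; ring
  rw [hqk]
  have : (n : ℝ) / 2 * (layerConst d * (K + B * q) * (1 / n) ^ 2) =
      (layerConst d * (K + B * q) / n) / 2 := by field_simp
  rw [this]
  have : 0 ≤ layerConst d * (K + B * q) / n := by positivity
  linarith

end

/-! ### Weights and the bound by energy increments -/

section

variable {d : ℕ} {o : Fin d}

/-- The sum of the energies of the components of a map. -/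
def totalEnergy (o : Fin d) (n : ℕ) (h : Fin d → E d → ℝ) (x : E d) : ℝ :=
  ∑ j, energy o n (h j) x

theorem abs_cellQuot_le (n l : ℕ) {f : E d → ℝ} (hf : LipschitzWith 1 f) (x : E d) :
    |cellQuot o n l f x| ≤ 1 := abs_diffQuot_le o _ _ hf x

theorem cellQuot_repl (n l : ℕ) (f : E d → ℝ) (t : ℝ) (x : E d) :
    cellQuot o n l f (repl o t x) = cellQuot o n l f x := diffQuot_repl o _ _ f t x

theorem lipschitzWith_cellQuot {n : ℕ} (hn : 0 < n) (l : ℕ) {f : E d → ℝ} (hf : LipschitzWith 1 f) :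
    LipschitzWith (2 * n) (cellQuot o n l f) := by
  have hn' : (0 : ℝ) < n := by exact_mod_cast hn
  refine lipschitzWith_diffQuot o ?_ hf
  rw [NNReal.coe_natCast]; field_simp; ring

theorem energy_nonneg (n : ℕ) (f : E d → ℝ) (x : E d) : 0 ≤ energy o n f x := by
  unfold energy; positivity

theorem energy_le_one {n : ℕ} (hn : 0 < n) {f : E d → ℝ} (hf : LipschitzWith 1 f) (x : E d) :
    energy o n f x ≤ 1 := by
  have hn' : (0 : ℝ) < n := by exact_mod_cast hn
  unfold energy
  have : ∑ l ∈ Finset.range n, cellQuot o n l f x ^ 2 ≤ n := by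
    refine (Finset.sum_le_card_nsmul _ _ 1 fun l _ => ?_).trans (by simp)
    exact (sq_le_one_iff_abs_le_one _).2 (abs_cellQuot_le n l hf x)
  rw [one_div, inv_mul_le_iff₀ hn', mul_one]
  exact this

theorem lipschitzWith_energy {n : ℕ} (hn : 0 < n) {f : E d → ℝ} (hf : LipschitzWith 1 f) :
    LipschitzWith (4 * n) (energy o n f) := by
  have hn' : (0 : ℝ) < n := by exact_mod_cast hn
  refine lipschitzWith_real fun x y => ?_
  unfold energy
  rw [← mul_sub, ← Finset.sum_sub_distrib, abs_mul, abs_of_nonneg (by positivity : (0 : ℝ) ≤ 1 / n)]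
  have h1 : |∑ l ∈ Finset.range n, (cellQuot o n l f x ^ 2 - cellQuot o n l f y ^ 2)| ≤
      n * (4 * n * dist x y) := by
    refine (Finset.abs_sum_le_sum_abs _ _).trans ((Finset.sum_le_card_nsmul _ _ _ fun l _ => ?_).trans
      (le_of_eq (by rw [Finset.card_range, nsmul_eq_mul])))
    have h2 := abs_sub_le_of_lipschitz (lipschitzWith_cellQuot (o := o) hn l hf) x y
    have h3 := abs_cellQuot_le (o := o) n l hf x
    have h4 := abs_cellQuot_le (o := o) n l hf y
    rw [sq_sub_sq, abs_mul]
    push_cast at h2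
    have h5 := mul_le_mul ((abs_add_le _ _).trans (add_le_add h3 h4)) h2 (abs_nonneg _) (by norm_num)
    linarith
  calc (1 / n : ℝ) * _ ≤ (1 / n) * (n * (4 * n * dist x y)) :=
        mul_le_mul_of_nonneg_left h1 (by positivity)
    _ = _ := by push_cast; field_simp

theorem lipschitzWith_totalEnergy {n : ℕ} (hn : 0 < n) {h : Fin d → E d → ℝ}
    (hh : ∀ j, LipschitzWith 1 (h j)) : LipschitzWith (d * (4 * n)) (totalEnergy o n h) := by
  refine lipschitzWith_real fun x y => ?_
  unfold totalEnergy
  rw [← Finset.sum_sub_distrib]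
  refine (Finset.abs_sum_le_sum_abs _ _).trans ((Finset.sum_le_card_nsmul _ _ _ fun j _ =>
    abs_sub_le_of_lipschitz (lipschitzWith_energy (o := o) hn (hh j)) x y).trans (le_of_eq ?_))
  simp [mul_assoc]

theorem totalEnergy_nonneg (n : ℕ) (h : Fin d → E d → ℝ) (x : E d) : 0 ≤ totalEnergy o n h x :=
  Finset.sum_nonneg fun j _ => energy_nonneg n (h j) x

theorem totalEnergy_le {n : ℕ} (hn : 0 < n) {h : Fin d → E d → ℝ}
    (hh : ∀ j, LipschitzWith 1 (h j)) (x : E d) : totalEnergy o n h x ≤ d := by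
  refine (Finset.sum_le_card_nsmul _ _ 1 fun j _ => energy_le_one hn (hh j) x).trans (by simp)

theorem abs_totalEnergy_le {n : ℕ} (hn : 0 < n) {h : Fin d → E d → ℝ}
    (hh : ∀ j, LipschitzWith 1 (h j)) (x : E d) : |totalEnergy o n h x| ≤ (d : ℝ≥0) := by
  rw [abs_of_nonneg (totalEnergy_nonneg n h x)]
  exact totalEnergy_le hn hh x

/-- Weights: bounded nonnegative Lipschitz functions of the coordinates other than `x_o`, supported
in the strip `{0 ≤ x_j ≤ 1 for j ≠ o}`. -/
structure IsWeight (o : Fin d) (w : E d → ℝ) : Prop where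
  lip : ∃ K : ℝ≥0, LipschitzWith K w
  nonneg : ∀ x, 0 ≤ w x
  bdd : ∃ B : ℝ≥0, ∀ x, w x ≤ B
  strip : VanishesOffStrip o w
  indep : ∀ t x, w (repl o t x) = w x

theorem IsWeight.measurable {w : E d → ℝ} (hw : IsWeight o w) : Measurable w :=
  hw.lip.choose_spec.continuous.measurable

theorem IsWeight.integrableOn_mul {w F : E d → ℝ} (hw : IsWeight o w) (hF : Measurable F) {C : ℝ}
    (hC : ∀ x, |F x| ≤ C) (a b : ℝ) : IntegrableOn (fun x => w x * F x) (slab o a b) := by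
  obtain ⟨B, hB⟩ := hw.bdd
  refine integrableOn_slab (hw.measurable.mul hF) (C := B * C) (fun x => ?_)
    (fun x j hj hx => by simp [hw.strip x j hj hx]) a b
  rw [Pi.mul_apply, abs_mul, abs_of_nonneg (hw.nonneg x)]
  exact mul_le_mul (hB x) (hC x) (abs_nonneg _) B.2

theorem IsWeight.integrableOn {w : E d → ℝ} (hw : IsWeight o w) (a b : ℝ) :
    IntegrableOn w (slab o a b) := by
  simpa using hw.integrableOn_mul (F := fun _ => 1) measurable_const (C := 1) (by simp) a b

/-- The oscillating weight is nearly orthogonal to a Jacobian, up to the increase of its energy. -/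
theorem abs_setIntegral_wave_mul_weight_le {w : E d → ℝ} (hw : IsWeight o w) :
    ∃ A : ℝ, ∀ q k : ℕ, 0 < q → 0 < k → ∀ (t : ℝ), 0 < t → ∀ (f : E d → ℝ) (h : Fin d → E d → ℝ),
      LipschitzWith 1 f → (∀ x, |f x| ≤ 1) → (∀ j, LipschitzWith 1 (h j)) →
      |∫ x in slab o 0 1, wave o (q * (2 * k)) x * (f x * w x * jac h x)| ≤
        d.factorial * 7 ^ d * (t / 2 * (∫ x in slab o 0 1,
          w x * (totalEnergy o (q * (2 * k)) h x - totalEnergy o q h x)) +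
          d / (2 * t) * ∫ x in slab o 0 1, w x) + A * q / (q * (2 * k) : ℕ) := by
  obtain ⟨K, hK⟩ := hw.lip
  obtain ⟨B, hB⟩ := hw.bdd
  refine ⟨layerConst d * (1 * K + B * 1 + B), fun q k hq hk t ht f h hf hf1 hh => ?_⟩
  have hwB : ∀ x, |w x| ≤ B := fun x => by rw [abs_of_nonneg (hw.nonneg x)]; exact hB x
  have hχL : LipschitzWith (1 * K + B * 1) fun x => f x * w x := lipschitzWith_mul hf hK hf1 hwB
  have hfw : ∀ x, |f x * w x| ≤ w x := fun x => by
    rw [abs_mul, abs_of_nonneg (hw.nonneg x)]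
    exact mul_le_of_le_one_left (hw.nonneg x) (hf1 x)
  have h1 := abs_setIntegral_wave_mul_jac_le (o := o) hq hk hh hχL
    (fun x => (hfw x).trans (hB x)) (fun x j hj hx => by simp [hw.strip x j hj hx])
  have hm : 0 < 2 * k := by positivity
  have hn : 0 < q * (2 * k) := by positivity
  set m := 2 * k
  set n := q * m with hn_def
  have hn' : (0 : ℝ) < n := by exact_mod_cast hn
  have hq1 : (1 : ℝ) ≤ q := by exact_mod_cast hq
  refine h1.trans (add_le_add (mul_le_mul_of_nonneg_left ?_ (by positivity)) ?_)
  · set D : ℕ → E d → ℝ := fun l x =>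
      ∑ j, (cellQuot o n l (h j) x - cellQuot o q (l / m) (h j) x) ^ 2 with hD
    have hcm : ∀ n l j, Measurable (cellQuot o n l (h j)) := fun n l j => by
      have h2 := (lipschitzWith_comp_repl o (((l : ℝ) + 1) / n) (hh j)).continuous.measurable
      have h3 := (lipschitzWith_comp_repl o ((l : ℝ) / n) (hh j)).continuous.measurable
      exact (h2.sub h3).div_const _
    have hδ2 : ∀ l j x, |cellQuot o n l (h j) x - cellQuot o q (l / m) (h j) x| ≤ 2 := fun l j x => by
      refine (abs_sub_le_add _ _).trans ?_
      have h2 := abs_cellQuot_le (o := o) n l (hh j) x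
      have h3 := abs_cellQuot_le (o := o) q (l / m) (hh j) x
      linarith
    have hDm : ∀ l, Measurable (D l) := fun l =>
      Finset.measurable_fun_sum _ fun j _ => ((hcm _ _ j).sub (hcm _ _ j)).pow_const 2
    have hD0 : ∀ l x, 0 ≤ D l x := fun l x => Finset.sum_nonneg fun j _ => sq_nonneg _
    have hDb : ∀ l x, |D l x| ≤ d * 4 := fun l x => by
      rw [abs_of_nonneg (hD0 l x)]
      refine (Finset.sum_le_card_nsmul _ _ 4 fun j _ => ?_).trans (by simp)
      rw [← sq_abs]
      have := hδ2 l j x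
      nlinarith [abs_nonneg (cellQuot o n l (h j) x - cellQuot o q (l / m) (h j) x)]
    have hDi : ∀ l a b, IntegrableOn (fun x => w x * D l x) (slab o a b) := fun l a b =>
      hw.integrableOn_mul (hDm l) (hDb l) a b
    have hcell : ∀ l ∈ Finset.range n, ∫ x in slab o ((l : ℝ) / n) ((l + 1) / n),
        |f x * w x| * ∑ j, |cellQuot o n l (h j) x - cellQuot o q (l / m) (h j) x| ≤
        t / 2 * ((1 / n) * ∫ x in slab o 0 1, w x * D l x) +
        d / (2 * t) * ∫ x in slab o ((l : ℝ) / n) ((l + 1) / n), w x := by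
      intro l _
      -- Neither `w` nor the quotients depend on `x_o`. Each cell integral is thus `1/n` times an
      -- integral over the unit slab, and summing over cells produces the mean in
      -- `mean_sq_cellQuot_sub`.
      rw [← setIntegral_cell (fun s x => by
        simp only [hD, cellQuot_repl, hw.indep]) (hDi l) hn l, ← integral_const_mul,
        ← integral_const_mul, ← integral_add ((hDi l _ _).const_mul _) ((hw.integrableOn _ _).const_mul _)]
      refine integral_mono_of_nonneg (Filter.Eventually.of_forall fun x => by positivity)
        (((hDi l _ _).const_mul _).add ((hw.integrableOn _ _).const_mul _))
        (Filter.Eventually.of_forall fun x => ?_)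
      have hs : ∑ j, |cellQuot o n l (h j) x - cellQuot o q (l / m) (h j) x| ≤
          t / 2 * D l x + d / (2 * t) := by
        have e : t / 2 * D l x + d / (2 * t) = ∑ j : Fin d, (t / 2 *
            (cellQuot o n l (h j) x - cellQuot o q (l / m) (h j) x) ^ 2 + 1 / (2 * t)) := by
          rw [Finset.sum_add_distrib, ← Finset.mul_sum]
          simp [hD]
          ring
        rw [e]
        refine Finset.sum_le_sum fun j _ => ?_
        rw [← sq_abs]
        set y := |cellQuot o n l (h j) x - cellQuot o q (l / m) (h j) x|
        -- Young's inequality `y ≤ t y² / 2 + 1 / (2t)`, by completing the square.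
        have : t / 2 * y ^ 2 + 1 / (2 * t) - y = (t * y - 1) ^ 2 / (2 * t) := by field_simp; ring
        have h0 : 0 ≤ (t * y - 1) ^ 2 / (2 * t) := by positivity
        linarith
      have := mul_le_mul (hfw x) hs (Finset.sum_nonneg fun j _ => abs_nonneg _) (hw.nonneg x)
      simp only
      linarith
    refine (Finset.sum_le_sum hcell).trans (le_of_eq ?_)
    rw [Finset.sum_add_distrib, ← Finset.mul_sum, ← Finset.mul_sum, ← Finset.mul_sum,
      sum_setIntegral_cells hw.integrableOn hn]
    congr 2
    rw [← integral_finsetSum _ fun l _ => hDi l 0 1, ← integral_const_mul]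
    congr 1
    ext x
    rw [← Finset.mul_sum]
    have : (1 / n : ℝ) * ∑ l ∈ Finset.range n, D l x =
        totalEnergy o n h x - totalEnergy o q h x := by
      unfold totalEnergy
      simp only [hD]
      rw [Finset.sum_comm, Finset.mul_sum, ← Finset.sum_sub_distrib]
      exact Finset.sum_congr rfl fun j _ => mean_sq_cellQuot_sub hq hm (h j) x
    rw [← this]
    ring
  · rw [mul_assoc]
    refine div_le_div_of_nonneg_right ?_ hn'.le
    refine mul_le_mul_of_nonneg_left ?_ (layerConst_nonneg d)
    push_cast
    nlinarith [K.2, B.2]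

end

/-! ### Concentration of weights by fast periodic factors -/

section

/-- A nonnegative periodic Lipschitz function of mean one, supported in a small set. -/
theorem exists_periodic_bump {θ : ℝ} (hθ : 0 < θ) (hθ1 : θ ≤ 1) :
    ∃ (g : ℝ → ℝ) (K B : ℝ≥0), LipschitzWith K g ∧ (∀ s, 0 ≤ g s) ∧ (∀ s, g s ≤ B) ∧
      Function.Periodic g 1 ∧ ∫ s in (0 : ℝ)..1, g s = 1 ∧
      ∫ s in (0 : ℝ)..1, {s | g s ≠ 0}.indicator (fun _ => (1 : ℝ)) s ≤ θ := by
  have hpi := Real.pi_pos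
  set g₀ : ℝ → ℝ := fun s => max 0 (Real.cos (2 * Real.pi * s) - Real.cos (Real.pi * θ)) with hg₀
  have hg₀0 : ∀ s, 0 ≤ g₀ s := fun s => le_max_left _ _
  have hg₀2 : ∀ s, g₀ s ≤ 2 := fun s => max_le (by norm_num) (by
    linarith [Real.cos_le_one (2 * Real.pi * s), Real.neg_one_le_cos (Real.pi * θ)])
  have hg₀L : LipschitzWith (2 * NNReal.pi) g₀ := lipschitzWith_real fun x y => by
    refine (abs_max_sub_max_le_max 0 _ 0 _).trans ?_
    rw [sub_self, abs_zero, max_eq_right (abs_nonneg _), sub_sub_sub_cancel_right]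
    have h1 : |Real.cos (2 * Real.pi * x) - Real.cos (2 * Real.pi * y)| ≤
        |2 * Real.pi * x - 2 * Real.pi * y| := Real.abs_cos_sub_cos_le _ _
    refine h1.trans (le_of_eq ?_)
    rw [← mul_sub, abs_mul, abs_of_pos (by positivity), Real.dist_eq]
    rfl
  have hg₀p : Function.Periodic g₀ 1 := fun s => by
    simp only [hg₀]
    rw [mul_add, mul_one, Real.cos_add_two_pi]
  have hg₀c : Continuous g₀ := hg₀L.continuous
  have hpos : 0 < ∫ s in (0 : ℝ)..1, g₀ s := by
    refine intervalIntegral.integral_pos zero_lt_one hg₀c.continuousOn (fun s _ => hg₀0 s)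
      ⟨0, by simp, ?_⟩
    simp only [hg₀, mul_zero, Real.cos_zero]
    refine lt_max_of_lt_right (sub_pos.2 ?_)
    have := Real.cos_lt_cos_of_nonneg_of_le_pi le_rfl (by nlinarith : Real.pi * θ ≤ Real.pi)
      (by positivity)
    rwa [Real.cos_zero] at this
  set c := ∫ s in (0 : ℝ)..1, g₀ s with hc
  have hzero : ∀ s, θ / 2 ≤ s → s ≤ 1 - θ / 2 → g₀ s = 0 := by
    intro s h1 h2
    refine max_eq_left (sub_nonpos.2 ?_)
    rcases le_total s (1 / 2) with h | h
    · exact Real.cos_le_cos_of_nonneg_of_le_pi (by positivity) (by nlinarith) (by nlinarith)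
    · have e : Real.cos (2 * Real.pi * s) = Real.cos (2 * Real.pi - 2 * Real.pi * s) := by
        rw [Real.cos_two_pi_sub]
      rw [e]
      exact Real.cos_le_cos_of_nonneg_of_le_pi (by positivity) (by nlinarith) (by nlinarith)
  refine ⟨fun s => c⁻¹ * g₀ s, Real.toNNReal c⁻¹ * (2 * NNReal.pi), Real.toNNReal (c⁻¹ * 2),
    ?_, ?_, ?_, ?_, ?_, ?_⟩
  · refine lipschitzWith_real fun x y => ?_
    rw [← mul_sub, abs_mul, abs_of_pos (inv_pos.2 hpos), NNReal.coe_mul,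
      Real.coe_toNNReal _ (inv_pos.2 hpos).le, mul_assoc]
    exact mul_le_mul_of_nonneg_left (abs_sub_le_of_lipschitz hg₀L x y) (inv_pos.2 hpos).le
  · exact fun s => mul_nonneg (inv_pos.2 hpos).le (hg₀0 s)
  · intro s
    rw [Real.coe_toNNReal _ (by positivity)]
    exact mul_le_mul_of_nonneg_left (hg₀2 s) (inv_pos.2 hpos).le
  · intro s
    simp only [hg₀p s]
  · rw [intervalIntegral.integral_const_mul, ← hc, inv_mul_cancel₀ hpos.ne']
  · set Z : Set ℝ := {s | c⁻¹ * g₀ s ≠ 0} with hZ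
    have hZm : MeasurableSet Z :=
      (measurable_const.mul hg₀c.measurable) (measurableSet_singleton (0 : ℝ)).compl
    rw [intervalIntegral.integral_of_le zero_le_one, integral_indicator hZm,
      Measure.restrict_restrict hZm, setIntegral_const, smul_eq_mul, mul_one]
    have hsub : Z ∩ Set.Ioc 0 1 ⊆ Set.Icc 0 (θ / 2) ∪ Set.Icc (1 - θ / 2) 1 := by
      rintro s ⟨hs, hs0, hs1⟩
      by_contra hcon
      simp only [Set.mem_union, Set.mem_Icc, not_or, not_and, not_le] at hcon
      have h1 := hcon.1 hs0.le
      have h2 : s < 1 - θ / 2 := by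
        by_contra h2
        exact absurd (hcon.2 (not_lt.1 h2)) (by linarith)
      exact hs (by rw [hzero s h1.le h2.le, mul_zero])
    refine (measureReal_mono hsub (by
      exact (measure_union_lt_top measure_Icc_lt_top measure_Icc_lt_top).ne)).trans
      ((measureReal_union_le _ _).trans (le_of_eq ?_))
    rw [Real.volume_real_Icc_of_le (by positivity), Real.volume_real_Icc_of_le (by linarith)]
    ring

section Average

variable {d : ℕ} {p : Fin d} {F : E d → ℝ} {g : ℝ → ℝ} {M : ℕ} {C G R : ℝ}

theorem shift_apply (x : E d) (t : ℝ) (j : Fin d) :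
    (x + t • EuclideanSpace.single p (1 : ℝ)) j = if j = p then x j + t else x j := by
  simp only [PiLp.add_apply, PiLp.smul_apply, PiLp.single_apply, smul_eq_mul]
  split_ifs <;> simp

theorem shift_eq_zero (hF0 : ∀ x ∉ Metric.closedBall (0 : E d) R, F x = 0)
    {x : E d} (hx : x ∉ Metric.closedBall (0 : E d) (R + 1)) {t : ℝ} (ht : |t| ≤ 1) :
    F (x + t • EuclideanSpace.single p (1 : ℝ)) = 0 := by
  refine hF0 _ fun h => hx ?_
  rw [mem_closedBall_zero_iff] at h ⊢
  have h1 : ‖t • (EuclideanSpace.single p (1 : ℝ) : E d)‖ ≤ 1 := by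
    rw [norm_smul, PiLp.norm_single, norm_one, mul_one]; exact ht
  have h2 := norm_sub_le (x + t • (EuclideanSpace.single p (1 : ℝ) : E d))
    (t • (EuclideanSpace.single p (1 : ℝ) : E d))
  rw [add_sub_cancel_right] at h2
  linarith

/-- Justifies Fubini in the average over shifts. Shifts have length at most 1, so everything is
supported in the ball of radius `R + 1`. -/
theorem integrable_shift_prod (hM : 0 < M) (hF : Measurable F) (hC : ∀ x, |F x| ≤ C)
    (hF0 : ∀ x ∉ Metric.closedBall (0 : E d) R, F x = 0) (hg : Measurable g) (hG : ∀ s, |g s| ≤ G) :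
    Integrable (fun z : ℝ × E d => F (z.2 + (z.1 / M) • EuclideanSpace.single p (1 : ℝ)) *
      g (M * z.2 p + z.1)) ((volume.restrict (Set.Ioc (0 : ℝ) 1)).prod volume) := by
  have hM' : (1 : ℝ) ≤ M := by exact_mod_cast hM
  have hm : Measurable fun z : ℝ × E d => F (z.2 + (z.1 / M) • EuclideanSpace.single p (1 : ℝ)) *
      g (M * z.2 p + z.1) := by
    refine (hF.comp ?_).mul (hg.comp ?_)
    · exact measurable_snd.add ((measurable_fst.div_const _).smul measurable_const)
    · exact (((lipschitzWith_coord p).continuous.measurable.comp measurable_snd).const_mul _).add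
        measurable_fst
  have hdom : Integrable (fun z : ℝ × E d => (1 : ℝ) *
      (Metric.closedBall (0 : E d) (R + 1)).indicator (fun _ => C * G) z.2)
      ((volume.restrict (Set.Ioc (0 : ℝ) 1)).prod volume) := by
    refine Integrable.mul_prod (f := fun _ : ℝ => (1 : ℝ)) (integrable_const _) ?_
    exact (integrable_indicator_iff Metric.isClosed_closedBall.measurableSet).2
      (integrableOn_const (isCompact_closedBall _ _).measure_lt_top.ne)
  refine Integrable.mono' hdom hm.aestronglyMeasurable ?_
  have hprod : (volume.restrict (Set.Ioc (0 : ℝ) 1)).prod (volume : Measure (E d)) =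
      (volume.prod volume).restrict (Set.Ioc (0 : ℝ) 1 ×ˢ Set.univ) := by
    rw [← Measure.prod_restrict, Measure.restrict_univ]
  rw [hprod]
  refine ae_restrict_of_forall_mem (measurableSet_Ioc.prod MeasurableSet.univ) fun z hz => ?_
  have hz1 : |z.1 / M| ≤ 1 := by
    have h1 := hz.1.1
    have h2 := hz.1.2
    rw [abs_of_nonneg (by positivity), div_le_one (by linarith)]
    linarith
  rw [one_mul]
  by_cases hx : z.2 ∈ Metric.closedBall (0 : E d) (R + 1)
  · rw [Set.indicator_of_mem hx, Real.norm_eq_abs, abs_mul]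
    exact mul_le_mul (hC _) (hG _) (abs_nonneg _) ((abs_nonneg _).trans (hC 0))
  · rw [Set.indicator_of_notMem hx, shift_eq_zero hF0 hx hz1]
    simp

/-- Averaging over translations by fractions of the period. -/
theorem integral_mul_eq_integral_average (hM : 0 < M) (hF : Measurable F) (hC : ∀ x, |F x| ≤ C)
    (hF0 : ∀ x ∉ Metric.closedBall (0 : E d) R, F x = 0) (hg : Measurable g) (hG : ∀ s, |g s| ≤ G) :
    ∫ x, F x * g (M * x p) = ∫ x : E d, ∫ s in (0 : ℝ)..1,
      F (x + (s / M) • EuclideanSpace.single p (1 : ℝ)) * g (M * x p + s) := by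
  have hM' : (0 : ℝ) < M := by exact_mod_cast hM
  simp only [intervalIntegral.integral_of_le (zero_le_one (α := ℝ))]
  rw [integral_integral_swap (f := fun (x : E d) (s : ℝ) =>
    F (x + (s / M) • EuclideanSpace.single p (1 : ℝ)) * g (M * x p + s))
    (integrable_shift_prod hM hF hC hF0 hg hG).swap]
  have h1 : ∀ s : ℝ, ∫ x : E d, F (x + (s / M) • EuclideanSpace.single p (1 : ℝ)) * g (M * x p + s) =
      ∫ x, F x * g (M * x p) := by
    intro s
    rw [← integral_add_right_eq_self (μ := volume) (fun x : E d => F x * g (M * x p))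
      ((s / M) • EuclideanSpace.single p (1 : ℝ))]
    congr 1
    ext x
    rw [shift_apply, if_pos rfl]
    congr 2
    field_simp
  simp only [h1]
  simp

theorem integrable_average (hM : 0 < M) (hF : Measurable F) (hC : ∀ x, |F x| ≤ C)
    (hF0 : ∀ x ∉ Metric.closedBall (0 : E d) R, F x = 0) (hg : Measurable g) (hG : ∀ s, |g s| ≤ G) :
    Integrable fun x : E d => ∫ s in (0 : ℝ)..1,
      F (x + (s / M) • EuclideanSpace.single p (1 : ℝ)) * g (M * x p + s) := by
  simp only [intervalIntegral.integral_of_le (zero_le_one (α := ℝ))]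
  exact (integrable_shift_prod hM hF hC hF0 hg hG).swap.integral_prod_left

theorem intervalIntegrable_of_bounded {f : ℝ → ℝ} (hf : Measurable f) (hC : ∀ s, |f s| ≤ C)
    (a b : ℝ) : IntervalIntegrable f volume a b :=
  (intervalIntegrable_const (c := C)).mono_fun' hf.aestronglyMeasurable
    (Filter.Eventually.of_forall fun s => hC s)

theorem intervalIntegral_periodic_shift (hp : Function.Periodic g 1) (c : ℝ) :
    ∫ s in (0 : ℝ)..1, g (c + s) = ∫ s in (0 : ℝ)..1, g s := by
  rw [intervalIntegral.integral_comp_add_left (fun s => g s) c, add_zero]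
  simpa using hp.intervalIntegral_add_eq c 0

theorem measurable_shift_mul (hF : Measurable F) (hg : Measurable g) (x : E d) :
    Measurable fun s : ℝ => F (x + (s / M) • EuclideanSpace.single p (1 : ℝ)) * g (M * x p + s) :=
  (hF.comp (measurable_const.add ((measurable_id.div_const _).smul measurable_const))).mul
    (hg.comp (measurable_const.add measurable_id))

/-- After averaging over shifts within one period, the periodic factor integrates to its mean and
the only error is the oscillation `η` of `F` along a shift of length at most `1/M`. -/
theorem abs_integral_mul_periodic_sub_le (hM : 0 < M) (hF : Measurable F) (hC : ∀ x, |F x| ≤ C)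
    (hF0 : ∀ x ∉ Metric.closedBall (0 : E d) R, F x = 0) (hg : Measurable g) (hG : ∀ s, |g s| ≤ G)
    (hp : Function.Periodic g 1) {η : ℝ} (hη : ∀ x : E d, ∀ t : ℝ, 0 ≤ t → t ≤ 1 / M →
      |F (x + t • EuclideanSpace.single p (1 : ℝ)) - F x| ≤ η) :
    |(∫ x, F x * g (M * x p)) - (∫ s in (0 : ℝ)..1, g s) * ∫ x, F x| ≤
      η * G * volume.real (Metric.closedBall (0 : E d) (R + 1)) := by
  have hM' : (1 : ℝ) ≤ M := by exact_mod_cast hM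
  have hR : ∀ x ∉ Metric.closedBall (0 : E d) (R + 1), F x = 0 := fun x hx =>
    hF0 x fun h => hx (Metric.closedBall_subset_closedBall (by linarith) h)
  have hFi : Integrable F := integrable_of_bounded_of_eq_zero hF.aestronglyMeasurable
    Metric.isClosed_closedBall.measurableSet (isCompact_closedBall _ _).measure_lt_top.ne hC hR
  rw [integral_mul_eq_integral_average hM hF hC hF0 hg hG, ← integral_const_mul,
    ← integral_sub (integrable_average hM hF hC hF0 hg hG) (hFi.const_mul _)]
  have e : ∀ x : E d, (∫ s in (0 : ℝ)..1,
      F (x + (s / M) • EuclideanSpace.single p (1 : ℝ)) * g (M * x p + s)) -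
      (∫ s in (0 : ℝ)..1, g s) * F x = ∫ s in (0 : ℝ)..1,
      (F (x + (s / M) • EuclideanSpace.single p (1 : ℝ)) - F x) * g (M * x p + s) := by
    intro x
    rw [← intervalIntegral_periodic_shift hp (M * x p), mul_comm _ (F x),
      ← intervalIntegral.integral_const_mul,
      ← intervalIntegral.integral_sub]
    · simp only [sub_mul]
    · exact intervalIntegrable_of_bounded (C := C * G) (measurable_shift_mul hF hg x) (fun s => by
        rw [abs_mul]
        exact mul_le_mul (hC _) (hG _) (abs_nonneg _) ((abs_nonneg _).trans (hC 0))) _ _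
    · refine intervalIntegrable_of_bounded (C := C * G) ((hg.comp
        (measurable_const.add measurable_id)).const_mul _) (fun s => ?_) _ _
      rw [abs_mul]
      exact mul_le_mul (hC _) (hG _) (abs_nonneg _) ((abs_nonneg _).trans (hC 0))
  simp only [e]
  refine abs_integral_le_mul_volume
    (isCompact_closedBall _ _).measure_lt_top.ne (fun x => ?_) fun x hx => ?_
  · have := intervalIntegral.norm_integral_le_of_norm_le_const (a := (0 : ℝ)) (b := 1) (C := η * G)
      (f := fun s => (F (x + (s / M) • EuclideanSpace.single p (1 : ℝ)) - F x) * g (M * x p + s))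
      fun s hs => by
        rw [Set.uIoc_of_le zero_le_one] at hs
        rw [Real.norm_eq_abs, abs_mul]
        have h1 := hη x (s / M) (div_nonneg hs.1.le (by positivity))
          (div_le_div_of_nonneg_right hs.2 (by positivity))
        exact mul_le_mul h1 (hG _) (abs_nonneg _) ((abs_nonneg _).trans h1)
    simpa using this
  · refine (intervalIntegral.integral_congr (g := fun _ => (0 : ℝ)) fun s hs => ?_).trans (by simp)
    rw [Set.uIcc_of_le zero_le_one] at hs
    simp only
    rw [hR x hx, shift_eq_zero hF0 hx, sub_zero, zero_mul]
    rw [abs_of_nonneg (div_nonneg hs.1 (by positivity)), div_le_one (by linarith)]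
    linarith [hs.2]

/-- No regularity of `F` is needed for this upper bound, so it applies to indicators and measures
the support of a periodically modulated function. -/
theorem abs_integral_mul_periodic_le (hM : 0 < M) (hF : Measurable F) (hC : ∀ x, |F x| ≤ C)
    (hF0 : ∀ x ∉ Metric.closedBall (0 : E d) R, F x = 0) (hg : Measurable g) (hG : ∀ s, |g s| ≤ G)
    (hp : Function.Periodic g 1) (hg0 : ∀ s, 0 ≤ g s) :
    |∫ x, F x * g (M * x p)| ≤
      C * (∫ s in (0 : ℝ)..1, g s) * volume.real (Metric.closedBall (0 : E d) (R + 1)) := by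
  have hM' : (1 : ℝ) ≤ M := by exact_mod_cast hM
  rw [integral_mul_eq_integral_average hM hF hC hF0 hg hG]
  refine abs_integral_le_mul_volume
    (isCompact_closedBall _ _).measure_lt_top.ne (fun x => ?_) fun x hx => ?_
  · rw [← intervalIntegral_periodic_shift hp (M * x p), ← intervalIntegral.integral_const_mul]
    refine intervalIntegral.norm_integral_le_of_norm_le
      (f := fun s => F (x + (s / M) • EuclideanSpace.single p (1 : ℝ)) * g (M * x p + s)) zero_le_one
      (Filter.Eventually.of_forall fun s _ => ?_)
      ((intervalIntegrable_of_bounded (hg.comp (measurable_const.add measurable_id))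
        (fun s => hG _) _ _).const_mul _)
    rw [Real.norm_eq_abs, abs_mul, abs_of_nonneg (hg0 _)]
    exact mul_le_mul_of_nonneg_right (hC _) (hg0 _)
  · refine (intervalIntegral.integral_congr (g := fun _ => (0 : ℝ)) fun s hs => ?_).trans (by simp)
    rw [Set.uIcc_of_le zero_le_one] at hs
    simp only
    rw [shift_eq_zero hF0 hx, zero_mul]
    rw [abs_of_nonneg (div_nonneg hs.1 (by positivity)), div_le_one (by linarith)]
    linarith [hs.2]

end Average

end

theorem lipschitzWith_periodic_coord {d : ℕ} (p : Fin d) {g : ℝ → ℝ} {K : ℝ≥0} (hg : LipschitzWith K g)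
    (M : ℕ) : LipschitzWith (K * M) fun x : E d => g (M * x p) := by
  refine lipschitzWith_real fun x y => ?_
  refine (abs_sub_le_of_lipschitz hg _ _).trans ?_
  rw [Real.dist_eq, ← mul_sub, abs_mul, Nat.abs_cast, NNReal.coe_mul, NNReal.coe_natCast, mul_assoc]
  have := abs_sub_le_of_lipschitz (lipschitzWith_coord p) x y
  rw [NNReal.coe_one, one_mul] at this
  gcongr

/-- Modulating in a coordinate `x_p` with `p ≠ o` preserves the independence of `x_o`. -/
theorem IsWeight.mul_comp_coord {d : ℕ} {o p : Fin d} (hpo : p ≠ o) {w : E d → ℝ} (hw : IsWeight o w)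
    {g : ℝ → ℝ} {K B : ℝ≥0} (hg : LipschitzWith K g) (hg0 : ∀ s, 0 ≤ g s) (hgB : ∀ s, g s ≤ B)
    (M : ℕ) : IsWeight o fun x => w x * g (M * x p) := by
  obtain ⟨Kw, hKw⟩ := hw.lip
  obtain ⟨Bw, hBw⟩ := hw.bdd
  refine ⟨⟨_, lipschitzWith_mul hKw (lipschitzWith_periodic_coord p hg M) (a := Bw) (b := B)
    (fun x => by rw [abs_of_nonneg (hw.nonneg x)]; exact hBw x)
    (fun x => by rw [abs_of_nonneg (hg0 _)]; exact hgB _)⟩,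
    fun x => mul_nonneg (hw.nonneg x) (hg0 _), ⟨Bw * B, fun x => ?_⟩, fun x j hj hx => ?_, fun t x => ?_⟩
  · exact mul_le_mul (hBw x) (hgB _) (hg0 _) Bw.2
  · rw [hw.strip x j hj hx, zero_mul]
  · rw [hw.indep, repl_apply, if_neg hpo]

/-- A weight can be concentrated on a set of small measure, changing its integrals against
equi-Lipschitz functions arbitrarily little. -/
theorem IsWeight.exists_concentrated {d : ℕ} {o p : Fin d} (hpo : p ≠ o) {w : E d → ℝ}
    (hw : IsWeight o w) {δ η : ℝ} (hδ : 0 < δ) (hη : 0 < η) (Λ D : ℝ≥0) :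
    ∃ w' : E d → ℝ, IsWeight o w' ∧ (∀ x, w x = 0 → w' x = 0) ∧
      volume.real ({x | w' x ≠ 0} ∩ box o 0 1) ≤ δ ∧
      ∀ H : E d → ℝ, LipschitzWith Λ H → (∀ x, |H x| ≤ D) →
        |(∫ x in slab o 0 1, w' x * H x) - ∫ x in slab o 0 1, w x * H x| ≤ η := by
  obtain ⟨R, hR⟩ := (isCompact_box o 0 1 : IsCompact (box o 0 1)).isBounded.subset_closedBall (0 : E d)
  set v := volume.real (Metric.closedBall (0 : E d) (R + 1)) with hv
  have hv0 : 0 ≤ v := measureReal_nonneg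
  have hθ : 0 < min 1 (δ / (v + 1)) := lt_min one_pos (by positivity)
  obtain ⟨g, K, B, hgK, hg0, hgB, hgp, hg1, hgθ⟩ := exists_periodic_bump hθ (min_le_left _ _)
  obtain ⟨Kw, hKw⟩ := hw.lip
  obtain ⟨Bw, hBw⟩ := hw.bdd
  have hwB : ∀ x, |w x| ≤ Bw := fun x => by rw [abs_of_nonneg (hw.nonneg x)]; exact hBw x
  have hgB' : ∀ s, |g s| ≤ B := fun s => by rw [abs_of_nonneg (hg0 s)]; exact hgB s
  set L : ℝ := ((Bw * Λ + D * Kw : ℝ≥0) : ℝ) with hL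
  have hL0 : 0 ≤ L := NNReal.coe_nonneg _
  -- Over a shift of length `1/M` the product `w H` varies by at most `L / M`, uniformly in `H`;
  -- this is multiplied by the bound `B` of `g` and the volume `v`.
  obtain ⟨M, hM⟩ := exists_nat_gt (L * B * v / η)
  have hM0 : (0 : ℝ) < M := lt_of_le_of_lt (by positivity) hM
  have hMn : 0 < M := by exact_mod_cast hM0
  refine ⟨fun x => w x * g (M * x p), hw.mul_comp_coord hpo hgK hg0 hgB M, fun x hx => by simp [hx], ?_,
    fun H hHΛ hHD => ?_⟩
  · set T := box o 0 1 with hT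
    have hTm : MeasurableSet T := (isCompact_box o 0 1).isClosed.measurableSet
    set Z : Set ℝ := {s | g s ≠ 0} with hZ
    have hZm : MeasurableSet Z := hgK.continuous.measurable (measurableSet_singleton (0 : ℝ)).compl
    have hcm : Measurable fun x : E d => M * x p :=
      ((lipschitzWith_coord p).continuous.measurable).const_mul _
    -- With the indicators of the box and of `{g ≠ 0}`, the averaged bound controls the measure of
    -- the new support inside the box.
    have h1 := abs_integral_mul_periodic_le (d := d) (p := p) (F := T.indicator fun _ => (1 : ℝ))
      (g := Z.indicator fun _ => (1 : ℝ)) (M := M) (C := 1) (G := 1) (R := R) hMn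
      (measurable_const.indicator hTm) (abs_indicator_le (by simp) T)
      (fun x hx => Set.indicator_of_notMem (fun h => hx (hR h)) _)
      (measurable_const.indicator hZm) (abs_indicator_le (by simp) Z)
      (fun s => by
        by_cases hs : s ∈ Z
        · rw [Set.indicator_of_mem hs, Set.indicator_of_mem]
          rw [hZ, Set.mem_ofPred_eq, hgp s]; exact hs
        · rw [Set.indicator_of_notMem hs, Set.indicator_of_notMem]
          rw [hZ, Set.mem_ofPred_eq, hgp s]; exact hs)
      (fun s => Set.indicator_nonneg (fun _ _ => zero_le_one) s)
    have h2 : ∫ x, T.indicator (fun _ => (1 : ℝ)) x * Z.indicator (fun _ => (1 : ℝ)) (M * x p) =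
        volume.real (((fun x : E d => M * x p) ⁻¹' Z) ∩ T) := by
      rw [Set.inter_comm, ← integral_indicator_one (hTm.inter (hcm hZm))]
      congr 1
      ext x
      by_cases hx1 : x ∈ T <;> by_cases hx2 : M * x p ∈ Z <;> simp [Set.indicator, hx1, hx2]
    rw [h2, abs_of_nonneg measureReal_nonneg, one_mul] at h1
    refine (measureReal_mono ?_ (measure_ne_top_of_subset Set.inter_subset_right
      (isCompact_box o 0 1).measure_lt_top.ne)).trans (h1.trans ?_)
    · rintro x ⟨hx, hxT⟩
      exact ⟨fun h0 : g (M * x p) = 0 => hx (by simp [h0]), hxT⟩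
    · have h3 := hgθ.trans (min_le_right _ _)
      calc _ ≤ δ / (v + 1) * v := mul_le_mul_of_nonneg_right h3 hv0
        _ ≤ δ := by rw [div_mul_eq_mul_div, div_le_iff₀ (by positivity)]; nlinarith
  · have hwH : LipschitzWith (Bw * Λ + D * Kw) fun x => w x * H x := lipschitzWith_mul hKw hHΛ hwB hHD
    have hs := measurableSet_slab (d := d) o 0 1
    have hbd : ∀ x, |w x * H x| ≤ Bw * D := fun x => by
      rw [abs_mul]; exact mul_le_mul (hwB x) (hHD x) (abs_nonneg _) Bw.2
    have hvan : VanishesOffStrip o fun x => w x * H x := fun x j hj hx => by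
      simp only [hw.strip x j hj hx, zero_mul]
    have h1 := abs_integral_mul_periodic_sub_le (d := d) (p := p)
      (F := (slab o 0 1).indicator fun x => w x * H x) (g := g) (M := M) (C := Bw * D) (G := B) (R := R)
      hMn (hwH.continuous.measurable.indicator hs) (abs_indicator_le hbd _)
      (fun x hx => indicator_slab_eq_zero hvan fun h => hx (hR h)) hgK.continuous.measurable hgB' hgp
      (η := L * (1 / M)) (fun x t ht htM => by
        -- Shifts along `x_p` preserve the slab in direction `o`, so the jump of the indicator at
        -- its faces is harmless.
        have hmem : x + t • EuclideanSpace.single p (1 : ℝ) ∈ slab o 0 1 ↔ x ∈ slab o 0 1 := by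
          simp only [slab, Set.mem_ofPred_eq, shift_apply, if_neg hpo.symm]
        by_cases hx : x ∈ slab o 0 1
        · rw [Set.indicator_of_mem hx, Set.indicator_of_mem (hmem.2 hx)]
          refine (abs_sub_le_of_lipschitz hwH _ _).trans (mul_le_mul_of_nonneg_left ?_ hL0)
          rw [dist_eq_norm, add_sub_cancel_left, norm_smul, PiLp.norm_single, norm_one, mul_one,
            Real.norm_of_nonneg ht]
          exact htM
        · rw [Set.indicator_of_notMem hx, Set.indicator_of_notMem (hx ∘ hmem.1), sub_zero, abs_zero]
          positivity)
    rw [hg1, one_mul, integral_indicator hs] at h1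
    have h2 : ∫ x, (slab o 0 1).indicator (fun x => w x * H x) x * g (M * x p) =
        ∫ x in slab o 0 1, w x * g (M * x p) * H x := by
      rw [← integral_indicator hs]
      congr 1
      ext x
      by_cases hx : x ∈ slab o 0 1
      · rw [Set.indicator_of_mem hx, Set.indicator_of_mem hx]; ring
      · rw [Set.indicator_of_notMem hx, Set.indicator_of_notMem hx, zero_mul]
    rw [h2] at h1
    refine h1.trans ?_
    rw [← hv]
    rw [div_lt_iff₀ hη] at hM
    calc L * (1 / M) * B * v = L * B * v / M := by ring
      _ ≤ η := by rw [div_le_iff₀ hM0]; linarith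

/-! ### Inductive construction of an almost annihilating density -/

section

variable {d : ℕ} {o : Fin d}

theorem exists_weight (o : Fin d) : ∃ w : E d → ℝ, IsWeight o w ∧ 0 < ∫ x in slab o 0 1, w x := by
  set c : E d := WithLp.toLp 2 fun _ => (1 / 2 : ℝ) with hc
  set w : E d → ℝ := fun x => max 0 (1 / 2 - dist (repl o 0 x) (repl o 0 c)) with hw
  have hL : LipschitzWith 1 w := lipschitzWith_real fun x y => by
    refine (abs_max_sub_max_le_max 0 _ 0 _).trans ?_
    rw [sub_self, abs_zero, max_eq_right (abs_nonneg _), sub_sub_sub_cancel_left, NNReal.coe_one, one_mul]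
    refine (abs_dist_sub_le _ _ _).trans ?_
    rw [dist_comm]
    exact dist_repl_le o (by simp)
  have hle : ∀ x, w x ≤ 1 / 2 := fun x => max_le (by norm_num) (by
    have := dist_nonneg (x := repl o 0 x) (y := repl o 0 c)
    linarith)
  have hw0 : ∀ x, 0 ≤ w x := fun x => le_max_left _ _
  have hW : IsWeight o w := by
    refine ⟨⟨1, hL⟩, hw0, ⟨1, fun x => (hle x).trans (by norm_num)⟩, fun x j hj hx => ?_, fun t x => ?_⟩
    · refine max_eq_left (sub_nonpos.2 ?_)
      have h1 := abs_apply_le_norm (repl o 0 x - repl o 0 c) j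
      rw [PiLp.sub_apply, repl_apply, repl_apply, if_neg hj, if_neg hj, ← dist_eq_norm] at h1
      refine le_trans ?_ h1
      simp only [hc]
      by_contra hcon
      rw [not_le, abs_lt] at hcon
      exact hx ⟨by linarith [hcon.1], by linarith [hcon.2]⟩
    · simp only [hw, repl_repl]
  refine ⟨w, hW, ?_⟩
  rw [setIntegral_pos_iff_support_of_nonneg_ae (Filter.Eventually.of_forall hw0) (hW.integrableOn 0 1)]
  have hO : IsOpen {x : E d | 0 < w x ∧ x o ∈ Set.Ioo (0 : ℝ) 1} :=
    (isOpen_lt continuous_const hL.continuous).inter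
      (isOpen_Ioo.preimage (lipschitzWith_coord o).continuous)
  refine (hO.measure_pos volume ⟨c, ?_, ?_⟩).trans_le (measure_mono ?_)
  · simp [hw]
  · simp only [hc]; constructor <;> norm_num
  · rintro x ⟨h1, h2⟩
    exact ⟨h1.ne', h2.1.le, h2.2⟩

/-- Concentrating any weight of positive mass, tested against the constant 1, keeps at least half of
the mass. -/
theorem exists_weight_small (hd : ∃ p : Fin d, p ≠ o) {δ : ℝ} (hδ : 0 < δ) :
    ∃ w : E d → ℝ, IsWeight o w ∧ 0 < ∫ x in slab o 0 1, w x ∧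
      volume.real ({x | w x ≠ 0} ∩ box o 0 1) ≤ δ := by
  obtain ⟨p, hp⟩ := hd
  obtain ⟨w, hw, hpos⟩ := exists_weight o
  obtain ⟨w', hw', -, hv, hH⟩ := hw.exists_concentrated hp hδ (half_pos hpos) 0 1
  refine ⟨w', hw', ?_, hv⟩
  have := hH (fun _ => 1) (LipschitzWith.const _) (by simp)
  simp only [mul_one] at this
  have := (abs_le.1 this).1
  linarith

theorem setIntegral_abs_le_of_support {u : E d → ℝ} {C : ℝ} (hC : ∀ x, |u x| ≤ C)
    (hs : VanishesOffStrip o u) (Z : Set (E d)) :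
    ∫ x in slab o 0 1, Z.indicator (fun x => |u x|) x ≤ C * volume.real (Z ∩ box o 0 1) := by
  rw [← integral_indicator (measurableSet_slab o 0 1)]
  refine (le_abs_self _).trans (abs_integral_le_mul_volume
    (measure_ne_top_of_subset Set.inter_subset_right (isCompact_box o 0 1).measure_lt_top.ne)
    (abs_indicator_le (abs_indicator_le (fun x => by rw [abs_abs]; exact hC x) _) _) fun x hx => ?_)
  by_cases hxs : x ∈ slab o 0 1
  · rw [Set.indicator_of_mem hxs]
    by_cases hxZ : x ∈ Z
    · rw [Set.indicator_of_mem hxZ, abs_eq_zero]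
      exact hs.eq_zero_of_notMem_box (fun h => hx ⟨hxZ, h⟩) ⟨hxs.1, hxs.2.le⟩
    · exact Set.indicator_of_notMem hxZ _
  · exact Set.indicator_of_notMem hxs _

/-- Cancellation between `a` and `b` costs at most `2 |a|`, and only where `b ≠ 0`. A wave with tiny
support therefore adds almost its full `L^1` norm. -/
theorem abs_add_ge_indicator (a b : ℝ) : |a| + |b| - 2 * (if b ≠ 0 then |a| else 0) ≤ |a + b| := by
  split_ifs with h
  · have := abs_sub_le_add (a + b) a
    rw [add_sub_cancel_left] at this
    linarith
  · rw [not_not] at h; simp [h]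

/-- The states of the inductive construction of a density which almost annihilates all Jacobians:
`N` is the number of steps, `w₀` the initial weight and `t`, `b` are parameters. -/
def IsStage (o : Fin d) (w₀ : E d → ℝ) (m t b : ℝ) (N n : ℕ) (w u : E d → ℝ) : Prop :=
  IsWeight o w ∧ (∀ x, w₀ x = 0 → w x = 0) ∧ m / 2 < ∫ x in slab o 0 1, w x ∧
    ∫ x in slab o 0 1, w x < 2 * m ∧ Measurable u ∧ (∃ C : ℝ≥0, ∀ x, |u x| ≤ C) ∧
    (∀ x, w₀ x = 0 → u x = 0) ∧ N * (m / 4) ≤ ∫ x in slab o 0 1, |u x| ∧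
    ∀ (f : E d → ℝ) (h : Fin d → E d → ℝ), LipschitzWith 1 f → (∀ x, |f x| ≤ 1) →
      (∀ j, LipschitzWith 1 (h j)) →
      |∫ x in slab o 0 1, u x * (f x * jac h x)| ≤
        d.factorial * 7 ^ d * (t / 2 * ∫ x in slab o 0 1, w x * totalEnergy o n h x) + N * b

theorem IsWeight.vanishesOffStrip_of_zero {w u : E d → ℝ} (hw : IsWeight o w)
    (h : ∀ x, w x = 0 → u x = 0) : VanishesOffStrip o u := fun x j hj hx => h x (hw.strip x j hj hx)

theorem integrableOn_mul_lipschitz_jac {u f : E d → ℝ} {h : Fin d → E d → ℝ} (hu : Measurable u)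
    {C : ℝ≥0} (hC : ∀ x, |u x| ≤ C) (hs : VanishesOffStrip o u) (hf : LipschitzWith 1 f)
    (hf1 : ∀ x, |f x| ≤ 1) (hh : ∀ j, LipschitzWith 1 (h j)) :
    IntegrableOn (fun x => u x * (f x * jac h x)) (slab o 0 1) := by
  have := integrableOn_mul_jac (o := o) (χ := fun x => u x * f x) (B := C) hh
    (hu.mul hf.continuous.measurable) (fun x => by
      rw [abs_mul]
      exact (mul_le_of_le_one_right (abs_nonneg _) (hf1 x)).trans (hC x))
    (fun x j hj hx => by simp only [hs x j hj hx, zero_mul]) 0 1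
  simpa only [mul_assoc] using this

/-- The weight is first concentrated, then a much finer wave carrying it is added to `u`. The energy
increase from scale `n` to `n'` in the wave estimate replaces the old energy term by the new one, up
to the budget `b` of one step. -/
theorem IsStage.succ (hd : ∃ p : Fin d, p ≠ o) {w₀ w u : E d → ℝ} {m t e : ℝ} {N n : ℕ}
    (hw₀ : IsWeight o w₀) (hm : 0 < m) (ht : 0 < t) (he : 0 < e) (hn : 0 < n)
    (hS : IsStage o w₀ m t (d.factorial * 7 ^ d * (d * m / t) + e) N n w u) :
    ∃ n' w' u', 0 < n' ∧
      IsStage o w₀ m t (d.factorial * 7 ^ d * (d * m / t) + e) (N + 1) n' w' u' := by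
  obtain ⟨p, hp⟩ := hd
  obtain ⟨hw, hww, hwl, hwu, hum, ⟨Cu, hCu⟩, hu0, huN, hfh⟩ := hS
  set c : ℝ := d.factorial * 7 ^ d with hc
  have hc0 : 0 < c := by positivity
  have hd1 : (1 : ℝ) ≤ d := by exact_mod_cast o.pos
  set I := ∫ x in slab o 0 1, w x with hI
  -- The first two bounds keep the mass of the weight strictly between `m/2` and `2m`; the third
  -- lets the change of weight in the energy term at scale `n` cost at most `e/2`.
  set η := min (min ((I - m / 2) / 2) ((2 * m - I) / 2)) (e / (c * t)) with hη
  have hη0 : 0 < η := lt_min (lt_min (by linarith) (by linarith)) (by positivity)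
  -- The support bound makes the integral of `|u|` over the new support at most `m/8`. The constants
  -- `d (4n)` and `d` are the Lipschitz constant and bound of `totalEnergy o n h`, uniform in `h`.
  obtain ⟨w', hw', hz, hv, hH⟩ := hw.exists_concentrated hp (δ := m / (8 * (Cu + 1)))
    (by positivity) hη0 (d * (4 * n)) d
  obtain ⟨A, hA⟩ := abs_setIntegral_wave_mul_weight_le hw'
  -- The constant `A` depends on the Lipschitz constant of `w'`, so the fine scale is chosen only
  -- after the weight; then `A n / n' ≤ e/2`.
  obtain ⟨k, hk⟩ := exists_nat_gt (|A| / e)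
  have hk0 : (0 : ℝ) < k := lt_of_le_of_lt (by positivity) hk
  have hkn : 0 < k := by exact_mod_cast hk0
  have hn' : (0 : ℝ) < n := by exact_mod_cast hn
  set n' := n * (2 * k) with hn'_def
  have hn'0 : 0 < n' := by positivity
  have hA' : A * n / (n' : ℕ) ≤ e / 2 := by
    rw [hn'_def]; push_cast
    rw [div_lt_iff₀ he] at hk
    rw [div_le_iff₀ (by positivity)]
    nlinarith [le_abs_self A]
  obtain ⟨B, hB⟩ := hw'.bdd
  -- The constant 1 is an admissible test function because `d ≥ 1`.
  have hI' := hH (fun _ => 1) ((LipschitzWith.const (1 : ℝ)).weaken zero_le) (by simpa using hd1)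
  simp only [mul_one] at hI'
  rw [← hI] at hI'
  set I' := ∫ x in slab o 0 1, w' x with hI'_def
  have hη1 : η ≤ (I - m / 2) / 2 := (min_le_left _ _).trans (min_le_left _ _)
  have hη2 : η ≤ (2 * m - I) / 2 := (min_le_left _ _).trans (min_le_right _ _)
  have hη3 : η ≤ e / (c * t) := min_le_right _ _
  have hI1 : m / 2 < I' := by have := (abs_le.1 hI').1; linarith
  have hI2 : I' < 2 * m := by have := (abs_le.1 hI').2; linarith
  have hz0 : ∀ x, w₀ x = 0 → w' x = 0 := fun x hx => hz x (hww x hx)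
  set v : E d → ℝ := fun x => wave o n' x * w' x with hv_def
  have hvm : Measurable v := (measurable_wave n').mul hw'.measurable
  have hvabs : ∀ x, |v x| = w' x := fun x => by
    rw [hv_def]; simp only [abs_mul, abs_wave, one_mul, abs_of_nonneg (hw'.nonneg x)]
  have hvB : ∀ x, |v x| ≤ B := fun x => by rw [hvabs]; exact hB x
  have hv0 : ∀ x, w₀ x = 0 → v x = 0 := fun x hx => by simp only [hv_def, hz0 x hx, mul_zero]
  have hus := hw₀.vanishesOffStrip_of_zero hu0
  have hvs := hw₀.vanishesOffStrip_of_zero hv0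
  refine ⟨n', w', fun x => u x + v x, hn'0, hw', hz0, hI1, hI2, hum.add hvm,
    ⟨Cu + B, fun x => (abs_add_le _ _).trans (add_le_add (hCu x) (hvB x))⟩,
    fun x hx => by simp only [hu0 x hx, hv0 x hx, add_zero], ?_, fun f h hf hf1 hh => ?_⟩
  -- The gain in the `L^1` norm is at least `m/2 - 2 · m/8 = m/4`.
  · set Z : Set (E d) := {x | w' x ≠ 0} with hZ
    have hZm : MeasurableSet Z := hw'.measurable (measurableSet_singleton (0 : ℝ)).compl
    have huabs : IntegrableOn (fun x => |u x|) (slab o 0 1) := (integrableOn_slab hum hCu hus 0 1).abs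
    have h1 : ∫ x in slab o 0 1, (|u x| + w' x - 2 * Z.indicator (fun x => |u x|) x) ≤
        ∫ x in slab o 0 1, |u x + v x| := by
      refine integral_mono ((huabs.add (hw'.integrableOn 0 1)).sub ((huabs.indicator hZm).const_mul 2))
        ((integrableOn_slab hum hCu hus 0 1).add (integrableOn_slab hvm hvB hvs 0 1)).abs fun x => ?_
      have := abs_add_ge_indicator (u x) (v x)
      rw [hvabs] at this
      refine le_trans (le_of_eq ?_) this
      have hiff : v x ≠ 0 ↔ x ∈ Z := by rw [← abs_ne_zero, hvabs]; rfl
      simp only [Set.indicator_apply, hiff]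
    have e3 : ∫ x in slab o 0 1, (|u x| + w' x - 2 * Z.indicator (fun x => |u x|) x) =
        (∫ x in slab o 0 1, |u x|) + I' - 2 * ∫ x in slab o 0 1, Z.indicator (fun x => |u x|) x := by
      rw [← integral_const_mul, ← integral_add huabs (hw'.integrableOn 0 1)]
      exact integral_sub (huabs.add (hw'.integrableOn 0 1)) ((huabs.indicator hZm).const_mul 2)
    rw [e3] at h1
    have h2 := setIntegral_abs_le_of_support hCu hus Z
    have h3 : (Cu : ℝ) * volume.real (Z ∩ box o 0 1) ≤ m / 8 := by
      refine (mul_le_mul_of_nonneg_left hv Cu.coe_nonneg).trans ?_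
      rw [mul_div_assoc', div_le_div_iff₀ (by positivity) (by norm_num)]
      linarith
    push_cast
    linarith
  · have h1 := hfh f h hf hf1 hh
    have h2 := hA n k hn hkn t ht f h hf hf1 hh
    rw [← hn'_def] at h2
    have hE := hH (totalEnergy o n h) (lipschitzWith_totalEnergy hn hh) (abs_totalEnergy_le hn hh)
    have e1 : ∫ x in slab o 0 1, (u x + v x) * (f x * jac h x) =
        (∫ x in slab o 0 1, u x * (f x * jac h x)) +
          ∫ x in slab o 0 1, wave o n' x * (f x * w' x * jac h x) := by
      have : ∀ x, wave o n' x * (f x * w' x * jac h x) = v x * (f x * jac h x) := fun x => by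
        simp only [hv_def]; ring
      simp only [this, add_mul]
      exact integral_add (integrableOn_mul_lipschitz_jac hum hCu hus hf hf1 hh)
        (integrableOn_mul_lipschitz_jac hvm hvB hvs hf hf1 hh)
    have e2 : ∫ x in slab o 0 1, w' x * (totalEnergy o n' h x - totalEnergy o n h x) =
        (∫ x in slab o 0 1, w' x * totalEnergy o n' h x) -
          ∫ x in slab o 0 1, w' x * totalEnergy o n h x := by
      simp only [mul_sub]
      exact integral_sub
        (hw'.integrableOn_mul (lipschitzWith_totalEnergy hn'0 hh).continuous.measurable
          (abs_totalEnergy_le hn'0 hh) 0 1)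
        (hw'.integrableOn_mul (lipschitzWith_totalEnergy hn hh).continuous.measurable
          (abs_totalEnergy_le hn hh) 0 1)
    rw [e1]
    rw [e2] at h2
    refine (abs_add_le _ _).trans ((add_le_add h1 h2).trans ?_)
    have h3 := (abs_le.1 hE).1
    set X := ∫ x in slab o 0 1, w x * totalEnergy o n h x
    set Y := ∫ x in slab o 0 1, w' x * totalEnergy o n h x
    set W := ∫ x in slab o 0 1, w' x * totalEnergy o n' h x
    have h4 : c * (t / 2 * (X - Y)) ≤ e / 2 := by
      have : X - Y ≤ e / (c * t) := by linarith
      calc c * (t / 2 * (X - Y)) ≤ c * (t / 2 * (e / (c * t))) := by gcongr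
        _ = e / 2 := by field_simp
    -- The Young term, with the mass at most `2m`; together with two errors `e/2` it fills the
    -- budget of one step.
    have h5 : c * (d / (2 * t) * I') ≤ c * (d * m / t) := by
      have : (d : ℝ) / (2 * t) * I' ≤ d / (2 * t) * (2 * m) := by gcongr
      calc _ ≤ c * (d / (2 * t) * (2 * m)) := by gcongr
        _ = _ := by field_simp
    push_cast
    linarith

theorem exists_isStage (hd : ∃ p : Fin d, p ≠ o) {w₀ : E d → ℝ} {t e : ℝ}
    (hw₀ : IsWeight o w₀) (hm : 0 < ∫ x in slab o 0 1, w₀ x) (ht : 0 < t) (he : 0 < e) (N : ℕ) :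
    ∃ n w u, 0 < n ∧ IsStage o w₀ (∫ x in slab o 0 1, w₀ x) t
      (d.factorial * 7 ^ d * (d * (∫ x in slab o 0 1, w₀ x) / t) + e) N n w u := by
  induction N with
  | zero =>
    refine ⟨1, w₀, fun _ => 0, one_pos, hw₀, fun _ h => h, by linarith, by linarith, measurable_const,
      ⟨0, by simp⟩, fun _ _ => rfl, by simp, fun f h _ _ hh => ?_⟩
    simp only [zero_mul, integral_zero, abs_zero, Nat.cast_zero, add_zero]
    have : 0 ≤ ∫ x in slab o 0 1, w₀ x * totalEnergy o 1 h x :=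
      integral_nonneg fun x => mul_nonneg (hw₀.nonneg x) (totalEnergy_nonneg _ _ _)
    positivity
  | succ N ih =>
    obtain ⟨n, w, u, hn, hS⟩ := ih
    exact hS.succ hd hw₀ hm ht he hn

/-- There are densities with small support that almost annihilate all Lipschitz Jacobians. -/
theorem exists_almost_annihilating (hd : ∃ p : Fin d, p ≠ o) {δ ε : ℝ} (hδ : 0 < δ) (hε : 0 < ε) :
    ∃ (A : Set (E d)) (u : E d → ℝ), MeasurableSet A ∧ volume.real (A ∩ box o 0 1) ≤ δ ∧
      (∀ x ∉ A, u x = 0) ∧ VanishesOffStrip o u ∧ Measurable u ∧ (∃ C : ℝ≥0, ∀ x, |u x| ≤ C) ∧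
      0 < ∫ x in slab o 0 1, |u x| ∧
      ∀ (f : E d → ℝ) (h : Fin d → E d → ℝ), LipschitzWith 1 f → (∀ x, |f x| ≤ 1) →
        (∀ j, LipschitzWith 1 (h j)) →
        |∫ x in slab o 0 1, u x * (f x * jac h x)| ≤ ε * ∫ x in slab o 0 1, |u x| := by
  obtain ⟨w₀, hw₀, hm, hv⟩ := exists_weight_small hd hδ
  set m := ∫ x in slab o 0 1, w₀ x with hm_def
  set c : ℝ := d.factorial * 7 ^ d with hc
  have hc0 : 0 < c := by positivity
  have hd1 : (1 : ℝ) ≤ d := by exact_mod_cast o.pos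
  -- With this `t`, and with `e = ε m / 16`, a step costs `ε m / 8`. Then `N` is taken so large that
  -- the single energy term, at most `c t m d`, is below `N ε m / 8`. The total `N ε m / 4` is at
  -- most `ε ∫ |u|`.
  set t : ℝ := 16 * c * d / ε with ht_def
  have ht : 0 < t := by positivity
  obtain ⟨N, hN⟩ := exists_nat_gt (8 * c * t * d / ε)
  have hN0 : (0 : ℝ) < N := lt_of_le_of_lt (by positivity) hN
  obtain ⟨n, w, u, hn, hw, hww, hwl, hwu, hum, hC, hu0, huN, hfh⟩ :=
    exists_isStage hd hw₀ hm ht (e := ε * m / 16) (by positivity) N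
  refine ⟨{x | w₀ x ≠ 0}, u, hw₀.measurable (measurableSet_singleton (0 : ℝ)).compl, hv,
    fun x hx => hu0 x (not_not.1 hx), hw₀.vanishesOffStrip_of_zero hu0, hum, hC,
    lt_of_lt_of_le (by positivity) huN, fun f h hf hf1 hh => ?_⟩
  refine (hfh f h hf hf1 hh).trans ?_
  have h1 : ∫ x in slab o 0 1, w x * totalEnergy o n h x ≤ 2 * m * d := by
    have : ∫ x in slab o 0 1, w x * totalEnergy o n h x ≤ ∫ x in slab o 0 1, w x * d :=
      integral_mono (hw.integrableOn_mul (lipschitzWith_totalEnergy hn hh).continuous.measurable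
        (abs_totalEnergy_le hn hh) 0 1) ((hw.integrableOn 0 1).mul_const _) fun x =>
        mul_le_mul_of_nonneg_left (totalEnergy_le hn hh x) (hw.nonneg x)
    rw [integral_mul_const] at this
    nlinarith
  have h2 : c * (t / 2 * ∫ x in slab o 0 1, w x * totalEnergy o n h x) ≤ N * (ε * m / 8) := by
    rw [div_lt_iff₀ hε] at hN
    calc _ ≤ c * (t / 2 * (2 * m * d)) := by gcongr
      _ = (8 * c * t * d) * (m / 8) := by ring
      _ ≤ (N * ε) * (m / 8) := by gcongr
      _ = _ := by ring
  have h3 : c * (d * m / t) = ε * m / 16 := by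
    rw [ht_def]; field_simp
  rw [← hm_def, ← hc, h3]
  have h4 := mul_le_mul_of_nonneg_left huN hε.le
  linarith

end

/-! ### Passage to the cube and normalization of the data -/

section

variable {d : ℕ} {o : Fin d}

theorem cube_eq_box (o : Fin d) : cube d = box o 0 1 := by
  ext x
  refine ⟨fun h => ⟨h o, fun j _ => h j⟩, fun h j => ?_⟩
  by_cases hj : j = o
  · rw [hj]; exact h.1
  · exact h.2 j hj

theorem cube_eq_preimage : cube d = (WithLp.ofLp : E d → Fin d → ℝ) ⁻¹' Set.Icc 0 1 := by
  ext x
  simp [cube, Pi.le_def, forall_and]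

theorem isCompact_cube : IsCompact (cube d) := by
  rw [cube_eq_preimage]
  exact (PiLp.homeomorph 2 (fun _ : Fin d => ℝ)).isCompact_preimage.2 isCompact_Icc

/-- The faces are null sets; at the remaining points `fderivWithin` is the full derivative of any
extension. -/
theorem ae_cube_mem_nhds : ∀ᵐ x ∂cubeMeasure d, cube d ∈ 𝓝 x := by
  rw [cubeMeasure, ae_restrict_iff' isCompact_cube.measurableSet]
  have h0 := ae_all_iff.2 fun j : Fin d => ae_coord_ne j 0
  have h1 := ae_all_iff.2 fun j : Fin d => ae_coord_ne j 1
  filter_upwards [h0, h1] with x hx0 hx1 hx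
  have : cube d = ⋂ j : Fin d, (fun y : E d => y j) ⁻¹' Set.Icc (0 : ℝ) 1 := by
    ext y; simp [cube]
  rw [this, Filter.iInter_mem]
  intro j
  exact (lipschitzWith_coord j).continuous.continuousAt.preimage_mem_nhds
    (Icc_mem_nhds ((hx j).1.lt_of_ne' (hx0 j)) ((hx j).2.lt_of_ne (hx1 j)))

theorem setIntegral_cube_eq_slab {G : E d → ℝ} (h : VanishesOffStrip o G) :
    ∫ x, G x ∂cubeMeasure d = ∫ x in slab o 0 1, G x := by
  rw [cubeMeasure, ← integral_indicator isCompact_cube.measurableSet,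
    ← integral_indicator (measurableSet_slab o 0 1)]
  refine integral_congr_ae ?_
  filter_upwards [ae_coord_ne o 1] with x hx
  by_cases hs : x ∈ slab o 0 1
  · rw [Set.indicator_of_mem hs]
    by_cases hc : x ∈ cube d
    · rw [Set.indicator_of_mem hc]
    · rw [Set.indicator_of_notMem hc]
      rw [cube_eq_box o] at hc
      exact (h.eq_zero_of_notMem_box hc ⟨hs.1, hs.2.le⟩).symm
  · rw [Set.indicator_of_notMem hs, Set.indicator_of_notMem]
    exact fun hc => hs ⟨(hc o).1, (hc o).2.lt_of_ne hx⟩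

/-- The infimum defining `lipConst` is attained: each difference quotient is a lower bound of the
set of constants. -/
theorem IsLip.lipschitzOnWith {f : E d → ℝ} (hf : IsLip f) :
    LipschitzOnWith (lipConst f) f (cube d) := by
  refine LipschitzOnWith.of_dist_le_mul fun x hx y hy => ?_
  rcases eq_or_ne x y with rfl | hne
  · simp
  have hpos : 0 < nndist x y := pos_iff_ne_zero.2 (nndist_eq_zero.not.2 hne)
  have : nndist (f x) (f y) / nndist x y ≤ lipConst f :=
    le_csInf hf fun K hK => by
      rw [div_le_iff₀ hpos]
      exact hK.dist_le_mul x hx y hy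
  rw [div_le_iff₀ hpos] at this
  exact_mod_cast this

theorem IsLip.abs_le_supNorm {f : E d → ℝ} (hf : IsLip f) {x : E d} (hx : x ∈ cube d) :
    |f x| ≤ supNorm f := by
  have hb : BddAbove ((fun x => |f x|) '' cube d) :=
    (isCompact_cube.image_of_continuousOn hf.lipschitzOnWith.continuousOn.abs).bddAbove
  refine le_ciSup (f := fun x : cube d => |f x|) ?_ (⟨x, hx⟩ : cube d)
  rwa [Set.image_eq_range] at hb

theorem lipNorm_nonneg (f : E d → ℝ) : 0 ≤ lipNorm f := le_max_of_le_right (NNReal.coe_nonneg _)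

/-- Normalized extension of a function on the cube. -/
theorem IsLip.exists_normalized {f : E d → ℝ} (hf : IsLip f) :
    ∃ g : E d → ℝ, LipschitzWith 1 g ∧ (∀ x, |g x| ≤ 1) ∧ ∀ x ∈ cube d, f x = lipNorm f * g x := by
  obtain ⟨F, hF, hfF⟩ := hf.lipschitzOnWith.extend_real
  set N := lipNorm f with hN
  have hN0 : 0 ≤ N := lipNorm_nonneg f
  have hclamp : ∀ s : ℝ, |max (-1) (min 1 s)| ≤ 1 := fun s =>
    abs_le.2 ⟨le_max_left _ _, max_le (by norm_num) (min_le_left _ _)⟩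
  -- Rescale a Lipschitz extension and truncate. If the norm vanishes, its inverse is `0` by
  -- convention and `f` is zero on the cube.
  refine ⟨fun x => max (-1) (min 1 (N⁻¹ * F x)), lipschitzWith_real fun x y => ?_, fun x => hclamp _,
    fun x hx => ?_⟩
  · refine (abs_max_sub_max_le_max _ _ _ _).trans ?_
    rw [sub_self, abs_zero, max_eq_right (abs_nonneg _)]
    refine (abs_min_sub_min_le_max _ _ _ _).trans ?_
    rw [sub_self, abs_zero, max_eq_right (abs_nonneg _), ← mul_sub, abs_mul,
      abs_of_nonneg (inv_nonneg.2 hN0), NNReal.coe_one, one_mul]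
    calc N⁻¹ * |F x - F y| ≤ N⁻¹ * (N * dist x y) := by
          refine mul_le_mul_of_nonneg_left ((abs_sub_le_of_lipschitz hF x y).trans ?_) (inv_nonneg.2 hN0)
          exact mul_le_mul_of_nonneg_right (le_max_right _ _) dist_nonneg
      _ = (N⁻¹ * N) * dist x y := by ring
      _ ≤ dist x y := mul_le_of_le_one_left dist_nonneg inv_mul_le_one
  · have h1 : |f x| ≤ N := (hf.abs_le_supNorm hx).trans (le_max_left _ _)
    rcases hN0.eq_or_lt with h0 | hpos
    · rw [← h0] at h1 ⊢
      rw [zero_mul]; exact abs_nonpos_iff.1 h1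
    · simp only
      rw [← hfF hx, min_eq_right, max_eq_right, mul_inv_cancel_left₀ hpos.ne']
      · rw [inv_mul_eq_div, le_div_iff₀ hpos]; linarith [(abs_le.1 h1).1]
      · rw [inv_mul_eq_div, div_le_one hpos]; exact (abs_le.1 h1).2

/-- Each component is extended and divided by its Lipschitz constant, which leaves its row of the
Jacobian matrix as a factor. A component with constant zero has zero gradient, so the identity
persists with the inverse read as `0`. -/
theorem exists_normalized_map {π : Fin d → E d → ℝ} (hπ : ∀ j, IsLip (π j)) :
    ∃ h : Fin d → E d → ℝ, (∀ j, LipschitzWith 1 (h j)) ∧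
      ∀ᵐ x ∂cubeMeasure d, jacobian π x = (∏ j, (lipConst (π j) : ℝ)) * jac h x := by
  choose F hF hπF using fun j => (hπ j).lipschitzOnWith.extend_real
  have hL : ∀ j, LipschitzWith 1 fun x => (lipConst (π j) : ℝ)⁻¹ * F j x := fun j =>
    lipschitzWith_real fun x y => by
      rw [← mul_sub, abs_mul, abs_of_nonneg (inv_nonneg.2 (NNReal.coe_nonneg _)), NNReal.coe_one, one_mul]
      calc _ ≤ (lipConst (π j) : ℝ)⁻¹ * (lipConst (π j) * dist x y) :=
            mul_le_mul_of_nonneg_left (abs_sub_le_of_lipschitz (hF j) x y)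
              (inv_nonneg.2 (NNReal.coe_nonneg _))
        _ = ((lipConst (π j) : ℝ)⁻¹ * lipConst (π j)) * dist x y := by ring
        _ ≤ dist x y := mul_le_of_le_one_left dist_nonneg inv_mul_le_one
  refine ⟨_, hL, ?_⟩
  filter_upwards [ae_cube_mem_nhds] with x hx
  have hrow : ∀ j k, fderivWithin ℝ (π j) (cube d) x (EuclideanSpace.single k (1 : ℝ)) =
      lipConst (π j) * grad (fun x => (lipConst (π j) : ℝ)⁻¹ * F j x) x k := by
    intro j k
    have e1 : fderivWithin ℝ (π j) (cube d) x = fderiv ℝ (F j) x := by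
      rw [fderivWithin_of_mem_nhds hx]
      exact Filter.EventuallyEq.fderiv_eq (Filter.eventuallyEq_of_mem hx (hπF j))
    rw [e1]
    by_cases h0 : lipConst (π j) = 0
    · have := abs_grad_le (hF j) x k
      rw [h0, NNReal.coe_zero] at this
      rw [h0, NNReal.coe_zero, zero_mul]
      exact abs_nonpos_iff.1 this
    · have h0' : (lipConst (π j) : ℝ) ≠ 0 := NNReal.coe_ne_zero.2 h0
      simp only [grad]
      have e2 : (fun x => (lipConst (π j) : ℝ)⁻¹ * F j x) = (lipConst (π j) : ℝ)⁻¹ • F j := rfl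
      rw [e2, fderiv_const_smul_field]
      simp [h0']
  simp only [jacobian, hrow]
  exact Matrix.det_mul_column _ _

/-- The estimate on the cube, for data that are not normalized. -/
theorem abs_integral_mul_jacobian_le {u : E d → ℝ} {e : ℝ} (hu : VanishesOffStrip o u)
    (hfh : ∀ (f : E d → ℝ) (h : Fin d → E d → ℝ), LipschitzWith 1 f → (∀ x, |f x| ≤ 1) →
      (∀ j, LipschitzWith 1 (h j)) → |∫ x in slab o 0 1, u x * (f x * jac h x)| ≤ e)
    {f : E d → ℝ} {π : Fin d → E d → ℝ} (hf : IsLip f) (hπ : ∀ j, IsLip (π j)) :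
    |∫ x, u x * (f x * jacobian π x) ∂cubeMeasure d| ≤
      e * (lipNorm f * ∏ j, (lipConst (π j) : ℝ)) := by
  obtain ⟨g, hg, hg1, hfg⟩ := hf.exists_normalized
  obtain ⟨h, hh, hπh⟩ := exists_normalized_map hπ
  have h1 : ∫ x, u x * (f x * jacobian π x) ∂cubeMeasure d =
      (lipNorm f * ∏ j, (lipConst (π j) : ℝ)) * ∫ x, u x * (g x * jac h x) ∂cubeMeasure d := by
    rw [← integral_const_mul]
    refine integral_congr_ae ?_
    filter_upwards [hπh, ae_restrict_mem isCompact_cube.measurableSet] with x hx hxc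
    rw [hx, hfg x hxc]; ring
  have h0 : 0 ≤ lipNorm f * ∏ j, (lipConst (π j) : ℝ) :=
    mul_nonneg (lipNorm_nonneg f) (Finset.prod_nonneg fun _ _ => NNReal.coe_nonneg _)
  rw [h1, abs_mul, abs_of_nonneg h0, mul_comm,
    setIntegral_cube_eq_slab (o := o) fun x j hj hx => by simp only [hu x j hj hx, zero_mul]]
  exact mul_le_mul_of_nonneg_right (hfh g h hg hg1 hh) h0

end

/-! ### Weak-star limits, smoothing and duality -/

section

open Filter

variable {d : ℕ}

instance isFiniteMeasure_cubeMeasure : IsFiniteMeasure (cubeMeasure d) :=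
  ⟨by rw [cubeMeasure, Measure.restrict_apply_univ]; exact isCompact_cube.measure_lt_top⟩

theorem eventually_mem_of_isOpen_weakStar {V : Set (Linfty d)} (hV : IsOpen[weakStar d] V)
    {ι : Type*} {l : Filter ι} {R : ι → Linfty d} {ρ : Linfty d} (hρ : ρ ∈ V)
    (h : ∀ v : Lone d, Tendsto (fun i => ∫ x, v x * R i x ∂cubeMeasure d) l
      (𝓝 (∫ x, v x * ρ x ∂cubeMeasure d))) : ∀ᶠ i in l, R i ∈ V := by
  have h1 : Tendsto R l (@nhds _ (weakStar d) ρ) := by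
    rw [weakStar, nhds_induced, tendsto_comap_iff, tendsto_pi_nhds]
    exact h
  exact h1 (@IsOpen.mem_nhds (Linfty d) (weakStar d) ρ V hV hρ)

theorem isOpen_weakStar_lt (v : Lone d) (a : ℝ) :
    IsOpen[weakStar d] {ρ : Linfty d | a < ∫ x, v x * ρ x ∂cubeMeasure d} := by
  have h : @Continuous _ _ (weakStar d) _ fun ρ : Linfty d => ∫ x, v x * ρ x ∂cubeMeasure d :=
    @Continuous.comp _ _ _ (weakStar d) _ _ _ (fun φ : Lone d → ℝ => φ v) (continuous_apply v)
      (@continuous_induced_dom _ _ (fun (ρ : Linfty d) (u : Lone d) =>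
        ∫ x, u x * ρ x ∂cubeMeasure d) _)
  exact @IsOpen.preimage _ _ (weakStar d) _ _ h _ isOpen_Ioi

/-- The element of `L^∞(Q)` represented by a bounded measurable function. -/
def toLinfty (r : E d → ℝ) (hr : Measurable r) (hb : ∀ x, |r x| ≤ 2) : Linfty d :=
  (memLp_top_of_bound (μ := cubeMeasure d) hr.aestronglyMeasurable 2 (Eventually.of_forall hb)).toLp r

section toLinfty

variable {r : E d → ℝ} (hr : Measurable r) (hb : ∀ x, |r x| ≤ 2)

theorem coeFn_toLinfty : toLinfty r hr hb =ᵐ[cubeMeasure d] r := MemLp.coeFn_toLp _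

theorem norm_toLinfty_le : ‖toLinfty r hr hb‖ ≤ 2 := by
  have h := Lp.norm_le_of_ae_bound (f := toLinfty r hr hb) zero_le_two (by
    filter_upwards [coeFn_toLinfty hr hb] with x hx
    rw [hx]; exact hb x)
  simpa using h

theorem integral_mul_toLinfty (v : E d → ℝ) :
    ∫ x, v x * toLinfty r hr hb x ∂cubeMeasure d = ∫ x, v x * r x ∂cubeMeasure d :=
  integral_congr_ae (by filter_upwards [coeFn_toLinfty hr hb] with x hx; rw [hx])

/-- Truncating a representative makes the almost everywhere bound hold everywhere, as the later
pointwise constructions need. -/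
theorem exists_toLinfty_eq {σ : Linfty d} (hσ : ‖σ‖ ≤ 2) :
    ∃ (r : E d → ℝ) (hr : Measurable r) (hb : ∀ x, |r x| ≤ 2), toLinfty r hr hb = σ := by
  have hm : Measurable σ := (Lp.stronglyMeasurable σ).measurable
  refine ⟨fun x => max (-2) (min 2 (σ x)), measurable_const.max (measurable_const.min hm),
    fun x => abs_le.2 ⟨le_max_left _ _, max_le (by norm_num) (min_le_left _ _)⟩, ?_⟩
  refine Lp.ext ?_
  refine (coeFn_toLinfty _ _).trans ?_
  have h1 : ∀ᵐ x ∂cubeMeasure d, ‖σ x‖ₑ ≤ eLpNormEssSup σ (cubeMeasure d) := ae_le_eLpNormEssSup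
  filter_upwards [h1] with x hx
  have h2 : |σ x| ≤ 2 := by
    refine le_trans ?_ hσ
    rw [Lp.norm_def, eLpNorm_exponent_top, ← Real.norm_eq_abs, ← toReal_enorm]
    refine ENNReal.toReal_mono ?_ hx
    rw [← eLpNorm_exponent_top]
    exact Lp.eLpNorm_ne_top σ
  rw [min_eq_right (abs_le.1 h2).2, max_eq_right (abs_le.1 h2).1]

end toLinfty

theorem tendsto_integral_mul_of_ae_tendsto {v : E d → ℝ} (hv : Integrable v (cubeMeasure d))
    {R : ℕ → E d → ℝ} {r : E d → ℝ} (hR : ∀ n, Measurable (R n)) (hb : ∀ n x, |R n x| ≤ 2)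
    (h : ∀ᵐ x ∂cubeMeasure d, Tendsto (fun n => R n x) atTop (𝓝 (r x))) :
    Tendsto (fun n => ∫ x, v x * R n x ∂cubeMeasure d) atTop
      (𝓝 (∫ x, v x * r x ∂cubeMeasure d)) := by
  refine tendsto_integral_of_dominated_convergence (fun x => |v x| * 2)
    (fun n => hv.aestronglyMeasurable.mul (hR n).aestronglyMeasurable) (hv.abs.mul_const 2)
    (fun n => Eventually.of_forall fun x => ?_) ?_
  · rw [Real.norm_eq_abs, abs_mul]
    exact mul_le_mul_of_nonneg_left (hb n x) (abs_nonneg _)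
  · filter_upwards [h] with x hx using hx.const_mul _

/-- Bounded changes on sets of vanishing measure are weak-star negligible, by absolute continuity of
the integral of `|v|`. -/
theorem tendsto_integral_mul_of_eq_off {v : E d → ℝ} (hv : Integrable v (cubeMeasure d))
    {R : ℕ → E d → ℝ} {r : E d → ℝ} {A : ℕ → Set (E d)} (hA : ∀ n, MeasurableSet (A n))
    (hAt : Tendsto (fun n => cubeMeasure d (A n)) atTop (𝓝 0))
    (hR : ∀ n, Measurable (R n)) (hb : ∀ n x, |R n x| ≤ 2) (hr : Measurable r) (hrb : ∀ x, |r x| ≤ 2)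
    (h : ∀ n, ∀ x ∉ A n, R n x = r x) :
    Tendsto (fun n => ∫ x, v x * R n x ∂cubeMeasure d) atTop
      (𝓝 (∫ x, v x * r x ∂cubeMeasure d)) := by
  have hmul : ∀ {s : E d → ℝ}, Measurable s → (∀ x, |s x| ≤ 2) →
      Integrable (fun x => v x * s x) (cubeMeasure d) := fun hs hsb =>
    hv.mul_bdd hs.aestronglyMeasurable (Eventually.of_forall hsb)
  have h0 : Tendsto (fun n => 4 * ∫ x in A n, |v x| ∂cubeMeasure d) atTop (𝓝 (4 * 0)) :=
    (hv.abs.tendsto_setIntegral_nhds_zero hAt).const_mul 4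
  rw [mul_zero] at h0
  rw [tendsto_iff_dist_tendsto_zero]
  refine squeeze_zero (fun n => dist_nonneg) (fun n => ?_) h0
  rw [Real.dist_eq, ← integral_sub (hmul (hR n) (hb n)) (hmul hr hrb), ← integral_const_mul,
    ← integral_indicator (hA n)]
  refine norm_integral_le_of_norm_le (f := fun x => v x * R n x - v x * r x)
    ((hv.abs.const_mul 4).indicator (hA n)) (Eventually.of_forall fun x => ?_)
  by_cases hx : x ∈ A n
  · rw [Set.indicator_of_mem hx, Real.norm_eq_abs, ← mul_sub, abs_mul, mul_comm]
    refine mul_le_mul_of_nonneg_right ?_ (abs_nonneg _)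
    refine (abs_sub_le_add _ _).trans ?_
    have h1 := hb n x
    have h2 := hrb x
    linarith
  · rw [Set.indicator_of_notMem hx, h n x hx, sub_self, norm_zero]

/-- A bounded measurable function is the almost everywhere limit of smooth functions with the same
bound. -/
theorem exists_smooth_tendsto {r : E d → ℝ} (hr : Measurable r) (hb : ∀ x, |r x| ≤ 2) :
    ∃ R : ℕ → E d → ℝ, (∀ n, ContDiff ℝ (⊤ : ℕ∞) (R n)) ∧ (∀ n x, |R n x| ≤ 2) ∧
      ∀ᵐ x, Tendsto (fun n => R n x) atTop (𝓝 (r x)) := by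
  have hloc : LocallyIntegrable r volume := by
    refine (locallyIntegrable_const (2 : ℝ)).mono hr.aestronglyMeasurable
      (Eventually.of_forall fun x => ?_)
    simpa using hb x
  set φ : ℕ → ContDiffBump (0 : E d) := fun n =>
    ⟨1 / (n + 1 : ℝ), 2 * (1 / (n + 1 : ℝ)), by positivity, by
      have : (0 : ℝ) < 1 / (n + 1 : ℝ) := by positivity
      linarith⟩ with hφ
  refine ⟨fun n => convolution ((φ n).normed volume) r (ContinuousLinearMap.lsmul ℝ ℝ) volume,
    fun n => ?_, fun n x => ?_, ?_⟩
  · exact (φ n).hasCompactSupport_normed.contDiff_convolution_left _ (φ n).contDiff_normed hloc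
  · simp only [convolution_def]
    have hi : Integrable (fun t => (φ n).normed volume t * 2) volume :=
      (φ n).integrable_normed.mul_const 2
    refine (norm_integral_le_of_norm_le (f := fun t => (ContinuousLinearMap.lsmul ℝ ℝ)
      ((φ n).normed volume t) (r (x - t))) hi (Eventually.of_forall fun t => ?_)).trans ?_
    · rw [ContinuousLinearMap.lsmul_apply, norm_smul, Real.norm_of_nonneg ((φ n).nonneg_normed t)]
      exact mul_le_mul_of_nonneg_left (hb _) ((φ n).nonneg_normed t)
    · rw [integral_mul_const, (φ n).integral_normed, one_mul]
  · refine ContDiffBump.ae_convolution_tendsto_right_of_locallyIntegrable (K := 2) (φ := φ) ?_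
      (Eventually.of_forall fun n => le_rfl) hloc
    have := (tendsto_one_div_add_atTop_nhds_zero_nat (𝕜 := ℝ)).const_mul 2
    rwa [mul_zero] at this

/-- A density that almost annihilates Jacobians bounds the size of formal Lipschitz sums below. -/
theorem FormalLipschitzSum.integral_le {v : Lone d} {e : ℝ} (F : FormalLipschitzSum d) {ρ : Linfty d}
    (hF : F.Solves ρ)
    (h : ∀ i, |∫ x, v x * (F.f i x * jacobian (F.π i) x) ∂cubeMeasure d| ≤
      e * (lipNorm (F.f i) * ∏ j, (lipConst (F.π i j) : ℝ))) :
    ∫ x, v x * ρ x ∂cubeMeasure d ≤ e * F.size := by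
  obtain ⟨g, hg, -, hsum⟩ := hF
  have h1 := hsum.mapL ((ContinuousLinearMap.mul ℝ ℝ).lpPairing (cubeMeasure d) 1 ∞ v)
  simp only [ContinuousLinearMap.lpPairing_eq_integral, ContinuousLinearMap.mul_apply'] at h1
  refine hasSum_le (fun i => ?_) h1 (F.summable.hasSum.mul_left e)
  refine (le_abs_self _).trans ((le_of_eq ?_).trans (h i))
  congr 1
  exact integral_congr_ae (by filter_upwards [hg i] with x hx; rw [hx])

end

/-! ### From testing densities to the theorem -/

section

open Filter

variable {d : ℕ}

/-- With `ε = 1/(S + 1)` every solution satisfies `∫ u ρ ≤ (I/(S + 1)) s`, where `I = ∫ |u|`. The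
threshold `a = I S/(S + 1)` thus forces `s > S`, while staying below the value `2 I` attained by `2
sign u`. -/
theorem exists_testing_density (hd : 2 ≤ d) {δ S : ℝ} (hδ : 0 < δ) (hS : 0 ≤ S) :
    ∃ (A : Set (E d)) (u : E d → ℝ) (a : ℝ), MeasurableSet A ∧ (cubeMeasure d).real A ≤ δ ∧
      Measurable u ∧ (∀ x ∉ A, u x = 0) ∧ Integrable u (cubeMeasure d) ∧
      a < 2 * ∫ x, |u x| ∂cubeMeasure d ∧
      ∀ v : Lone d, v =ᵐ[cubeMeasure d] u → ∀ ρ : Linfty d, a < ∫ x, v x * ρ x ∂cubeMeasure d →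
        ∀ F : FormalLipschitzSum d, F.Solves ρ → S < F.size := by
  set o : Fin d := ⟨0, by omega⟩ with ho
  have hp : ∃ p : Fin d, p ≠ o := ⟨⟨1, by omega⟩, by simp [ho]⟩
  obtain ⟨A, u, hA, hAδ, huA, hus, hum, ⟨C, hC⟩, hpos, hfh⟩ :=
    exists_almost_annihilating hp hδ (ε := 1 / (S + 1)) (by positivity)
  have hI : ∫ x, |u x| ∂cubeMeasure d = ∫ x in slab o 0 1, |u x| :=
    setIntegral_cube_eq_slab fun x j hj hx => by rw [hus x j hj hx, abs_zero]
  set I := ∫ x in slab o 0 1, |u x| with hI_def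
  refine ⟨A, u, 1 / (S + 1) * I * S, hA, ?_, hum, huA, ?_, ?_, fun v hv ρ hρ F hF => ?_⟩
  · rw [cubeMeasure, measureReal_restrict_apply hA, cube_eq_box o]
    exact hAδ
  · exact Integrable.of_bound hum.aestronglyMeasurable C (Eventually.of_forall hC)
  · rw [hI]
    have : 1 / (S + 1) * I * S = I * (S / (S + 1)) := by ring
    rw [this]
    have h1 : S / (S + 1) ≤ 1 := (div_le_one (by linarith)).2 (by linarith)
    nlinarith
  · have h1 := F.integral_le (v := v) (e := 1 / (S + 1) * I) hF fun i => by
      have h2 := abs_integral_mul_jacobian_le hus hfh (F.isLip_f i) (F.isLip_π i)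
      refine le_trans (le_of_eq ?_) h2
      congr 1
      exact integral_congr_ae (by filter_upwards [hv] with x hx; rw [hx])
    exact lt_of_mul_lt_mul_left (hρ.trans_le h1) (by positivity)

theorem exists_smooth_near {V : Set (Linfty d)} (hV : IsOpen[weakStar d] V) {r : E d → ℝ}
    (hr : Measurable r) (hb : ∀ x, |r x| ≤ 2) (h : toLinfty r hr hb ∈ V) :
    ∃ ρ ∈ V, IsSmooth ρ ∧ ‖ρ‖ ≤ 2 := by
  obtain ⟨R, hR, hRb, hlim⟩ := exists_smooth_tendsto hr hb
  have hRm : ∀ n, Measurable (R n) := fun n => (hR n).continuous.measurable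
  obtain ⟨n, hn⟩ := (eventually_mem_of_isOpen_weakStar hV h
    (R := fun n => toLinfty (R n) (hRm n) (hRb n)) (l := atTop) fun v => by
      simp only [integral_mul_toLinfty]
      exact tendsto_integral_mul_of_ae_tendsto (L1.integrable_coeFn v) hRm hRb
        (ae_restrict_of_ae hlim)).exists
  exact ⟨_, hn, ⟨R n, hR n, coeFn_toLinfty _ _⟩, norm_toLinfty_le _ _⟩

end

end PrescribedJacobian

end

theorem theorem5 (d : ℕ) (hd : 2 ≤ d)
    (σ : PrescribedJacobian.Linfty d) (hσ : ‖σ‖ ≤ 2)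
    (V : Set (PrescribedJacobian.Linfty d))
    (hV : IsOpen[PrescribedJacobian.weakStar d] V) (hσV : σ ∈ V)
    (S : ℝ) (hS : 0 ≤ S) :
    ∃ ρ₀ : PrescribedJacobian.Linfty d,
      PrescribedJacobian.IsSmooth ρ₀ ∧ ‖ρ₀‖ ≤ 2 ∧ ρ₀ ∈ V ∧
      ∃ U : Set (PrescribedJacobian.Linfty d),
        IsOpen[PrescribedJacobian.weakStar d] U ∧ ρ₀ ∈ U ∧
        ∀ ρ ∈ U, ∀ F : PrescribedJacobian.FormalLipschitzSum d,
          F.Solves ρ → S < F.size := by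
  open PrescribedJacobian Filter in
  classical
  obtain ⟨r, hr, hb, rfl⟩ := exists_toLinfty_eq hσ
  choose A u a hA hAδ hum huA hui ha hF using fun n : ℕ =>
    exists_testing_density hd (δ := 1 / (n + 1 : ℝ)) (by positivity) hS
  -- The original function is kept off `A n` and replaced by `2 sign u` on it. As the measure of `A
  -- n` tends to zero, these functions tend weak-star to it and eventually lie in `V`.
  set R : ℕ → E d → ℝ := fun n x => if x ∈ A n then (if 0 ≤ u n x then 2 else -2) else r x with hR
  have hRm : ∀ n, Measurable (R n) := fun n =>
    Measurable.ite (hA n) (Measurable.ite (measurableSet_le measurable_const (hum n))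
      measurable_const measurable_const) hr
  have hRb : ∀ n x, |R n x| ≤ 2 := fun n x => by
    simp only [hR]
    split_ifs
    · norm_num
    · norm_num
    · exact hb x
  have hAt : Tendsto (fun n => cubeMeasure d (A n)) atTop (𝓝 0) := by
    have h0 : Tendsto (fun n => (cubeMeasure d).real (A n)) atTop (𝓝 0) :=
      squeeze_zero (fun n => measureReal_nonneg) hAδ tendsto_one_div_add_atTop_nhds_zero_nat
    simpa [measureReal_def, ENNReal.ofReal_toReal] using ENNReal.tendsto_ofReal h0
  obtain ⟨n, hn⟩ := (eventually_mem_of_isOpen_weakStar hV hσV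
    (R := fun n => toLinfty (R n) (hRm n) (hRb n)) (l := atTop) fun v => by
      simp only [integral_mul_toLinfty]
      exact tendsto_integral_mul_of_eq_off (L1.integrable_coeFn v) hA hAt hRm hRb hr hb
        fun n x hx => if_neg hx).exists
  set v : Lone d := (hui n).toL1 (u n) with hv_def
  have hv : v =ᵐ[cubeMeasure d] u n := (hui n).coeFn_toL1
  set U : Set (Linfty d) := {ρ | a n < ∫ x, v x * ρ x ∂cubeMeasure d} with hU_def
  have hU : IsOpen[weakStar d] U := isOpen_weakStar_lt v (a n)
  have hnU : toLinfty (R n) (hRm n) (hRb n) ∈ U := by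
    simp only [hU_def, Set.mem_ofPred_eq, integral_mul_toLinfty]
    refine (ha n).trans_le (le_of_eq ?_)
    rw [← integral_const_mul]
    refine integral_congr_ae ?_
    filter_upwards [hv] with x hx
    rw [hx]
    simp only [hR]
    split_ifs with h1 h2
    · rw [abs_of_nonneg h2, mul_comm]
    · rw [abs_of_neg (not_le.1 h2)]; ring
    · simp [huA n x h1]
  -- Both conditions are weak-star open, so a mollification of `R n` still satisfies them.
  obtain ⟨ρ, hρ, hs, hρ2⟩ := exists_smooth_near
    (@IsOpen.inter (Linfty d) (weakStar d) V U hV hU) (hRm n) (hRb n) ⟨hn, hnU⟩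
  exact ⟨ρ, hs, hρ2, hρ.1, U, hU, hρ.2, fun ρ' hρ' F => hF n v hv ρ' hρ' F⟩
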